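/- For $j\ge 0$ let $C(j)=\{x\in\mathbb R^3: 2^j\le |x|<2^{j+1}\}$, and let $C(-1)$ be the unit ball of $\mathbb R^3$. Put $$\|f\|_B=\sum_{j\ge -1}\Big(2^{j+1}\int_{C(j)}|f|^2\Big)^{1/2},\qquad \|u\|_{B^*}=\sup_{j\ge -1}\Big(2^{-j}\int_{C(j)}|u|^2\Big)^{1/2},$$ and let $B$, $B^*$ be the corresponding spaces of complex functions with finite norm. Weak-$*$ convergence $w^\varepsilon\to w$ in $B^*$ means $\int w^\varepsilon\bar v\to\int w\bar v$ for every $v\in B$. The Fourier transform is $\hat u(\xi)=(2\pi)^{-3}\int e^{-ix\cdot\xi}u(x)\,dx$, extended to tempered distributions. Let $S_0,S_1\in B$, let $q_1\in\mathbb R^3$ with $q_1\neq 0$, and let $\alpha_\varepsilon>0$ for $\varepsilon>0$, with $\alpha_\varepsilon\to 0$ as $\varepsilon\to 0^+$. For $\varepsilon>0$ let $u^\varepsilon\in L^2(\mathbb R^3)$ be the solution of $$-i\frac{\alpha_\varepsilon}{\varepsilon}u^\varepsilon+\Delta u^\varepsilon+\frac1{\varepsilon^2}u^\varepsilon=\frac1{\varepsilon^3}S_0\Big(\frac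 x\varepsilon\Big)+\frac1{\varepsilon^3}S_1\Big(\frac{x-q_1}\varepsilon\Big)\quad\text{in }\mathbb R^3,$$ and put $w_0^\varepsilon(x)=\varepsilon\,u^\varepsilon(\varepsilon x)$ and $w_1^\varepsilon(x)=\varepsilon\,u^\varepsilon(q_1+\varepsilon x)$ (that is, $\varepsilon^{(d-1)/2}u^\varepsilon(\cdot)$ with $d=3$). **Proposition.** The families $(w_0^\varepsilon)_{\varepsilon>0}$ and $(w_1^\varepsilon)_{\varepsilon>0}$ are uniformly bounded in $B^*$. As $\varepsilon\to0^+$ they converge weakly-$*$ in $B^*$ to the outgoing solutions $w_0,w_1\in B^*$ of $$\Delta w_0+w_0=S_0,\qquad \Delta w_1+w_1=S_1,$$ that is, to the solutions given in Fourier space, for $j=0,1$, by $$\widehat{w_j}(\xi)=\frac{-\widehat{S_j}(\xi)}{|\xi|^2-1+i0}=-\Big(\mathrm{p.v.}\Big(\frac1{|\xi|^2-1}\Big)-i\pi\,\delta(|\xi|^2-1)\Big)\widehat{S_j}(\xi).$$ Here, tested against any Schwartz function, the first quotient is the limit as $\delta\to0^+$ of $-\widehat{S_j}/(|\xi|^2-1+i\delta)$,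 the principal value term is the limit as $\eta\to0^+$ of $\mathbf 1_{\{||\xi|^2-1|>\eta\}}\widehat{S_j}/(|\xi|^2-1)$, and the delta term $\delta(|\xi|^2-1)\widehat{S_j}$ is the limit as $\eta\to0^+$ of $\frac1{2\eta}\mathbf 1_{\{||\xi|^2-1|<\eta\}}\widehat{S_j}$; all these limits exist. Moreover, the contribution of the other, shifted source vanishes in the limit: if $a^\varepsilon,b^\varepsilon\in B^*$ are the solutions of $$-i\alpha_\varepsilon\varepsilon a^\varepsilon+\Delta a^\varepsilon+a^\varepsilon=S_1\Big(x-\frac{q_1}\varepsilon\Big),\qquad -i\alpha_\varepsilon\varepsilon b^\varepsilon+\Delta b^\varepsilon+b^\varepsilon=S_0\Big(x+\frac{q_1}\varepsilon\Big),$$ then $a^\varepsilon\to0$ and $b^\varepsilon\to0$ weakly-$*$ in $B^*$ as $\varepsilon\to0^+$. -/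

import Mathlib

open MeasureTheory Filter
open scoped Topology ENNReal NNReal SchwartzMap

noncomputable section

namespace TwoSources

/-- The physical space `ℝ³` with its Euclidean norm. -/
abbrev E3 : Type := EuclideanSpace ℝ (Fin 3)

/-! ### The Agmon–Hörmander spaces `B` and `B*`

The rings `C(j)`, `j ≥ -1`, are indexed by `k = j + 1 : ℕ`. -/

/-- `annulus k` is `C(k - 1)`: the unit ball for `k = 0`, and `{2^(k-1) ≤ |x| < 2^k}` for `k ≥ 1`. -/
def annulus : ℕ → Set E3
  | 0 => Metric.ball 0 1
  | k + 1 => {x : E3 | (2 : ℝ) ^ k ≤ ‖x‖ ∧ ‖x‖ < (2 : ℝ) ^ (k + 1)}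

/-- `‖f‖_B = ∑_{j ≥ -1} (2^(j+1) ∫_{C(j)} |f|²)^(1/2)`, with `j = k - 1`. -/
def normB (f : E3 → ℂ) : ℝ≥0∞ :=
  ∑' k : ℕ, ((2 : ℝ≥0∞) ^ k * ∫⁻ x in annulus k, ‖f x‖ₑ ^ 2) ^ (1 / 2 : ℝ)

/-- `‖u‖_{B*} = sup_{j ≥ -1} (2^(-j) ∫_{C(j)} |u|²)^(1/2)`, with `-j = 1 - k`. -/
def normBstar (u : E3 → ℂ) : ℝ≥0∞ :=
  ⨆ k : ℕ, ((2 : ℝ≥0∞) ^ (1 - (k : ℤ)) * ∫⁻ x in annulus k, ‖u x‖ₑ ^ 2) ^ (1 / 2 : ℝ)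

def MemB (f : E3 → ℂ) : Prop := AEStronglyMeasurable f volume ∧ normB f < ∞

def MemBstar (u : E3 → ℂ) : Prop := AEStronglyMeasurable u volume ∧ normBstar u < ∞

/-- Weak-* convergence in `B*`, the dual of `B` for the pairing `⟨u, v⟩ = ∫ u v̄`. -/
def TendstoWeakStar (w : ℝ → E3 → ℂ) (l : Filter ℝ) (w₀ : E3 → ℂ) : Prop :=
  ∀ v : E3 → ℂ, MemB v →
    Tendsto (fun ε => ∫ x, w ε x * (starRingEnd ℂ) (v x)) l
      (𝓝 (∫ x, w₀ x * (starRingEnd ℂ) (v x)))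

/-! ### The Helmholtz equation -/

/-- `-iκ u + Δu + m u = f` in the sense of tempered distributions. -/
def IsHelmholtzSolution (κ m : ℝ) (u f : E3 → ℂ) : Prop :=
  ∀ φ : 𝓢(E3, ℂ),
    ∫ x, u x * (-Complex.I * (κ : ℂ) * φ x + Laplacian.laplacian (φ : E3 → ℂ) x + (m : ℂ) * φ x)
      = ∫ x, f x * φ x

/-- The source `S^ε(x) = ε⁻³ S₀(x/ε) + ε⁻³ S₁((x - q₁)/ε)`. -/
def source (S₀ S₁ : E3 → ℂ) (q₁ : E3) (ε : ℝ) (x : E3) : ℂ :=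
  ((ε : ℂ) ^ 3)⁻¹ * S₀ (ε⁻¹ • x) + ((ε : ℂ) ^ 3)⁻¹ * S₁ (ε⁻¹ • (x - q₁))

/-- The rescaled function `x ↦ ε^((d-1)/2) u(q + εx)` in dimension `d = 3`, where `(d-1)/2 = 1`. -/
def rescale (q : E3) (ε : ℝ) (u : E3 → ℂ) (x : E3) : ℂ := (ε : ℂ) * u (q + ε • x)

/-! ### Fourier transforms, normalised as `û(ξ) = (2π)⁻³ ∫ exp(-i x·ξ) u(x) dx` -/

/-- The Fourier transform of an integrable function. -/
def fourierInt (φ : E3 → ℂ) (ξ : E3) : ℂ :=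
  ((2 * Real.pi : ℂ) ^ 3)⁻¹ *
    ∫ x, Complex.exp (-Complex.I * ((inner ℝ x ξ : ℝ) : ℂ)) * φ x

open Classical in
/-- The Fourier–Plancherel transform of a square integrable function. Mathlib's transform, the
`L²`-continuous extension of `∫ exp(-2πi x·ξ) f(x) dx`, is brought to the normalisation above. -/
def fourierL2 (f : E3 → ℂ) (ξ : E3) : ℂ :=
  if h : MemLp f 2 (volume : Measure E3) then
    ((2 * Real.pi : ℂ) ^ 3)⁻¹ *
      (FourierTransform.fourier (h.toLp f) : Lp ℂ 2 (volume : Measure E3))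
        ((2 * Real.pi)⁻¹ • ξ)
  else 0

/-- The Fourier transform of (the tempered distribution defined by) `w`, tested against `φ`:
`⟨ŵ, φ⟩ = ⟨w, φ̂⟩`. -/
def fourierPairing (w : E3 → ℂ) (φ : 𝓢(E3, ℂ)) : ℂ := ∫ x, w x * fourierInt φ x

/-- `ŵ = -Ŝ / (|ξ|² - 1 + i0)` as distributions, i.e. `ŵ` is the limit in the sense of tempered
distributions of `-Ŝ / (|ξ|² - 1 + iδ)` as `δ → 0⁺`. -/
def HasOutgoingFourier (w S : E3 → ℂ) : Prop :=
  ∀ φ : 𝓢(E3, ℂ),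
    Tendsto
      (fun δ : ℝ => ∫ ξ : E3,
        -(fourierL2 S ξ) / ((‖ξ‖ : ℂ) ^ 2 - 1 + Complex.I * (δ : ℂ)) * φ ξ)
      (𝓝[>] 0) (𝓝 (fourierPairing w φ))

/-- `P = ⟨p.v.(1/(|ξ|² - 1)) Ŝ, φ⟩`. -/
def IsPrincipalValue (S : E3 → ℂ) (φ : 𝓢(E3, ℂ)) (P : ℂ) : Prop :=
  Tendsto
    (fun η : ℝ => ∫ ξ in {ξ : E3 | η < |‖ξ‖ ^ 2 - 1|},
      fourierL2 S ξ / ((‖ξ‖ : ℂ) ^ 2 - 1) * φ ξ)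
    (𝓝[>] 0) (𝓝 P)

/-- `D = ⟨δ(|ξ|² - 1) Ŝ, φ⟩`, where `δ(s)` is the limit of `(2η)⁻¹ 1_{|s| < η}` as `η → 0⁺`
(for continuous `Ŝ` this is half of the integral of `Ŝ φ` over the unit sphere). -/
def IsSphereDelta (S : E3 → ℂ) (φ : 𝓢(E3, ℂ)) (D : ℂ) : Prop :=
  Tendsto
    (fun η : ℝ => ((2 * η : ℝ) : ℂ)⁻¹ * ∫ ξ in {ξ : E3 | |‖ξ‖ ^ 2 - 1| < η},
      fourierL2 S ξ * φ ξ)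
    (𝓝[>] 0) (𝓝 D)

/-- `ŵ = -(p.v.(1/(|ξ|² - 1)) - iπ δ(|ξ|² - 1)) Ŝ` as distributions, including the existence of
the two products on the right. -/
def HasPvDeltaFourier (w S : E3 → ℂ) : Prop :=
  ∀ φ : 𝓢(E3, ℂ), ∃ P D : ℂ, IsPrincipalValue S φ P ∧ IsSphereDelta S φ D ∧
    fourierPairing w φ = -(P - Complex.I * (Real.pi : ℂ) * D)

/-- `w ∈ B*` is the outgoing solution of `Δw + w = S`. -/
structure IsOutgoingSolution (w S : E3 → ℂ) : Prop where
  memBstar : MemBstar w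
  solution : IsHelmholtzSolution 0 1 w S
  outgoing : HasOutgoingFourier w S
  pvDelta : HasPvDeltaFourier w S

/-! ### `B ⊆ L²`, so that `fourierL2` is meaningful on `B` -/

theorem iUnion_annulus : ⋃ k, annulus k = Set.univ := by
  refine Set.eq_univ_of_forall fun x => Set.mem_iUnion.2 ?_
  have hex : ∃ n : ℕ, ‖x‖ < (2 : ℝ) ^ n := pow_unbounded_of_one_lt _ one_lt_two
  classical
  have hs := Nat.find_spec hex
  have hm : ∀ m < Nat.find hex, ¬ ‖x‖ < (2 : ℝ) ^ m := fun m hm => Nat.find_min hex hm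
  refine ⟨Nat.find hex, ?_⟩
  rcases h : Nat.find hex with _ | k
  · rw [h] at hs
    simpa [annulus] using hs
  · rw [h] at hs hm
    exact ⟨not_lt.1 (hm k (Nat.lt_succ_self k)), hs⟩

theorem MemB.memLp {f : E3 → ℂ} (hf : MemB f) : MemLp f 2 (volume : Measure E3) := by
  refine ⟨hf.1, ?_⟩
  rw [eLpNorm_lt_top_iff_lintegral_rpow_enorm_lt_top (by norm_num) (by norm_num)]
  set a : ℕ → ℝ≥0∞ :=
    fun k => ((2 : ℝ≥0∞) ^ k * ∫⁻ x in annulus k, ‖f x‖ₑ ^ 2) ^ (1 / 2 : ℝ) with ha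
  have hsq : ∀ k, ∫⁻ x in annulus k, ‖f x‖ₑ ^ 2 ≤ a k * ∑' j, a j := fun k => by
    calc ∫⁻ x in annulus k, ‖f x‖ₑ ^ 2
        ≤ (2 : ℝ≥0∞) ^ k * ∫⁻ x in annulus k, ‖f x‖ₑ ^ 2 :=
          le_mul_of_one_le_left (zero_le) (one_le_pow₀ (by norm_num))
      _ = a k * a k := by
          rw [ha, ← ENNReal.rpow_add_of_nonneg _ _ (by norm_num) (by norm_num)]
          norm_num
      _ ≤ a k * ∑' j, a j := by gcongr; exact ENNReal.le_tsum k
  calc ∫⁻ x, ‖f x‖ₑ ^ ((2 : ℝ≥0∞).toReal)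
      = ∫⁻ x in ⋃ k, annulus k, ‖f x‖ₑ ^ 2 := by
        rw [iUnion_annulus, Measure.restrict_univ]
        norm_num
    _ ≤ ∑' k, ∫⁻ x in annulus k, ‖f x‖ₑ ^ 2 := lintegral_iUnion_le _ _
    _ ≤ ∑' k, a k * ∑' j, a j := ENNReal.tsum_le_tsum hsq
    _ = normB f * normB f := by rw [ENNReal.tsum_mul_right]; rfl
    _ < ∞ := ENNReal.mul_lt_top hf.2 hf.2

end TwoSources

end

noncomputable section

namespace TwoSources

open scoped FourierTransform

/-! ### The spaces `B` and `B*` -/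

/-! After the change of variables `x ↦ q + εx` both families solve one and the same problem, `-iκw +
Δw + w = F + G(· - h)`, with `κ = α_ε ε → 0⁺`; `F` is the source at the observed point and `G` the
other one, carried off to infinity by `h = ±q₁/ε`. With the transform `∫ e^{-2πi x·ξ}` and `p =
4π²|ξ|² - 1`, the pairing of `w` with `v ∈ B` is minus the form of the multiplier `1/(p + iκ)` at
`(F, v)`, minus the form of `e^{-2πi h·ξ}/(p + iκ)` at `(G, v)` (`integral_rescale_mul_conj`). All
claims become claims on these forms.

Uniform bound (`formBound_phase_mul_resolv`). Freezing the two frequencies transversal to a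
coordinate leaves a one-dimensional resolvent, whose kernel is a bounded exponential; so it acts on
`L¹` in that coordinate with values in `L²` in the others, a norm that `B` dominates. The identity
`∑ 4π²ξᵢ² = p + 1` writes `1/(p + iκ)`, up to a bounded multiplier, as minus the sum of three such
resolvents cut off to bounded transversal frequency. The mixed norms are translation invariant, so
the bound is uniform in `h` as well as in `κ`.

Limits. By the uniform bound and the density of Schwartz functions in `B`, it suffices to treat
Schwartz data. There `1/(p + iκ) = -i ∫₀^∞ e^{-κs} e^{isp} ds`, and the dispersive decay `s^{-3/2}`
of the Schrödinger group, integrable at infinity, permits dominated convergence: the limit `κ → 0⁺`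
exists, and the term displaced by `h` tends to zero by the Riemann–Lebesgue lemma at each time `s`.

Principal value and delta (`exists_tendsto_resolv_pv_delta`). The truncated `1/p` minus `1/(p +
iη)`, and the normalised indicator of `|p| < η`, are dilations `η⁻¹φ(p/η)` with `|φ| ≤ c/(1 + t²)`.
They are dominated by the Poisson kernel, the imaginary part of the resolvent up to sign, hence are
again uniformly bounded on `B × B`; on Schwartz data they converge to `∫ φ` times a density on the
sphere. The two integrals are `iπ` and `1`, which is the Sokhotski–Plemelj formula.

Finally `B*` is the dual of `B` (`IsBoundedAntilinear.exists_memBstar`), so the limit form is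
represented by a function, the outgoing solution. -/

theorem measurableSet_annulus (k : ℕ) : MeasurableSet (annulus k) := by
  cases k with
  | zero => exact measurableSet_ball
  | succ k =>
    exact (measurableSet_le measurable_const measurable_norm).inter
      (measurableSet_lt measurable_norm measurable_const)

theorem norm_lt_of_mem_annulus {k : ℕ} {x : E3} (hx : x ∈ annulus k) : ‖x‖ < 2 ^ k := by
  cases k with
  | zero => simpa [annulus] using hx
  | succ k => exact hx.2

theorem le_norm_of_mem_annulus {k j : ℕ} (hjk : j < k) {x : E3} (hx : x ∈ annulus k) :
    2 ^ j ≤ ‖x‖ := by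
  cases k with
  | zero => omega
  | succ k => exact (pow_le_pow_right₀ one_le_two (by omega)).trans hx.1

theorem pairwise_disjoint_annulus : Pairwise (Function.onFun Disjoint annulus) := by
  have key : ∀ i j, i < j → Disjoint (annulus i) (annulus j) := fun i j hij =>
    Set.disjoint_left.2 fun x hi hj =>
      absurd (norm_lt_of_mem_annulus hi) (not_lt.2 (le_norm_of_mem_annulus hij hj))
  intro i j hij
  rcases lt_or_gt_of_ne hij with h | h
  · exact key i j h
  · exact (key j i h).symm

theorem lintegral_eq_tsum_annulus (g : E3 → ℝ≥0∞) :
    ∫⁻ x, g x = ∑' k, ∫⁻ x in annulus k, g x := by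
  rw [← lintegral_iUnion measurableSet_annulus pairwise_disjoint_annulus, iUnion_annulus,
    Measure.restrict_univ]

theorem eLpNorm_two_eq {α : Type*} [MeasurableSpace α] (μ : Measure α) (f : α → ℂ) :
    eLpNorm f 2 μ = (∫⁻ x, ‖f x‖ₑ ^ 2 ∂μ) ^ (1 / 2 : ℝ) := by
  rw [eLpNorm_eq_lintegral_rpow_enorm_toReal (by norm_num) (by norm_num)]
  norm_num

theorem normB_eq (f : E3 → ℂ) :
    normB f = ∑' k : ℕ, ((2 : ℝ≥0∞) ^ k) ^ (1 / 2 : ℝ) *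
      eLpNorm f 2 (volume.restrict (annulus k)) := by
  simp only [normB, eLpNorm_two_eq]
  exact tsum_congr fun k => ENNReal.mul_rpow_of_nonneg _ _ (by norm_num)

/-- The inclusion of `ℓ¹` in `ℓ²`, applied to the roots: each `√(a k)` is at most their sum. -/
theorem sqrt_tsum_le (a : ℕ → ℝ≥0∞) :
    (∑' k, a k) ^ (1 / 2 : ℝ) ≤ ∑' k, a k ^ (1 / 2 : ℝ) := by
  set S := ∑' k, a k ^ (1 / 2 : ℝ) with hS
  have h : ∑' k, a k ≤ S ^ (2 : ℝ) := by
    calc ∑' k, a k ≤ ∑' k, a k ^ (1 / 2 : ℝ) * S := by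
          refine ENNReal.tsum_le_tsum fun k => ?_
          calc a k = a k ^ (1 / 2 : ℝ) * a k ^ (1 / 2 : ℝ) := by
                rw [← ENNReal.rpow_add_of_nonneg _ _ (by norm_num) (by norm_num)]
                norm_num
            _ ≤ _ := by gcongr; exact ENNReal.le_tsum k
      _ = S ^ (2 : ℝ) := by
          rw [ENNReal.tsum_mul_right, ← hS]
          norm_num [sq]
  calc (∑' k, a k) ^ (1 / 2 : ℝ) ≤ (S ^ (2 : ℝ)) ^ (1 / 2 : ℝ) := by gcongr
    _ = S := by rw [← ENNReal.rpow_mul]; norm_num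

theorem eLpNorm_le_normB (f : E3 → ℂ) : eLpNorm f 2 volume ≤ normB f := by
  rw [eLpNorm_two_eq, lintegral_eq_tsum_annulus]
  refine (sqrt_tsum_le _).trans (ENNReal.tsum_le_tsum fun k => ?_)
  gcongr
  exact le_mul_of_one_le_left zero_le (one_le_pow₀ (by norm_num))

theorem normB_congr {f g : E3 → ℂ} (h : f =ᵐ[volume] g) : normB f = normB g := by
  simp only [normB_eq]
  exact tsum_congr fun k => by rw [eLpNorm_congr_ae (ae_restrict_of_ae h)]

theorem normB_mono {f g : E3 → ℂ} (h : ∀ x, ‖f x‖ ≤ ‖g x‖) : normB f ≤ normB g := by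
  simp only [normB_eq]
  gcongr with k
  exact eLpNorm_mono h

theorem normB_add_le {f g : E3 → ℂ} (hf : AEStronglyMeasurable f volume)
    (hg : AEStronglyMeasurable g volume) : normB (f + g) ≤ normB f + normB g := by
  simp only [normB_eq]
  rw [← ENNReal.tsum_add]
  refine ENNReal.tsum_le_tsum fun k => ?_
  rw [← mul_add]
  gcongr
  exact eLpNorm_add_le hf.restrict hg.restrict (by norm_num)

theorem normB_neg (f : E3 → ℂ) : normB (-f) = normB f := by
  simp [normB]

theorem normB_const_smul (c : ℂ) (f : E3 → ℂ) : normB (c • f) = ‖c‖ₑ * normB f := by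
  simp only [normB_eq, eLpNorm_const_smul, ← ENNReal.tsum_mul_left]
  exact tsum_congr fun k => by ring

theorem MemB.add {f g : E3 → ℂ} (hf : MemB f) (hg : MemB g) : MemB (f + g) :=
  ⟨hf.1.add hg.1, (normB_add_le hf.1 hg.1).trans_lt (ENNReal.add_lt_top.2 ⟨hf.2, hg.2⟩)⟩

theorem MemB.neg {f : E3 → ℂ} (hf : MemB f) : MemB (-f) := ⟨hf.1.neg, by rw [normB_neg]; exact hf.2⟩

theorem MemB.sub {f g : E3 → ℂ} (hf : MemB f) (hg : MemB g) : MemB (f - g) := by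
  rw [sub_eq_add_neg]; exact hf.add hg.neg

theorem MemB.const_smul {f : E3 → ℂ} (hf : MemB f) (c : ℂ) : MemB (c • f) :=
  ⟨hf.1.const_smul c, by rw [normB_const_smul]; exact ENNReal.mul_lt_top (by simp) hf.2⟩

theorem MemB.indicator {f : E3 → ℂ} (hf : MemB f) {s : Set E3} (hs : MeasurableSet s) :
    MemB (s.indicator f) :=
  ⟨hf.1.indicator hs, (normB_mono fun x => norm_indicator_le_norm_self f x).trans_lt hf.2⟩

/-- The `B`-norm as a real number. -/
def nB (f : E3 → ℂ) : ℝ := (normB f).toReal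

theorem nB_nonneg (f : E3 → ℂ) : 0 ≤ nB f := ENNReal.toReal_nonneg

theorem nB_le_add_sub {f g : E3 → ℂ} (hf : MemB f) (hg : MemB g) : nB g ≤ nB f + nB (f - g) := by
  have h : normB g ≤ normB f + normB (f - g) := by
    calc normB g = normB (f + -(f - g)) := by congr 1; abel
      _ ≤ normB f + normB (-(f - g)) := normB_add_le hf.1 (hf.sub hg).neg.1
      _ = _ := by rw [normB_neg]
  unfold nB
  rw [← ENNReal.toReal_add hf.2.ne (hf.sub hg).2.ne]
  exact ENNReal.toReal_mono (ENNReal.add_lt_top.2 ⟨hf.2, (hf.sub hg).2⟩).ne h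

/-! ### Truncation, weights and density of Schwartz functions in `B`. -/

theorem normB_indicator_annulus (f : E3 → ℂ) (k : ℕ) :
    normB ((annulus k).indicator f) =
      ((2 : ℝ≥0∞) ^ k) ^ (1 / 2 : ℝ) * eLpNorm f 2 (volume.restrict (annulus k)) := by
  rw [normB_eq, tsum_eq_single k]
  · rw [eLpNorm_indicator_eq_eLpNorm_restrict (measurableSet_annulus k),
      Measure.restrict_restrict (measurableSet_annulus k), Set.inter_self]
  · intro j hj
    rw [eLpNorm_indicator_eq_eLpNorm_restrict (measurableSet_annulus k),
      Measure.restrict_restrict (measurableSet_annulus k),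
      (pairwise_disjoint_annulus hj.symm).inter_eq]
    simp

/-- Only the rings `0, …, K` meet the ball of radius `2 ^ K`. This turns `L²` approximation inside a
fixed ball into approximation in `B`. -/
theorem normB_le_of_support {f : E3 → ℂ} {K : ℕ} (hf : ∀ x, (2 : ℝ) ^ K ≤ ‖x‖ → f x = 0) :
    normB f ≤ (∑ k ∈ Finset.range (K + 1), ((2 : ℝ≥0∞) ^ k) ^ (1 / 2 : ℝ)) * eLpNorm f 2 volume := by
  rw [normB_eq, tsum_eq_sum (s := Finset.range (K + 1)), Finset.sum_mul]
  · gcongr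
    exact Measure.restrict_le_self
  · intro k hk
    have hk' : K < k := by simpa using hk
    rw [eLpNorm_congr_ae (g := 0)]
    · simp
    · filter_upwards [ae_restrict_mem (measurableSet_annulus k)] with x hx
      exact hf x (le_norm_of_mem_annulus hk' hx)

theorem tendsto_normB_sub_truncation {f : E3 → ℂ} (hf : MemB f) :
    Tendsto (fun K : ℕ => normB (f - (Metric.ball (0 : E3) (2 ^ K)).indicator f)) atTop (𝓝 0) := by
  set a : ℕ → ℝ≥0∞ := fun k => ((2 : ℝ≥0∞) ^ k) ^ (1 / 2 : ℝ) *
      eLpNorm f 2 (volume.restrict (annulus k)) with ha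
  have hsum : ∑' k, a k ≠ ∞ := by rw [ha, ← normB_eq]; exact hf.2.ne
  have h0 := ENNReal.tendsto_sum_nat_add a hsum
  refine tendsto_of_tendsto_of_tendsto_of_le_of_le tendsto_const_nhds h0 (fun _ => zero_le)
    fun K => ?_
  rw [normB_eq, ← ENNReal.summable.sum_add_tsum_nat_add' (k := K), Finset.sum_eq_zero, zero_add]
  · refine ENNReal.tsum_le_tsum fun k => ?_
    simp only [ha]
    gcongr
    refine eLpNorm_mono fun x => ?_
    by_cases hx : x ∈ Metric.ball (0 : E3) (2 ^ K) <;> simp [hx]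
  · intro k hk
    have hk' : k < K := by simpa using hk
    rw [eLpNorm_congr_ae (g := 0)]
    · simp
    · filter_upwards [ae_restrict_mem (measurableSet_annulus k)] with x hx
      have : x ∈ Metric.ball (0 : E3) (2 ^ K) := by
        rw [mem_ball_zero_iff]
        exact (norm_lt_of_mem_annulus hx).trans_le (pow_le_pow_right₀ one_le_two hk'.le)
      simp [this]

/-- On ring `k` the weight `1 + ‖x‖` is at least `2 ^ k / 2`. Trading it for the factor `2 ^ (k /
2)` of the `B`-norm leaves a convergent geometric series. -/
theorem normB_le_of_weight {f : E3 → ℂ} :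
    normB f ≤ (∑' k : ℕ, 2 * (2⁻¹ ^ k : ℝ≥0∞) ^ (1 / 2 : ℝ)) *
      eLpNorm (fun x => ((1 + ‖x‖ : ℝ) : ℂ) * f x) 2 volume := by
  rw [normB_eq, ← ENNReal.tsum_mul_right]
  refine ENNReal.tsum_le_tsum fun k => ?_
  have h1 : eLpNorm f 2 (volume.restrict (annulus k)) ≤
      2 * (2⁻¹ ^ k : ℝ≥0∞) * eLpNorm (fun x => ((1 + ‖x‖ : ℝ) : ℂ) * f x) 2 volume := by
    have h2 : eLpNorm f 2 (volume.restrict (annulus k)) ≤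
        ENNReal.ofReal (2 * (2⁻¹ : ℝ) ^ k) *
          eLpNorm (fun x => ((1 + ‖x‖ : ℝ) : ℂ) * f x) 2 (volume.restrict (annulus k)) := by
      refine eLpNorm_le_mul_eLpNorm_of_ae_le_mul ?_ 2
      filter_upwards [ae_restrict_mem (measurableSet_annulus k)] with x hx
      rw [norm_mul, Complex.norm_real, Real.norm_of_nonneg (by positivity), ← mul_assoc]
      have h3 : (2 : ℝ) ^ k ≤ 2 * (1 + ‖x‖) := by
        cases k with
        | zero => simp; linarith [norm_nonneg x]
        | succ k => have := hx.1; rw [pow_succ]; linarith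
      have h4 : 1 ≤ 2 * (2⁻¹ : ℝ) ^ k * (1 + ‖x‖) := by
        rw [inv_pow]
        field_simp
        linarith
      exact le_mul_of_one_le_left (norm_nonneg _) h4
    refine h2.trans (mul_le_mul' (le_of_eq ?_) (eLpNorm_mono_measure _ Measure.restrict_le_self))
    rw [ENNReal.ofReal_mul (by norm_num), ENNReal.ofReal_pow (by norm_num),
      ENNReal.ofReal_inv_of_pos (by norm_num)]
    norm_num
  calc _ ≤ ((2 : ℝ≥0∞) ^ k) ^ (1 / 2 : ℝ) * (2 * (2⁻¹ ^ k : ℝ≥0∞) *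
        eLpNorm (fun x => ((1 + ‖x‖ : ℝ) : ℂ) * f x) 2 volume) := by gcongr
    _ = _ := by
      have h5 : (2⁻¹ ^ k : ℝ≥0∞) = (2⁻¹ ^ k : ℝ≥0∞) ^ (1 / 2 : ℝ) * (2⁻¹ ^ k : ℝ≥0∞) ^ (1 / 2 : ℝ) := by
        rw [← ENNReal.rpow_add_of_nonneg _ _ (by norm_num) (by norm_num)]
        norm_num
      have h6 : ((2 : ℝ≥0∞) ^ k) ^ (1 / 2 : ℝ) * (2⁻¹ ^ k : ℝ≥0∞) ^ (1 / 2 : ℝ) = 1 := by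
        rw [← ENNReal.mul_rpow_of_nonneg _ _ (by norm_num), ← mul_pow,
          ENNReal.mul_inv_cancel (by norm_num) (by norm_num)]
        simp
      conv_lhs => rw [h5]
      rw [← mul_assoc, ← mul_assoc, ← mul_assoc]
      rw [mul_comm _ (2 : ℝ≥0∞), mul_assoc (2 : ℝ≥0∞), h6, mul_one]

theorem tsum_geometric_sqrt_lt_top : ∑' k : ℕ, 2 * (2⁻¹ ^ k : ℝ≥0∞) ^ (1 / 2 : ℝ) < ∞ := by
  rw [ENNReal.tsum_mul_left]
  refine ENNReal.mul_lt_top (by norm_num) ?_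
  have : ∀ k : ℕ, (2⁻¹ ^ k : ℝ≥0∞) ^ (1 / 2 : ℝ) = ((2⁻¹ : ℝ≥0∞) ^ (1 / 2 : ℝ)) ^ k := fun k => by
    rw [← ENNReal.rpow_natCast, ← ENNReal.rpow_mul, ← ENNReal.rpow_natCast, ← ENNReal.rpow_mul,
      mul_comm]
  simp_rw [this]
  rw [ENNReal.tsum_geometric]
  refine ENNReal.inv_lt_top.2 (tsub_pos_of_lt ?_)
  exact ENNReal.rpow_lt_one (by norm_num) (by norm_num)

theorem memB_schwartz (f : 𝓢(E3, ℂ)) : MemB f := by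
  refine ⟨f.continuous.aestronglyMeasurable, ?_⟩
  refine normB_le_of_weight.trans_lt (ENNReal.mul_lt_top tsum_geometric_sqrt_lt_top ?_)
  have h : MemLp (fun x => f x + (‖x‖ : ℂ) * f x) 2 (volume : Measure E3) := by
    refine (f.memLp 2).add ?_
    have h1 := f.memLp 2 (volume : Measure E3)
    refine (memLp_two_iff_integrable_sq_norm ?_).2 ?_
    · exact (Continuous.mul (by fun_prop) f.continuous).aestronglyMeasurable
    · have h2 := f.integrable_pow_mul (volume : Measure E3) 2
      refine ((h2.mul_const (SchwartzMap.seminorm ℝ 0 0 f))).mono' ?_ ?_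
      · exact (Continuous.pow (Continuous.norm
          (Continuous.mul (by fun_prop) f.continuous)) 2).aestronglyMeasurable
      · filter_upwards with x
        have := SchwartzMap.norm_le_seminorm ℝ f x
        rw [norm_mul, Complex.norm_real, norm_norm, Real.norm_of_nonneg (by positivity), mul_pow,
          sq ‖f x‖, ← mul_assoc]
        gcongr
  refine lt_of_le_of_lt (le_of_eq ?_) h.2
  congr 1
  ext x
  push_cast
  ring

/-- Schwartz functions are dense in `B`. -/
theorem exists_schwartz_nB_sub_lt {f : E3 → ℂ} (hf : MemB f) {ε : ℝ} (hε : 0 < ε) :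
    ∃ g : 𝓢(E3, ℂ), nB (f - ⇑g) < ε := by
  obtain ⟨K, hK⟩ : ∃ K : ℕ, normB (f - (Metric.ball (0 : E3) (2 ^ K)).indicator f) <
      ENNReal.ofReal (ε / 2) :=
    ((tendsto_normB_sub_truncation hf).eventually
      (gt_mem_nhds (ENNReal.ofReal_pos.2 (half_pos hε)))).exists
  set f₁ := (Metric.ball (0 : E3) (2 ^ K)).indicator f with hf₁
  have hf₁B : MemB f₁ := hf.indicator measurableSet_ball
  -- The cutoff below lives in the ball of radius `2 ^ (K + 1)`, hence one ring more than for `f₁`.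
  set c : ℝ≥0∞ := ∑ k ∈ Finset.range (K + 2), ((2 : ℝ≥0∞) ^ k) ^ (1 / 2 : ℝ) with hc
  have hc_top : c ≠ ∞ := by
    refine ENNReal.sum_ne_top.2 fun k _ => ?_
    exact ENNReal.rpow_ne_top_of_nonneg (by norm_num) (by simp)
  have hc_one : 1 ≤ c := by
    rw [hc, Finset.sum_range_succ']
    simp
  have hcr : 0 < c.toReal := ENNReal.toReal_pos (by positivity) hc_top
  obtain ⟨g₀, -, hg₀, hle⟩ := MemLp.exist_eLpNorm_sub_le (p := 2) (by norm_num) (by norm_num)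
    hf₁B.memLp (ε := ε / (4 * c.toReal)) (by positivity)
  let χ : ContDiffBump (0 : E3) := ⟨2 ^ K, 2 ^ (K + 1), by positivity, by gcongr <;> norm_num⟩
  have hsupp : HasCompactSupport (fun x => (χ x : ℂ) * g₀ x) := by
    refine HasCompactSupport.mul_right ?_
    exact χ.hasCompactSupport.comp_left (g := fun t : ℝ => (t : ℂ)) (by simp)
  have hsm : ContDiff ℝ ((⊤ : ℕ∞) : WithTop ℕ∞) (fun x => (χ x : ℂ) * g₀ x) :=
    (Complex.ofRealCLM.contDiff.comp χ.contDiff).mul hg₀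
  refine ⟨hsupp.toSchwartzMap hsm, ?_⟩
  set g := hsupp.toSchwartzMap hsm with hg
  have hgx : ∀ x, g x = (χ x : ℂ) * g₀ x := fun x => rfl
  -- Since `χ = 1` where `f₁` lives, `f₁ = χ f₁`, and cutting off `g₀` cannot increase the error.
  have hdiff : ∀ x, ‖(f₁ - ⇑g) x‖ ≤ ‖(f₁ - g₀) x‖ := by
    intro x
    have : (f₁ - ⇑g) x = (χ x : ℂ) * (f₁ - g₀) x := by
      simp only [Pi.sub_apply, hgx]
      by_cases hx : x ∈ Metric.ball (0 : E3) (2 ^ K)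
      · have h1 : χ x = 1 := χ.one_of_mem_closedBall (Metric.ball_subset_closedBall hx)
        rw [h1]; simp
      · simp [hf₁, hx]
    rw [this, norm_mul, Complex.norm_real, Real.norm_of_nonneg χ.nonneg]
    exact mul_le_of_le_one_left (norm_nonneg _) χ.le_one
  have hvan : ∀ x, (2 : ℝ) ^ (K + 1) ≤ ‖x‖ → (f₁ - ⇑g) x = 0 := by
    intro x hx
    have h1 : χ x = 0 := χ.zero_of_le_dist (by simpa [dist_zero_right] using hx)
    have h2 : x ∉ Metric.ball (0 : E3) (2 ^ K) := by
      rw [mem_ball_zero_iff, not_lt]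
      exact (pow_le_pow_right₀ one_le_two (Nat.le_succ K)).trans hx
    simp [hgx, h1, hf₁, h2]
  have hlast : normB (f₁ - ⇑g) ≤ ENNReal.ofReal (ε / 4) := by
    calc normB (f₁ - ⇑g) ≤ c * eLpNorm (f₁ - ⇑g) 2 volume := normB_le_of_support hvan
      _ ≤ c * ENNReal.ofReal (ε / (4 * c.toReal)) := by
          gcongr
          exact (eLpNorm_mono hdiff).trans hle
      _ = ENNReal.ofReal (ε / 4) := by
          rw [← ENNReal.ofReal_toReal hc_top, ← ENNReal.ofReal_mul ENNReal.toReal_nonneg,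
            ENNReal.toReal_ofReal ENNReal.toReal_nonneg]
          congr 1
          field_simp
  have hfin : normB (f - ⇑g) < ENNReal.ofReal ε := by
    calc normB (f - ⇑g) = normB ((f - f₁) + (f₁ - ⇑g)) := by congr 1; abel
      _ ≤ normB (f - f₁) + normB (f₁ - ⇑g) :=
          normB_add_le (hf.sub hf₁B).1 (hf₁B.sub (memB_schwartz g)).1
      _ < ENNReal.ofReal (ε / 2) + ENNReal.ofReal (ε / 2) :=
          ENNReal.add_lt_add_of_lt_of_le (hlast.trans_lt ENNReal.ofReal_lt_top).ne hK
            (hlast.trans (ENNReal.ofReal_le_ofReal (by linarith)))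
      _ = ENNReal.ofReal ε := by
          rw [← ENNReal.ofReal_add (by positivity) (by positivity)]
          congr 1; ring
  exact ENNReal.toReal_lt_of_lt_ofReal hfin

/-! ### Fourier multiplier forms -/

open Classical in
/-- The Plancherel transform, in Mathlib's normalisation. -/
def planch (f : E3 → ℂ) : E3 → ℂ :=
  if h : MemLp f 2 (volume : Measure E3) then
    (FourierTransform.fourier (h.toLp f) : Lp ℂ 2 (volume : Measure E3))
  else 0

theorem planch_eq {f : E3 → ℂ} (h : MemLp f 2 (volume : Measure E3)) :
    planch f = (FourierTransform.fourier (h.toLp f) : Lp ℂ 2 (volume : Measure E3)) := dif_pos h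

theorem fourierL2_eq {f : E3 → ℂ} (h : MemLp f 2 (volume : Measure E3)) (ξ : E3) :
    fourierL2 f ξ = ((2 * Real.pi : ℂ) ^ 3)⁻¹ * planch f ((2 * Real.pi)⁻¹ • ξ) := by
  rw [fourierL2, dif_pos h, planch_eq h]

theorem memLp_planch (f : E3 → ℂ) : MemLp (planch f) 2 (volume : Measure E3) := by
  by_cases h : MemLp f 2 (volume : Measure E3)
  · rw [planch_eq h]; exact Lp.memLp _
  · rw [planch, dif_neg h]; exact MemLp.zero

theorem aestronglyMeasurable_planch (f : E3 → ℂ) :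
    AEStronglyMeasurable (planch f) (volume : Measure E3) := (memLp_planch f).1

theorem eLpNorm_planch {f : E3 → ℂ} (h : MemLp f 2 (volume : Measure E3)) :
    eLpNorm (planch f) 2 volume = eLpNorm f 2 volume := by
  have h1 := Lp.norm_fourier_eq (h.toLp f)
  rw [Lp.norm_def, Lp.norm_def, ENNReal.toReal_eq_toReal_iff' (Lp.eLpNorm_ne_top _)
    (Lp.eLpNorm_ne_top _)] at h1
  rw [planch_eq h, h1, eLpNorm_congr_ae h.coeFn_toLp]

theorem planch_add {f g : E3 → ℂ} (hf : MemLp f 2 (volume : Measure E3))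
    (hg : MemLp g 2 (volume : Measure E3)) :
    planch (f + g) =ᵐ[volume] planch f + planch g := by
  rw [planch_eq hf, planch_eq hg, planch_eq (hf.add hg), MemLp.toLp_add hf hg,
    FourierTransform.fourier_add]
  exact Lp.coeFn_add _ _

theorem planch_const_smul {f : E3 → ℂ} (hf : MemLp f 2 (volume : Measure E3)) (c : ℂ) :
    planch (c • f) =ᵐ[volume] c • planch f := by
  rw [planch_eq hf, planch_eq (hf.const_smul c), MemLp.toLp_const_smul c hf,
    FourierTransform.fourier_smul]
  exact Lp.coeFn_smul _ _

theorem planch_schwartz (f : 𝓢(E3, ℂ)) :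
    planch f =ᵐ[volume] (FourierTransform.fourier f : 𝓢(E3, ℂ)) := by
  rw [planch_eq (f.memLp 2)]
  have : (f.memLp 2 (volume : Measure E3)).toLp f = f.toLp 2 := rfl
  rw [this, SchwartzMap.toLp_fourier_eq]
  exact SchwartzMap.coeFn_toLp _ _ _

theorem integral_planch_mul_conj {f v : E3 → ℂ} (hf : MemLp f 2 (volume : Measure E3))
    (hv : MemLp v 2 (volume : Measure E3)) :
    ∫ ξ, planch f ξ * (starRingEnd ℂ) (planch v ξ) = ∫ x, f x * (starRingEnd ℂ) (v x) := by
  have h1 := Lp.inner_fourier_eq (hv.toLp v) (hf.toLp f)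
  rw [L2.inner_def, L2.inner_def] at h1
  simp only [RCLike.inner_apply] at h1
  rw [planch_eq hf, planch_eq hv, h1]
  refine integral_congr_ae ?_
  filter_upwards [hf.coeFn_toLp, hv.coeFn_toLp] with x h2 h3
  rw [h2, h3]

/-- The sesquilinear form of the Fourier multiplier `m`. -/
def mulForm (m f v : E3 → ℂ) : ℂ := ∫ ξ, m ξ * (planch f ξ * (starRingEnd ℂ) (planch v ξ))

theorem integrable_mul_conj {f v : E3 → ℂ} (hf : MemLp f 2 (volume : Measure E3))
    (hv : MemLp v 2 (volume : Measure E3)) :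
    Integrable (fun ξ => f ξ * (starRingEnd ℂ) (v ξ)) (volume : Measure E3) := by
  have h : MemLp (fun ξ => (starRingEnd ℂ) (v ξ)) 2 (volume : Measure E3) :=
    hv.of_le (Complex.continuous_conj.comp_aestronglyMeasurable hv.1) (by simp)
  exact hf.integrable_mul h

theorem integral_norm_mul_le {f v : E3 → ℂ} (hf : MemLp f 2 (volume : Measure E3))
    (hv : MemLp v 2 (volume : Measure E3)) :
    ∫ ξ, ‖f ξ‖ * ‖v ξ‖ ≤ (eLpNorm f 2 volume).toReal * (eLpNorm v 2 volume).toReal := by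
  have h := integral_mul_norm_le_Lp_mul_Lq (p := 2) (q := 2) (μ := volume) (f := f) (g := v)
    Real.HolderConjugate.two_two (by simpa using hf) (by simpa using hv)
  refine h.trans (le_of_eq ?_)
  rw [hf.eLpNorm_eq_integral_rpow_norm (by norm_num) (by norm_num),
    hv.eLpNorm_eq_integral_rpow_norm (by norm_num) (by norm_num),
    ENNReal.toReal_ofReal (by positivity), ENNReal.toReal_ofReal (by positivity)]
  norm_num

theorem integrable_mulForm {m f v : E3 → ℂ} {M : ℝ} (hm : AEStronglyMeasurable m volume)
    (hM : ∀ ξ, ‖m ξ‖ ≤ M) :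
    Integrable (fun ξ => m ξ * (planch f ξ * (starRingEnd ℂ) (planch v ξ)))
      (volume : Measure E3) :=
  (integrable_mul_conj (memLp_planch f) (memLp_planch v)).bdd_mul hm (Eventually.of_forall hM)

theorem norm_mulForm_le_eLpNorm {m f v : E3 → ℂ} {M : ℝ} (hM : ∀ ξ, ‖m ξ‖ ≤ M)
    (hf : MemLp f 2 (volume : Measure E3)) (hv : MemLp v 2 (volume : Measure E3)) :
    ‖mulForm m f v‖ ≤ M * ((eLpNorm f 2 volume).toReal * (eLpNorm v 2 volume).toReal) := by
  have hM0 : 0 ≤ M := (norm_nonneg _).trans (hM 0)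
  calc ‖mulForm m f v‖ ≤ ∫ ξ, M * (‖planch f ξ‖ * ‖planch v ξ‖) := by
        refine norm_integral_le_of_norm_le ?_ (Eventually.of_forall fun ξ => ?_)
        · refine Integrable.const_mul ?_ M
          simpa using (integrable_mul_conj (memLp_planch f) (memLp_planch v)).norm
        · rw [norm_mul, norm_mul, RCLike.norm_conj]
          gcongr
          exact hM ξ
    _ ≤ _ := by
        rw [integral_const_mul, ← eLpNorm_planch hf, ← eLpNorm_planch hv]
        gcongr
        exact integral_norm_mul_le (memLp_planch f) (memLp_planch v)

theorem MemB.toReal_eLpNorm_le {f : E3 → ℂ} (hf : MemB f) :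
    (eLpNorm f 2 volume).toReal ≤ nB f :=
  ENNReal.toReal_mono hf.2.ne (eLpNorm_le_normB f)

theorem norm_mulForm_le {m f v : E3 → ℂ} {M : ℝ} (hM : ∀ ξ, ‖m ξ‖ ≤ M)
    (hf : MemB f) (hv : MemB v) : ‖mulForm m f v‖ ≤ M * nB f * nB v := by
  have hM0 : 0 ≤ M := (norm_nonneg _).trans (hM 0)
  refine (norm_mulForm_le_eLpNorm hM hf.memLp hv.memLp).trans ?_
  rw [mul_assoc]
  gcongr
  · exact nB_nonneg f
  · exact hf.toReal_eLpNorm_le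
  · exact hv.toReal_eLpNorm_le

theorem mulForm_add_left {m f g v : E3 → ℂ} {M : ℝ} (hm : AEStronglyMeasurable m volume)
    (hM : ∀ ξ, ‖m ξ‖ ≤ M) (hf : MemLp f 2 (volume : Measure E3))
    (hg : MemLp g 2 (volume : Measure E3)) :
    mulForm m (f + g) v = mulForm m f v + mulForm m g v := by
  unfold mulForm
  rw [← integral_add (integrable_mulForm hm hM) (integrable_mulForm hm hM)]
  refine integral_congr_ae ?_
  filter_upwards [planch_add hf hg] with ξ h
  rw [h, Pi.add_apply]
  ring

theorem mulForm_add_right {m f v w : E3 → ℂ} {M : ℝ} (hm : AEStronglyMeasurable m volume)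
    (hM : ∀ ξ, ‖m ξ‖ ≤ M) (hv : MemLp v 2 (volume : Measure E3))
    (hw : MemLp w 2 (volume : Measure E3)) :
    mulForm m f (v + w) = mulForm m f v + mulForm m f w := by
  unfold mulForm
  rw [← integral_add (integrable_mulForm hm hM) (integrable_mulForm hm hM)]
  refine integral_congr_ae ?_
  filter_upwards [planch_add hv hw] with ξ h
  rw [h, Pi.add_apply, map_add]
  ring

theorem mulForm_smul_right (m f : E3 → ℂ) {v : E3 → ℂ} (c : ℂ)
    (hv : MemLp v 2 (volume : Measure E3)) :
    mulForm m f (c • v) = (starRingEnd ℂ) c * mulForm m f v := by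
  unfold mulForm
  rw [← integral_const_mul]
  refine integral_congr_ae ?_
  filter_upwards [planch_const_smul hv c] with ξ h
  rw [h, Pi.smul_apply, smul_eq_mul, map_mul]
  ring

/-! ### Forms bounded on `B × B`, and passage from Schwartz functions to `B`. -/

/-- The form of the multiplier `m` is bounded on `B × B` by `C`. -/
def FormBound (m : E3 → ℂ) (C : ℝ) : Prop :=
  ∀ f v : E3 → ℂ, MemB f → MemB v → ‖mulForm m f v‖ ≤ C * nB f * nB v

theorem mulForm_sub_sub {m f g v w : E3 → ℂ} {M : ℝ} (hm : AEStronglyMeasurable m volume)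
    (hM : ∀ ξ, ‖m ξ‖ ≤ M) (hf : MemB f) (hg : MemB g) (hv : MemB v) (hw : MemB w) :
    mulForm m f v = mulForm m g w + mulForm m (f - g) v + mulForm m g (v - w) := by
  have h1 := mulForm_add_left (v := v) hm hM (hf.sub hg).memLp hg.memLp
  have h2 := mulForm_add_right (f := g) hm hM (hv.sub hw).memLp hw.memLp
  rw [sub_add_cancel] at h1 h2
  rw [h1, h2]
  ring

theorem FormBound.norm_sub_le {m f g v w : E3 → ℂ} {M C : ℝ} (hC : FormBound m C)
    (hm : AEStronglyMeasurable m volume)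
    (hM : ∀ ξ, ‖m ξ‖ ≤ M) (hf : MemB f) (hg : MemB g) (hv : MemB v) (hw : MemB w) :
    ‖mulForm m f v - mulForm m g w‖ ≤ C * nB (f - g) * nB v + C * nB g * nB (v - w) := by
  rw [mulForm_sub_sub hm hM hf hg hv hw, add_assoc, add_sub_cancel_left]
  exact (norm_add_le _ _).trans (add_le_add (hC _ _ (hf.sub hg) hv) (hC _ _ hg (hv.sub hw)))

/-- The first bound is the error that `FormBound.norm_sub_le` produces; the second prevents the
product of norms from growing, so that a bound on Schwartz functions passes to `B` with the same
constant. -/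
theorem exists_schwartz_pair {f v : E3 → ℂ} (hf : MemB f) (hv : MemB v) {C ε : ℝ} (hC : 0 ≤ C)
    (hε : 0 < ε) : ∃ g w : 𝓢(E3, ℂ), C * nB (f - ⇑g) * nB v + C * nB g * nB (v - ⇑w) < ε ∧
      nB g * nB w < nB f * nB v + ε := by
  -- Both `C δ (nB f + nB v + 2)` and `δ (nB f + nB v + 2)` fall below `ε`; the bound `δ ≤ 1`
  -- absorbs the terms quadratic in `δ`.
  set δ : ℝ := min 1 (ε / (2 * (C + 1) * (nB f + nB v + 2))) with hδ
  have h0 := nB_nonneg f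
  have h0' := nB_nonneg v
  have hδ0 : 0 < δ := lt_min one_pos (by positivity)
  have hδ1 : δ ≤ 1 := min_le_left _ _
  have h3 : 0 < δ * (nB f + nB v + 2) := by positivity
  have hδ3 : 2 * (C + 1) * (δ * (nB f + nB v + 2)) ≤ ε := by
    have : δ ≤ ε / (2 * (C + 1) * (nB f + nB v + 2)) := min_le_right _ _
    rw [le_div_iff₀ (by positivity)] at this
    linarith
  have hδ2 : C * δ * (nB f + nB v + 2) < ε := by nlinarith
  have hδ4 : δ * (nB f + nB v + 2) < ε := by nlinarith [mul_nonneg hC h3.le]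
  obtain ⟨g, hg⟩ := exists_schwartz_nB_sub_lt hf hδ0
  obtain ⟨w, hw⟩ := exists_schwartz_nB_sub_lt hv hδ0
  have hg1 : nB g ≤ nB f + δ := (nB_le_add_sub hf (memB_schwartz g)).trans (by linarith)
  have hw1 : nB w ≤ nB v + δ := (nB_le_add_sub hv (memB_schwartz w)).trans (by linarith)
  have e1 : C * nB (f - ⇑g) * nB v ≤ C * δ * nB v := by gcongr
  have e2 : C * nB g * nB (v - ⇑w) ≤ C * (nB f + δ) * δ := by
    have := nB_nonneg g
    have := nB_nonneg (v - ⇑w)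
    gcongr
  have e3 : nB g * nB w ≤ (nB f + δ) * (nB v + δ) := by
    have := nB_nonneg g
    have := nB_nonneg w
    gcongr
  have e4 : C * δ * δ ≤ C * δ * 1 := by gcongr
  have e5 : 0 ≤ C * δ := by positivity
  refine ⟨g, w, ?_, ?_⟩ <;> nlinarith

/-- The supremum `M` of the multiplier makes the form continuous on `B × B`, because `B` embeds in
`L²`. It serves only for the approximation and is absent from the conclusion, so it may blow up as
the absorption vanishes. -/
theorem FormBound.of_schwartz {m : E3 → ℂ} {M C : ℝ} (hm : AEStronglyMeasurable m volume)
    (hM : ∀ ξ, ‖m ξ‖ ≤ M) (hC0 : 0 ≤ C)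
    (hC : ∀ f v : 𝓢(E3, ℂ), ‖mulForm m f v‖ ≤ C * nB f * nB v) : FormBound m C := by
  intro f v hf hv
  have hMB : FormBound m M := fun f v hf hv => norm_mulForm_le hM hf hv
  have hM0 : 0 ≤ M := (norm_nonneg _).trans (hM 0)
  refine le_of_forall_pos_le_add fun ε hε => ?_
  -- One share of `ε / (C + 1)` pays for the change of the form, `C` shares for the change of the
  -- norms.
  obtain ⟨g, w, h1, h2⟩ := exists_schwartz_pair hf hv hM0 (ε := ε / (C + 1)) (by positivity)
  have h3 := hMB.norm_sub_le hm hM hf (memB_schwartz g) hv (memB_schwartz w)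
  have h4 := hC g w
  have h5 := norm_add_le (mulForm m f v - mulForm m g w) (mulForm m g w)
  rw [sub_add_cancel] at h5
  have h6 : C * (nB g * nB w) ≤ C * (nB f * nB v + ε / (C + 1)) := by gcongr
  have h7 : (C + 1) * (ε / (C + 1)) = ε := by field_simp
  linarith

/-- Uniformly bounded forms which converge on Schwartz functions converge on `B`. -/
theorem exists_tendsto_mulForm {ι : Type*} {l : Filter ι} [l.NeBot] {m : ι → E3 → ℂ} {C : ℝ}
    (hm : ∀ᶠ i in l, AEStronglyMeasurable (m i) volume ∧ (∃ M : ℝ, ∀ ξ, ‖m i ξ‖ ≤ M) ∧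
      FormBound (m i) C)
    (hC : 0 ≤ C)
    (hlim : ∀ f v : 𝓢(E3, ℂ), ∃ L, Tendsto (fun i => mulForm (m i) f v) l (𝓝 L))
    {f v : E3 → ℂ} (hf : MemB f) (hv : MemB v) :
    ∃ L, Tendsto (fun i => mulForm (m i) f v) l (𝓝 L) := by
  -- No formula for the limit is at hand for general `f` and `v`, hence the Cauchy criterion.
  refine cauchy_map_iff_exists_tendsto.1 (Metric.cauchy_iff.2 ⟨inferInstance, fun ε hε => ?_⟩)
  obtain ⟨g, w, h1, -⟩ := exists_schwartz_pair hf hv hC (ε := ε / 4) (by positivity)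
  obtain ⟨L, hL⟩ := hlim g w
  refine ⟨Metric.ball L (ε / 2), ?_, ?_⟩
  · rw [mem_map]
    filter_upwards [hm, hL (Metric.ball_mem_nhds L (show 0 < ε / 4 by positivity))] with i hi hLi
    obtain ⟨hi1, ⟨M, hM⟩, hi2⟩ := hi
    have h3 := hi2.norm_sub_le hi1 hM hf (memB_schwartz g) hv (memB_schwartz w)
    have h4 : dist (mulForm (m i) g w) L < ε / 4 := hLi
    have h5 := dist_triangle (mulForm (m i) f v) (mulForm (m i) g w) L
    rw [dist_eq_norm] at h5
    show dist _ _ < _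
    rw [dist_eq_norm (mulForm (m i) f v)] at *
    linarith
  · intro x hx y hy
    have := dist_triangle_right x y L
    rw [Metric.mem_ball] at hx hy
    linarith

theorem tendsto_mulForm_zero {ι : Type*} {l : Filter ι} {m : ι → E3 → ℂ} {C : ℝ}
    (hm : ∀ᶠ i in l, AEStronglyMeasurable (m i) volume ∧ (∃ M : ℝ, ∀ ξ, ‖m i ξ‖ ≤ M) ∧
      FormBound (m i) C)
    (hC : 0 ≤ C)
    (hlim : ∀ f v : 𝓢(E3, ℂ), Tendsto (fun i => mulForm (m i) f v) l (𝓝 0))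
    {f v : E3 → ℂ} (hf : MemB f) (hv : MemB v) :
    Tendsto (fun i => mulForm (m i) f v) l (𝓝 0) := by
  refine Metric.tendsto_nhds.2 fun ε hε => ?_
  obtain ⟨g, w, h1, -⟩ := exists_schwartz_pair hf hv hC (ε := ε / 4) (by positivity)
  filter_upwards [hm, Metric.tendsto_nhds.1 (hlim g w) (ε / 4) (by positivity)] with i hi hLi
  obtain ⟨hi1, ⟨M, hM⟩, hi2⟩ := hi
  have h3 := hi2.norm_sub_le hi1 hM hf (memB_schwartz g) hv (memB_schwartz w)
  have h5 := norm_add_le (mulForm (m i) f v - mulForm (m i) g w) (mulForm (m i) g w)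
  rw [sub_add_cancel] at h5
  rw [dist_zero_right] at *
  linarith

/-! ### The one-dimensional resolvent -/

theorem fourier_real_eq (F : ℝ → ℂ) (t : ℝ) :
    𝓕 F t = ∫ x : ℝ, Complex.exp (((-2 * Real.pi * (x * t) : ℝ) : ℂ) * Complex.I) * F x := by
  rw [Real.fourier_eq']
  refine integral_congr_ae (Eventually.of_forall fun x => ?_)
  simp only [smul_eq_mul, RCLike.inner_apply, conj_trivial]
  rw [mul_comm t x]

/-- A multiplier with bounded Fourier transform is bounded from `L¹ × L¹`. -/
theorem norm_integral_mul_fourier_mul_conj_fourier_le {m F G : ℝ → ℂ} {c : ℝ} (hm : Integrable m)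
    (hc : ∀ x, ‖𝓕 m x‖ ≤ c) (hF : Integrable F) (hG : Integrable G) :
    ‖∫ t, m t * (𝓕 F t * (starRingEnd ℂ) (𝓕 G t))‖ ≤ c * ((∫ x, ‖F x‖) * ∫ y, ‖G y‖) := by
  have hGc : Integrable (fun y => (starRingEnd ℂ) (G y)) :=
    hG.mono (Complex.continuous_conj.comp_aestronglyMeasurable hG.1) (by simp)
  set H : ℝ × ℝ → ℂ := fun z => F z.1 * (starRingEnd ℂ) (G z.2) with hH
  have hHi : Integrable H := hF.mul_prod hGc
  set e : ℝ → ℝ × ℝ → ℂ := fun t z =>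
    Complex.exp (((-2 * Real.pi * (t * (z.1 - z.2)) : ℝ) : ℂ) * Complex.I) with he
  have he1 : ∀ t z, ‖e t z‖ = 1 := fun t z => Complex.norm_exp_ofReal_mul_I _
  -- The product is an integral over pairs `(x, y)` with an exponential in `x - y`; exchanging
  -- integrals then puts the transform of `m` at `x - y`.
  have h1 : ∀ t, 𝓕 F t * (starRingEnd ℂ) (𝓕 G t) = ∫ z, e t z * H z := by
    intro t
    rw [fourier_real_eq, fourier_real_eq, ← integral_conj, ← integral_prod_mul]
    refine integral_congr_ae (Eventually.of_forall fun z => ?_)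
    simp only [he, hH, map_mul, ← Complex.exp_conj, Complex.conj_ofReal, Complex.conj_I]
    rw [mul_mul_mul_comm, ← Complex.exp_add]
    congr 2
    push_cast
    ring
  have hint : Integrable (Function.uncurry fun (t : ℝ) (z : ℝ × ℝ) => m t * (e t z * H z))
      (volume.prod volume) := by
    have h2 : Integrable (fun w : ℝ × (ℝ × ℝ) => m w.1 * H w.2) (volume.prod volume) :=
      hm.mul_prod hHi
    refine (h2.bdd_mul (c := 1) (f := fun w : ℝ × (ℝ × ℝ) => e w.1 w.2) ?_ ?_).congr
      (Eventually.of_forall fun w => ?_)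
    · refine Continuous.aestronglyMeasurable ?_
      simp only [he]
      fun_prop
    · exact Eventually.of_forall fun w => (he1 _ _).le
    · simp only [Function.uncurry]
      ring
  calc ‖∫ t, m t * (𝓕 F t * (starRingEnd ℂ) (𝓕 G t))‖
      = ‖∫ t, ∫ z, m t * (e t z * H z)‖ := by
        congr 2 with t
        rw [h1, integral_const_mul]
    _ = ‖∫ z, 𝓕 m (z.1 - z.2) * H z‖ := by
        rw [integral_integral_swap hint]
        congr 2 with z
        rw [fourier_real_eq, ← integral_mul_const]
        refine integral_congr_ae (Eventually.of_forall fun t => ?_)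
        simp only [he]
        ring
    _ ≤ ∫ z, c * ‖H z‖ := by
        refine norm_integral_le_of_norm_le (hHi.norm.const_mul c) (Eventually.of_forall fun z => ?_)
        rw [norm_mul]
        gcongr
        exact hc _
    _ = c * ((∫ x, ‖F x‖) * ∫ y, ‖G y‖) := by
        rw [integral_const_mul, ← integral_prod_mul]
        simp only [hH, norm_mul, RCLike.norm_conj]
        rfl

theorem integrable_exp_neg_mul_abs {μ : ℂ} (hμ : 0 < μ.re) :
    Integrable (fun x : ℝ => Complex.exp (-μ * |x|)) := by
  have h1 : IntegrableOn (fun x : ℝ => Complex.exp (-μ * |x|)) (Set.Ioi 0) := by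
    refine (integrableOn_exp_mul_complex_Ioi (a := -μ) (by simpa using hμ) 0).congr_fun ?_
      measurableSet_Ioi
    intro x hx
    simp only [Set.mem_Ioi] at hx
    simp [abs_of_pos hx]
  have h2 : IntegrableOn (fun x : ℝ => Complex.exp (-μ * |x|)) (Set.Iic 0) := by
    refine (integrableOn_exp_mul_complex_Iic (a := μ) hμ 0).congr_fun ?_ measurableSet_Iic
    intro x hx
    simp only [Set.mem_Iic] at hx
    simp [abs_of_nonpos hx]
  rw [← integrableOn_univ, ← Set.Iic_union_Ioi (a := (0 : ℝ))]
  exact h2.union h1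

/-- The two half-lines contribute `1 / (a + μ)` and `-1 / (a - μ)`, with `a = -2πit`. -/
theorem fourier_exp_neg_mul_abs {μ : ℂ} (hμ : 0 < μ.re) (t : ℝ) :
    𝓕 (fun x : ℝ => Complex.exp (-μ * |x|)) t = 2 * μ / (4 * Real.pi ^ 2 * t ^ 2 + μ ^ 2) := by
  set a : ℂ := -(2 * Real.pi * t * Complex.I) with ha
  have hare : a.re = 0 := by simp [ha]
  have hfun : ∀ x : ℝ, Complex.exp (((-2 * Real.pi * (x * t) : ℝ) : ℂ) * Complex.I) *
      Complex.exp (-μ * |x|) = Complex.exp (a * x + -μ * |x|) := by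
    intro x
    rw [← Complex.exp_add]
    congr 1
    rw [ha]
    push_cast
    ring
  have hint : Integrable (fun x : ℝ => Complex.exp (a * x + -μ * |x|)) := by
    refine ((integrable_exp_neg_mul_abs hμ).bdd_mul (c := 1)
      (f := fun x : ℝ => Complex.exp (((-2 * Real.pi * (x * t) : ℝ) : ℂ) * Complex.I))
      (Continuous.aestronglyMeasurable (by fun_prop))
      (Eventually.of_forall fun x => (Complex.norm_exp_ofReal_mul_I _).le)).congr ?_
    exact Eventually.of_forall hfun
  rw [fourier_real_eq]
  simp_rw [hfun]
  rw [← setIntegral_univ, ← Set.Iic_union_Ioi (a := (0 : ℝ)),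
    setIntegral_union (Set.Iic_disjoint_Ioi le_rfl) measurableSet_Ioi hint.integrableOn
      hint.integrableOn]
  have h1 : ∫ x in Set.Iic (0 : ℝ), Complex.exp (a * x + -μ * |x|) = 1 / (a + μ) := by
    rw [setIntegral_congr_fun measurableSet_Iic (g := fun x : ℝ => Complex.exp ((a + μ) * x))]
    · rw [integral_exp_mul_complex_Iic (by simpa [hare] using hμ)]; simp
    · intro x hx
      simp only [Set.mem_Iic] at hx
      simp only [abs_of_nonpos hx]
      congr 1; push_cast; ring
  have h2 : ∫ x in Set.Ioi (0 : ℝ), Complex.exp (a * x + -μ * |x|) = -1 / (a - μ) := by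
    rw [setIntegral_congr_fun measurableSet_Ioi (g := fun x : ℝ => Complex.exp ((a - μ) * x))]
    · rw [integral_exp_mul_complex_Ioi (by simpa [hare] using hμ)]; simp
    · intro x hx
      simp only [Set.mem_Ioi] at hx
      simp only [abs_of_pos hx]
      congr 1; ring
  have n1 : a + μ ≠ 0 := fun h => by
    have := congrArg Complex.re h
    simp [hare] at this; linarith
  have n2 : a - μ ≠ 0 := fun h => by
    have := congrArg Complex.re h
    simp [hare] at this; linarith
  have n3 : (4 * Real.pi ^ 2 * t ^ 2 + μ ^ 2 : ℂ) = -((a + μ) * (a - μ)) := by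
    have : a ^ 2 = -(4 * Real.pi ^ 2 * t ^ 2) := by
      rw [ha, neg_sq, mul_pow, Complex.I_sq]; ring
    linear_combination this
  rw [h1, h2, n3]
  field_simp
  ring

theorem integrable_resolvent_symbol {w : ℂ} (hw : w.im ≠ 0) :
    Integrable (fun t : ℝ => 1 / (4 * Real.pi ^ 2 * t ^ 2 + w : ℂ)) := by
  have hne : ∀ t : ℝ, (4 * Real.pi ^ 2 * t ^ 2 + w : ℂ) ≠ 0 := fun t h => hw (by
    have := congrArg Complex.im h
    simpa [← Complex.ofReal_pow] using this)
  have hlow : ∀ t : ℝ, |w.im| ≤ ‖(4 * Real.pi ^ 2 * t ^ 2 + w : ℂ)‖ := fun t => by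
    refine le_trans (le_of_eq ?_) (Complex.abs_im_le_norm _)
    simp [← Complex.ofReal_pow]
  have h0 : 0 < |w.im| := abs_pos.2 hw
  have hbase : Integrable (fun t : ℝ => (1 + ‖1 - w‖ / |w.im|) * (1 + (2 * Real.pi * t) ^ 2)⁻¹) := by
    refine Integrable.const_mul ?_ _
    exact integrable_inv_one_add_sq.comp_mul_left' (by positivity)
  refine hbase.mono' ?_ (Eventually.of_forall fun t => ?_)
  · refine Continuous.aestronglyMeasurable ?_
    exact continuous_const.div (by fun_prop) hne
  -- Comparison with the case `w = 1`: the correcting factor is bounded since the denominator stays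
  -- at distance at least `|w.im|` from zero.
  · have h1 : (1 / (4 * Real.pi ^ 2 * t ^ 2 + w : ℂ)) =
        (1 + (1 - w) / (4 * Real.pi ^ 2 * t ^ 2 + w)) * ((1 + (2 * Real.pi * t) ^ 2 : ℝ) : ℂ)⁻¹ := by
      have h2 : ((1 + (2 * Real.pi * t) ^ 2 : ℝ) : ℂ) ≠ 0 :=
        Complex.ofReal_ne_zero.2 (by positivity)
      have h3 := hne t
      have h4 : (4 * Real.pi ^ 2 * t ^ 2 + w : ℂ) =
          ((1 + (2 * Real.pi * t) ^ 2 : ℝ) : ℂ) - (1 - w) := by push_cast; ring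
      rw [h4] at h3 ⊢
      generalize ((1 + (2 * Real.pi * t) ^ 2 : ℝ) : ℂ) = q at h2 h3
      field_simp
      ring
    rw [h1, norm_mul, norm_inv, Complex.norm_real,
      Real.norm_of_nonneg (by positivity : 0 ≤ 1 + (2 * Real.pi * t) ^ 2)]
    gcongr
    refine (norm_add_le _ _).trans ?_
    rw [norm_one, norm_div]
    gcongr
    exact hlow t

/-- By Fourier inversion the transform is `exp (-μ|x|)`, of modulus at most one however small `μ.re`
is. This is the source of all uniformity in the absorption. -/
theorem norm_fourier_resolvent_symbol_le {μ : ℂ} (hμ : 0 < μ.re) (him : (μ ^ 2).im ≠ 0) (x : ℝ) :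
    ‖𝓕 (fun t : ℝ => 2 * μ / (4 * Real.pi ^ 2 * t ^ 2 + μ ^ 2 : ℂ)) x‖ ≤ 1 := by
  have hK := integrable_exp_neg_mul_abs hμ
  have hKF : 𝓕 (fun x : ℝ => Complex.exp (-μ * |x|)) =
      fun t : ℝ => 2 * μ / (4 * Real.pi ^ 2 * t ^ 2 + μ ^ 2 : ℂ) :=
    funext fun t => fourier_exp_neg_mul_abs hμ t
  have hint : Integrable (𝓕 (fun x : ℝ => Complex.exp (-μ * |x|))) := by
    rw [hKF]
    refine ((integrable_resolvent_symbol him).const_mul (2 * μ)).congr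
      (Eventually.of_forall fun t => ?_)
    simp only
    ring
  have hcont : Continuous (fun x : ℝ => Complex.exp (-μ * |x|)) := by fun_prop
  have hinv := congrFun (hcont.fourierInv_fourier_eq hK hint) (-x)
  rw [Real.fourierInv_eq_fourier_neg, neg_neg, hKF] at hinv
  rw [hinv, Complex.norm_exp]
  simp only [abs_neg, neg_mul, Complex.neg_re, Complex.mul_re, Complex.ofReal_re,
    Complex.ofReal_im, mul_zero, sub_zero, Real.exp_le_one_iff, Left.neg_nonpos_iff]
  positivity

/-- The one-dimensional limiting absorption estimate. -/
theorem norm_integral_resolvent_mul_fourier_le {w : ℂ} (hw : w.im ≠ 0) {F G : ℝ → ℂ}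
    (hF : Integrable F) (hG : Integrable G) :
    ‖∫ t : ℝ, (w / (4 * Real.pi ^ 2 * t ^ 2 + w : ℂ)) * (𝓕 F t * (starRingEnd ℂ) (𝓕 G t))‖ ≤
      Real.sqrt ‖w‖ / 2 * ((∫ x, ‖F x‖) * ∫ y, ‖G y‖) := by
  obtain ⟨μ, hμ⟩ : ∃ μ : ℂ, μ ^ 2 = w := IsAlgClosed.exists_pow_nat_eq w (by norm_num)
  -- Of the two roots the decaying one is taken; a purely imaginary root would make `w` real.
  wlog hre : 0 < μ.re generalizing μ with H
  · rcases (not_lt.1 hre).lt_or_eq with h | h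
    · exact H (-μ) (by rw [neg_sq, hμ]) (by simpa using h)
    · exact absurd (by rw [← hμ, sq]; simp [h]) hw
  have him : (μ ^ 2).im ≠ 0 := by rwa [hμ]
  have hsq : Real.sqrt ‖w‖ = ‖μ‖ := by
    rw [← hμ, norm_pow, Real.sqrt_sq (norm_nonneg _)]
  have hm : Integrable (fun t : ℝ => 2 * μ / (4 * Real.pi ^ 2 * t ^ 2 + μ ^ 2 : ℂ)) := by
    refine ((integrable_resolvent_symbol him).const_mul (2 * μ)).congr
      (Eventually.of_forall fun t => ?_)
    simp only
    ring
  have h1 := norm_integral_mul_fourier_mul_conj_fourier_le hm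
    (norm_fourier_resolvent_symbol_le hre him) hF hG
  have h2 : ∫ t : ℝ, (w / (4 * Real.pi ^ 2 * t ^ 2 + w : ℂ)) * (𝓕 F t * (starRingEnd ℂ) (𝓕 G t)) =
      (μ / 2) * ∫ t : ℝ, (2 * μ / (4 * Real.pi ^ 2 * t ^ 2 + μ ^ 2 : ℂ)) *
        (𝓕 F t * (starRingEnd ℂ) (𝓕 G t)) := by
    rw [← integral_const_mul]
    refine integral_congr_ae (Eventually.of_forall fun t => ?_)
    simp only [hμ]
    rw [← hμ]
    ring
  rw [h2, norm_mul, norm_div, hsq, RCLike.norm_ofNat]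
  gcongr
  linarith

/-! ### Slicing `ℝ³` along a coordinate -/

abbrev E2 : Type := EuclideanSpace ℝ (Fin 2)

/-- The identification of `ℝ × ℝ²` with `ℝ³` inserting the first variable as coordinate `i`. -/
def ins (i : Fin 3) : ℝ × E2 ≃ᵐ E3 :=
  ((MeasurableEquiv.refl ℝ).prodCongr (MeasurableEquiv.toLp 2 (Fin 2 → ℝ)).symm).trans
    ((MeasurableEquiv.piFinSuccAbove (fun _ => ℝ) i).symm.trans (MeasurableEquiv.toLp 2 (Fin 3 → ℝ)))

theorem ins_apply (i : Fin 3) (p : ℝ × E2) :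
    ins i p = WithLp.toLp 2 (i.insertNth p.1 (WithLp.ofLp p.2) : Fin 3 → ℝ) := rfl

@[simp] theorem ins_apply_self (i : Fin 3) (p : ℝ × E2) : ins i p i = p.1 := by
  simp [ins_apply]

@[simp] theorem ins_apply_succAbove (i : Fin 3) (p : ℝ × E2) (j : Fin 2) :
    ins i p (i.succAbove j) = p.2 j := by
  simp [ins_apply]

theorem measurePreserving_ins (i : Fin 3) :
    MeasurePreserving (ins i) (volume : Measure (ℝ × E2)) (volume : Measure E3) := by
  have h1 : MeasurePreserving
      ((MeasurableEquiv.refl ℝ).prodCongr (MeasurableEquiv.toLp 2 (Fin 2 → ℝ)).symm)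
      (volume : Measure (ℝ × E2)) volume :=
    (MeasurePreserving.id _).prod (PiLp.volume_preserving_ofLp (Fin 2))
  have h2 := (volume_preserving_piFinSuccAbove (fun _ : Fin 3 => ℝ) i).symm
  have h3 := PiLp.volume_preserving_toLp (Fin 3)
  exact h3.comp (h2.comp h1)

theorem inner_ins (i : Fin 3) (p q : ℝ × E2) :
    (inner ℝ (ins i p) (ins i q) : ℝ) = p.1 * q.1 + inner ℝ p.2 q.2 := by
  simp only [PiLp.inner_apply, Fin.sum_univ_succAbove _ i, ins_apply_self, ins_apply_succAbove,
    RCLike.inner_apply, conj_trivial]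
  ring

theorem norm_ins_sq (i : Fin 3) (p : ℝ × E2) : ‖ins i p‖ ^ 2 = p.1 ^ 2 + ‖p.2‖ ^ 2 := by
  rw [← real_inner_self_eq_norm_sq, inner_ins, real_inner_self_eq_norm_sq]
  ring

theorem ins_add (i : Fin 3) (p q : ℝ × E2) : ins i (p + q) = ins i p + ins i q := by
  ext j
  refine Fin.succAboveCases i ?_ (fun j => ?_) j <;> simp

theorem ins_smul (i : Fin 3) (c : ℝ) (p : ℝ × E2) : ins i (c • p) = c • ins i p := by
  ext j
  refine Fin.succAboveCases i ?_ (fun j => ?_) j <;> simp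

theorem ins_sub (i : Fin 3) (p q : ℝ × E2) : ins i (p - q) = ins i p - ins i q := by
  rw [eq_sub_iff_add_eq, ← ins_add, sub_add_cancel]

theorem continuous_ins (i : Fin 3) : Continuous (ins i) := by
  have : ∀ p, ins i p = (LinearMap.toContinuousLinearMap
      ({ toFun := ins i, map_add' := ins_add i, map_smul' := ins_smul i } :
        ℝ × E2 →ₗ[ℝ] E3)) p := fun p => rfl
  rw [funext this]
  exact ContinuousLinearMap.continuous _

/-- `∫ ‖f(t, ·)‖_{L²} dt`, where `t` is the coordinate `i`. -/
def slabNorm (i : Fin 3) (f : E3 → ℂ) : ℝ≥0∞ :=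
  ∫⁻ t : ℝ, eLpNorm (fun y => f (ins i (t, y))) 2 volume

/-- The `B`-norm is not translation invariant. Estimating through `slabNorm`, which is, makes the
resolvent bound uniform in the displacement of the source. -/
theorem slabNorm_comp_sub (i : Fin 3) (f : E3 → ℂ) (h : E3) :
    slabNorm i (fun x => f (x - h)) = slabNorm i f := by
  obtain ⟨⟨s, z⟩, rfl⟩ := (ins i).surjective h
  have h1 : ∀ t : ℝ, eLpNorm (fun y => f (ins i (t, y) - ins i (s, z))) 2 volume =
      eLpNorm (fun y => f (ins i (t - s, y))) 2 volume := by
    intro t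
    simp_rw [← ins_sub, Prod.mk_sub_mk, eLpNorm_two_eq]
    rw [lintegral_sub_right_eq_self (fun y => ‖f (ins i (t - s, y))‖ₑ ^ 2) z]
  simp only [slabNorm, h1]
  exact lintegral_sub_right_eq_self
    (fun t => eLpNorm (fun y => f (ins i (t, y))) 2 volume) s

/-- Ring `k` projects into the interval `|t| < 2 ^ k`, of length `2 * 2 ^ k`; Cauchy–Schwarz in `t`
on each ring yields exactly the weights of the `B`-norm, up to a factor `√2 ≤ 2`. -/
theorem slabNorm_le_normB (i : Fin 3) {f : E3 → ℂ} (hf : Measurable f) :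
    slabNorm i f ≤ 2 * normB f := by
  set a : ℕ → ℝ → ℝ≥0∞ := fun k t =>
    ∫⁻ y, (annulus k).indicator (fun x => ‖f x‖ₑ ^ 2) (ins i (t, y)) with ha
  have hmeas : ∀ k, Measurable ((annulus k).indicator (fun x => ‖f x‖ₑ ^ 2)) := fun k =>
    (hf.enorm.pow_const 2).indicator (measurableSet_annulus k)
  have ha_meas : ∀ k, Measurable (a k) := fun k =>
    Measurable.lintegral_prod_right' ((hmeas k).comp (ins i).measurable)
  have h1 : ∀ t, eLpNorm (fun y => f (ins i (t, y))) 2 volume ≤ ∑' k, a k t ^ (1 / 2 : ℝ) := by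
    intro t
    rw [eLpNorm_two_eq]
    refine le_trans (le_of_eq ?_) (sqrt_tsum_le fun k => a k t)
    congr 1
    rw [ha, ← lintegral_tsum]
    · refine lintegral_congr fun y => ?_
      obtain ⟨k, hk⟩ := Set.mem_iUnion.1
        ((iUnion_annulus ▸ Set.mem_univ (ins i (t, y))) : ins i (t, y) ∈ ⋃ k, annulus k)
      rw [tsum_eq_single k, Set.indicator_of_mem hk]
      intro j hj
      exact Set.indicator_of_notMem
        (fun hj' => Set.disjoint_left.1 (pairwise_disjoint_annulus hj) hj' hk) _
    · intro k
      exact ((hmeas k).comp ((ins i).measurable.comp measurable_prodMk_left)).aemeasurable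
  have h2 : ∀ k, ∫⁻ t, a k t ^ (1 / 2 : ℝ) ≤
      2 * ((2 : ℝ≥0∞) ^ k * ∫⁻ x in annulus k, ‖f x‖ₑ ^ 2) ^ (1 / 2 : ℝ) := by
    intro k
    set I : Set ℝ := Set.Ioo (-(2 : ℝ) ^ k) (2 ^ k) with hI
    have hzero : ∀ t, t ∉ I → a k t = 0 := by
      intro t ht
      simp only [ha]
      refine lintegral_eq_zero_of_ae_eq_zero ?_
      refine Eventually.of_forall fun y => Set.indicator_of_notMem (fun hx => ht ?_) _
      have h3 := norm_lt_of_mem_annulus hx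
      have h4 : |t| ^ 2 ≤ ‖ins i (t, y)‖ ^ 2 := by
        rw [norm_ins_sq, sq_abs]; simp
      have h5 : |t| ≤ ‖ins i (t, y)‖ := (pow_le_pow_iff_left₀ (abs_nonneg _) (norm_nonneg _)
        two_ne_zero).1 h4
      exact abs_lt.1 (h5.trans_lt h3)
    have h3 : ∫⁻ t, a k t ^ (1 / 2 : ℝ) =
        ∫⁻ t, ((fun t => a k t ^ (1 / 2 : ℝ)) * (I.indicator (1 : ℝ → ℝ≥0∞))) t := by
      refine lintegral_congr fun t => ?_
      by_cases ht : t ∈ I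
      · simp [ht]
      · simp [ht, hzero t ht]
    rw [h3]
    refine (ENNReal.lintegral_mul_le_Lp_mul_Lq volume Real.HolderConjugate.two_two
      ((ha_meas k).pow_const _).aemeasurable
      ((measurable_one.indicator measurableSet_Ioo)).aemeasurable).trans ?_
    have h4 : ∫⁻ t, (a k t ^ (1 / 2 : ℝ)) ^ (2 : ℝ) = ∫⁻ x in annulus k, ‖f x‖ₑ ^ 2 := by
      simp_rw [← ENNReal.rpow_mul]
      norm_num
      rw [← lintegral_indicator (measurableSet_annulus k),
        ← (measurePreserving_ins i).lintegral_comp (hmeas k)]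
      exact (lintegral_prod _ ((hmeas k).comp (ins i).measurable).aemeasurable).symm
    have h5 : ∫⁻ t, (I.indicator (1 : ℝ → ℝ≥0∞) t) ^ (2 : ℝ) = 2 * 2 ^ k := by
      have : ∀ t, (I.indicator (1 : ℝ → ℝ≥0∞) t) ^ (2 : ℝ) = I.indicator 1 t := by
        intro t
        by_cases ht : t ∈ I <;> simp [ht]
      simp_rw [this]
      rw [lintegral_indicator_one measurableSet_Ioo, Real.volume_Ioo]
      rw [show (2 : ℝ) ^ k - -2 ^ k = 2 * 2 ^ k by ring, ENNReal.ofReal_mul (by norm_num),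
        ENNReal.ofReal_pow (by norm_num)]
      norm_num
    rw [h4, h5, mul_comm, ← ENNReal.mul_rpow_of_nonneg _ _ (by norm_num), mul_assoc,
      ENNReal.mul_rpow_of_nonneg _ _ (by norm_num)]
    gcongr
    calc (2 : ℝ≥0∞) ^ (1 / 2 : ℝ) ≤ 2 ^ (1 : ℝ) :=
          ENNReal.rpow_le_rpow_of_exponent_le (by norm_num) (by norm_num)
      _ = 2 := by simp
  calc slabNorm i f ≤ ∫⁻ t, ∑' k, a k t ^ (1 / 2 : ℝ) := lintegral_mono h1
    _ = ∑' k, ∫⁻ t, a k t ^ (1 / 2 : ℝ) :=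
        lintegral_tsum fun k => ((ha_meas k).pow_const _).aemeasurable
    _ ≤ ∑' k, 2 * ((2 : ℝ≥0∞) ^ k * ∫⁻ x in annulus k, ‖f x‖ₑ ^ 2) ^ (1 / 2 : ℝ) :=
        ENNReal.tsum_le_tsum h2
    _ = 2 * normB f := by rw [ENNReal.tsum_mul_left]; rfl

/-! ### Partial Fourier transforms -/

/-- The Fourier transform in the variables other than the coordinate `i`. -/
def partialFourier (i : Fin 3) (f : E3 → ℂ) (x : ℝ) (η : E2) : ℂ :=
  𝓕 (fun y : E2 => f (ins i (x, y))) η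

theorem partialFourier_eq (i : Fin 3) (f : E3 → ℂ) (x : ℝ) (η : E2) :
    partialFourier i f x η =
      ∫ y : E2, Complex.exp (((-2 * Real.pi * inner ℝ y η : ℝ) : ℂ) * Complex.I) *
        f (ins i (x, y)) := by
  rw [partialFourier, Real.fourier_eq']
  rfl

theorem integrable_comp_ins (i : Fin 3) (f : 𝓢(E3, ℂ)) :
    Integrable (fun p => f (ins i p)) (volume : Measure (ℝ × E2)) :=
  ((measurePreserving_ins i).integrable_comp f.continuous.aestronglyMeasurable).2 f.integrable

theorem integrable_exp_mul_comp_ins (i : Fin 3) (f : 𝓢(E3, ℂ)) (η : E2) :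
    Integrable (fun p : ℝ × E2 =>
      Complex.exp (((-2 * Real.pi * inner ℝ p.2 η : ℝ) : ℂ) * Complex.I) * f (ins i p))
      (volume : Measure (ℝ × E2)) := by
  refine (integrable_comp_ins i f).bdd_mul (c := 1)
    (Continuous.aestronglyMeasurable (by fun_prop)) (Eventually.of_forall fun x => ?_)
  exact (Complex.norm_exp_ofReal_mul_I _).le

theorem integrable_partialFourier (i : Fin 3) (f : 𝓢(E3, ℂ)) (η : E2) :
    Integrable (fun x => partialFourier i f x η) := by
  simp_rw [partialFourier_eq]
  exact (integrable_exp_mul_comp_ins i f η).integral_prod_left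

theorem fourier_partialFourier (i : Fin 3) (f : 𝓢(E3, ℂ)) (t : ℝ) (η : E2) :
    𝓕 (fun x => partialFourier i f x η) t = 𝓕 (f : E3 → ℂ) (ins i (t, η)) := by
  rw [fourier_real_eq, Real.fourier_eq', ← (measurePreserving_ins i).integral_comp
    (ins i).measurableEmbedding]
  have hint : Integrable (fun p : ℝ × E2 =>
      Complex.exp (((-2 * Real.pi * (p.1 * t) : ℝ) : ℂ) * Complex.I) *
      (Complex.exp (((-2 * Real.pi * inner ℝ p.2 η : ℝ) : ℂ) * Complex.I) * f (ins i p)))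
      (volume : Measure (ℝ × E2)) := by
    refine (integrable_exp_mul_comp_ins i f η).bdd_mul (c := 1)
      (Continuous.aestronglyMeasurable (by fun_prop)) (Eventually.of_forall fun x => ?_)
    exact (Complex.norm_exp_ofReal_mul_I _).le
  calc _ = ∫ x : ℝ, ∫ y : E2, Complex.exp (((-2 * Real.pi * (x * t) : ℝ) : ℂ) * Complex.I) *
      (Complex.exp (((-2 * Real.pi * inner ℝ y η : ℝ) : ℂ) * Complex.I) * f (ins i (x, y))) := by
        refine integral_congr_ae (Eventually.of_forall fun x => ?_)
        simp only [partialFourier_eq]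
        rw [integral_const_mul]
    _ = ∫ p : ℝ × E2, Complex.exp (((-2 * Real.pi * (p.1 * t) : ℝ) : ℂ) * Complex.I) *
      (Complex.exp (((-2 * Real.pi * inner ℝ p.2 η : ℝ) : ℂ) * Complex.I) * f (ins i p)) :=
        (integral_prod _ hint).symm
    _ = _ := by
        refine integral_congr_ae (Eventually.of_forall fun p => ?_)
        simp only [smul_eq_mul]
        rw [← mul_assoc, ← Complex.exp_add, inner_ins]
        congr 2
        push_cast
        ring

theorem stronglyMeasurable_partialFourier (i : Fin 3) (f : 𝓢(E3, ℂ)) :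
    StronglyMeasurable (Function.uncurry (partialFourier i f)) := by
  have h : Function.uncurry (partialFourier i f) = fun q : ℝ × E2 => ∫ y : E2,
      Complex.exp (((-2 * Real.pi * inner ℝ y q.2 : ℝ) : ℂ) * Complex.I) * f (ins i (q.1, y)) :=
    funext fun q => partialFourier_eq i f q.1 q.2
  rw [h]
  refine StronglyMeasurable.integral_prod_right (f := fun (q : ℝ × E2) (y : E2) =>
    Complex.exp (((-2 * Real.pi * inner ℝ y q.2 : ℝ) : ℂ) * Complex.I) * f (ins i (q.1, y)))
    (Continuous.stronglyMeasurable ?_)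
  have h1 := continuous_ins i
  have h2 := f.continuous
  simp only [Function.uncurry_def]
  refine Continuous.mul (by fun_prop) (h2.comp (h1.comp (by fun_prop)))

/-- The restriction of a Schwartz function to a hyperplane. -/
theorem exists_schwartz_slice (i : Fin 3) (f : 𝓢(E3, ℂ)) (x : ℝ) :
    ∃ g : 𝓢(E2, ℂ), ∀ y, g y = f (ins i (x, y)) := by
  let L : E2 →ₗ[ℝ] E3 :=
    { toFun := fun y => ins i (0, y)
      map_add' := fun y z => by rw [← ins_add]; simp
      map_smul' := fun c y => by rw [← ins_smul]; simp }
  have hL : ∀ y, ins i (x, y) = LinearMap.toContinuousLinearMap L y + ins i (x, 0) := fun y => by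
    show _ = ins i (0, y) + _
    rw [← ins_add, Prod.mk_add_mk, zero_add, add_zero]
  have hg : Function.HasTemperateGrowth (fun y : E2 => ins i (x, y)) := by
    rw [funext hL]
    exact (ContinuousLinearMap.hasTemperateGrowth _).add (Function.HasTemperateGrowth.const _)
  have hanti : AntilipschitzWith 1 (fun y : E2 => ins i (x, y)) := by
    refine AntilipschitzWith.of_le_mul_dist fun y z => ?_
    rw [NNReal.coe_one, one_mul, dist_eq_norm, dist_eq_norm, ← ins_sub]
    refine (pow_le_pow_iff_left₀ (norm_nonneg _) (norm_nonneg _) two_ne_zero).1 ?_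
    rw [norm_ins_sq]
    exact le_add_of_nonneg_left (sq_nonneg _)
  refine ⟨SchwartzMap.compCLMOfAntilipschitz ℝ hg hanti f, fun y => ?_⟩
  rw [SchwartzMap.compCLMOfAntilipschitz_apply]
  rfl

theorem eLpNorm_partialFourier (i : Fin 3) (f : 𝓢(E3, ℂ)) (x : ℝ) :
    eLpNorm (partialFourier i f x) 2 volume = eLpNorm (fun y => f (ins i (x, y))) 2 volume := by
  obtain ⟨g, hg⟩ := exists_schwartz_slice i f x
  have h1 : (fun y => f (ins i (x, y))) = g := funext fun y => (hg y).symm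
  have h2 : partialFourier i f x = (𝓕 g : 𝓢(E2, ℂ)) := by
    rw [SchwartzMap.fourier_coe, ← h1]
    rfl
  have h3 := SchwartzMap.norm_fourier_toL2_eq g
  rw [SchwartzMap.norm_toLp, SchwartzMap.norm_toLp, ENNReal.toReal_eq_toReal_iff'
    (SchwartzMap.eLpNorm_lt_top _ _ _).ne (SchwartzMap.eLpNorm_lt_top _ _ _).ne] at h3
  rw [h1, h2, h3]

/-- Tonelli moves the integral in `η` inside, where Cauchy–Schwarz applies for each pair `(x, y)`.
-/
theorem lintegral_mul_lintegral_le {F G : ℝ → E2 → ℝ≥0∞} (hF : Measurable (Function.uncurry F))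
    (hG : Measurable (Function.uncurry G)) :
    ∫⁻ η : E2, (∫⁻ x, F x η) * ∫⁻ y, G y η ≤
      (∫⁻ x, (∫⁻ η, F x η ^ 2) ^ (1 / 2 : ℝ)) * ∫⁻ y, (∫⁻ η, G y η ^ 2) ^ (1 / 2 : ℝ) := by
  have hFx : ∀ x, Measurable (F x) := fun x => hF.comp measurable_prodMk_left
  have hGx : ∀ x, Measurable (G x) := fun x => hG.comp measurable_prodMk_left
  have hFη : ∀ η, Measurable (fun x => F x η) := fun η => hF.comp measurable_prodMk_right
  have hGη : ∀ η, Measurable (fun x => G x η) := fun η => hG.comp measurable_prodMk_right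
  have hGint : Measurable (fun η => ∫⁻ y, G y η) := Measurable.lintegral_prod_left hG
  have hsq : ∀ {H : ℝ → E2 → ℝ≥0∞}, Measurable (Function.uncurry H) →
      Measurable (fun x => (∫⁻ η, H x η ^ 2) ^ (1 / 2 : ℝ)) := fun {H} hH =>
    (Measurable.lintegral_prod_right (f := fun x η => H x η ^ 2) (hH.pow_const 2)).pow_const _
  calc _ = ∫⁻ η : E2, ∫⁻ x, F x η * ∫⁻ y, G y η := by
        refine lintegral_congr fun η => ?_
        rw [lintegral_mul_const _ (hFη η)]
    _ = ∫⁻ x, ∫⁻ η : E2, F x η * ∫⁻ y, G y η := by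
        refine lintegral_lintegral_swap (Measurable.aemeasurable ?_)
        exact (hF.comp measurable_swap).mul (hGint.comp measurable_fst)
    _ = ∫⁻ x, ∫⁻ y, ∫⁻ η : E2, F x η * G y η := by
        refine lintegral_congr fun x => ?_
        rw [lintegral_lintegral_swap (f := fun y η => F x η * G y η) (Measurable.aemeasurable ?_)]
        · refine lintegral_congr fun η => ?_
          rw [lintegral_const_mul _ (hGη η)]
        · exact ((hFx x).comp measurable_snd).mul hG
    _ ≤ ∫⁻ x, ∫⁻ y, (∫⁻ η, F x η ^ 2) ^ (1 / 2 : ℝ) * (∫⁻ η, G y η ^ 2) ^ (1 / 2 : ℝ) := by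
        gcongr with x y
        have := ENNReal.lintegral_mul_le_Lp_mul_Lq (volume : Measure E2)
          Real.HolderConjugate.two_two (hFx x).aemeasurable (hGx y).aemeasurable
        simpa using this
    _ = _ := by
        simp_rw [lintegral_const_mul _ (hsq hG)]
        rw [lintegral_mul_const _ (hsq hF)]

/-- The `L²` duality in the transversal variables. -/
theorem lintegral_partialFourier_mul_le (i : Fin 3) (f g : 𝓢(E3, ℂ)) :
    ∫⁻ η : E2, (∫⁻ x, ‖partialFourier i f x η‖ₑ) * ∫⁻ y, ‖partialFourier i g y η‖ₑ ≤
      slabNorm i f * slabNorm i g := by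
  refine (lintegral_mul_lintegral_le (F := fun x η => ‖partialFourier i f x η‖ₑ)
    (G := fun x η => ‖partialFourier i g x η‖ₑ) (stronglyMeasurable_partialFourier i f).measurable.enorm
    (stronglyMeasurable_partialFourier i g).measurable.enorm).trans (le_of_eq ?_)
  simp only [slabNorm, ← eLpNorm_partialFourier]
  simp only [eLpNorm_two_eq]

/-! ### The uniform resolvent estimate -/

/-- The symbol `4π²|ξ|² - 1` of `-Δ - 1`. -/
def sym (ξ : E3) : ℝ := 4 * Real.pi ^ 2 * ‖ξ‖ ^ 2 - 1

/-- The multiplier `1 / (4π²|ξ|² - 1 + iκ)`. -/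
def resolv (κ : ℝ) (ξ : E3) : ℂ := 1 / ((sym ξ : ℂ) + Complex.I * κ)

theorem continuous_sym : Continuous sym := by unfold sym; fun_prop

theorem measurable_resolv (κ : ℝ) : Measurable (resolv κ) := by
  have := continuous_sym.measurable
  unfold resolv
  fun_prop

theorem norm_add_I_mul_ge (s κ : ℝ) : |κ| ≤ ‖(s : ℂ) + Complex.I * κ‖ := by
  simpa using Complex.abs_im_le_norm ((s : ℂ) + Complex.I * κ)

theorem norm_add_I_mul_ge' (s κ : ℝ) : |s| ≤ ‖(s : ℂ) + Complex.I * κ‖ := by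
  simpa using Complex.abs_re_le_norm ((s : ℂ) + Complex.I * κ)

theorem add_I_mul_ne_zero (s : ℝ) {κ : ℝ} (hκ : κ ≠ 0) : (s : ℂ) + Complex.I * κ ≠ 0 :=
  norm_pos_iff.1 ((abs_pos.2 hκ).trans_le (norm_add_I_mul_ge s κ))

theorem norm_resolv_le {κ : ℝ} (hκ : 0 < κ) (ξ : E3) : ‖resolv κ ξ‖ ≤ 1 / κ := by
  rw [resolv, norm_div, norm_one]
  gcongr
  simpa [abs_of_pos hκ] using norm_add_I_mul_ge (sym ξ) κ

/-- The part of `4π²|ξ|²` coming from the coordinates other than `i`. -/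
def transv (i : Fin 3) (ξ : E3) : ℝ := 4 * Real.pi ^ 2 * (‖ξ‖ ^ 2 - ξ i ^ 2)

theorem transv_ins (i : Fin 3) (p : ℝ × E2) :
    transv i (ins i p) = 4 * Real.pi ^ 2 * ‖p.2‖ ^ 2 := by
  rw [transv, norm_ins_sq, ins_apply_self]; ring

theorem transv_nonneg (i : Fin 3) (ξ : E3) : 0 ≤ transv i ξ := by
  obtain ⟨p, rfl⟩ := (ins i).surjective ξ
  rw [transv_ins]; positivity

theorem sym_eq_transv (i : Fin 3) (ξ : E3) :
    sym ξ = 4 * Real.pi ^ 2 * ξ i ^ 2 + (transv i ξ - 1) := by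
  rw [sym, transv]; ring

/-- The one-dimensional resolvent in the direction `i`, cut off to bounded transversal frequency. -/
def slabSym (i : Fin 3) (κ : ℝ) (ξ : E3) : ℂ :=
  if transv i ξ ≤ 2 then
    ((transv i ξ - 1 : ℝ) + Complex.I * κ) / ((sym ξ : ℂ) + Complex.I * κ) else 0

theorem measurable_transv (i : Fin 3) : Measurable (transv i) := by
  have h : Measurable fun ξ : E3 => ξ i := by fun_prop
  unfold transv
  fun_prop

theorem measurable_slabSym (i : Fin 3) (κ : ℝ) : Measurable (slabSym i κ) := by
  have h1 := measurable_transv i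
  have h2 := continuous_sym.measurable
  refine Measurable.ite (measurableSet_le h1 measurable_const) ?_ measurable_const
  fun_prop

theorem norm_transv_le {i : Fin 3} {κ : ℝ} {ξ : E3} (hκ : 0 < κ) (hκ1 : κ ≤ 1)
    (h : transv i ξ ≤ 2) : ‖((transv i ξ - 1 : ℝ) : ℂ) + Complex.I * κ‖ ≤ 2 := by
  refine (norm_add_le _ _).trans ?_
  have h0 := transv_nonneg i ξ
  have : |transv i ξ - 1| ≤ 1 := abs_le.2 ⟨by linarith, by linarith⟩
  rw [Complex.norm_real, norm_mul, Complex.norm_I, Complex.norm_real, Real.norm_eq_abs,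
    Real.norm_eq_abs, abs_of_pos hκ]
  linarith

theorem norm_slabSym_le {κ : ℝ} (hκ : 0 < κ) (hκ1 : κ ≤ 1) (i : Fin 3) (ξ : E3) :
    ‖slabSym i κ ξ‖ ≤ 2 / κ := by
  unfold slabSym
  split_ifs with h
  · rw [norm_div]
    gcongr
    · exact norm_transv_le hκ hκ1 h
    · simpa [abs_of_pos hκ] using norm_add_I_mul_ge (sym ξ) κ
  · simp; positivity

theorem integrable_fourier_mul_conj (f g : 𝓢(E3, ℂ)) :
    Integrable (fun ξ => 𝓕 (f : E3 → ℂ) ξ * (starRingEnd ℂ) (𝓕 (g : E3 → ℂ) ξ))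
      (volume : Measure E3) := by
  simp_rw [← SchwartzMap.fourier_coe]
  exact integrable_mul_conj ((𝓕 f).memLp 2) ((𝓕 g).memLp 2)

/-- For fixed transversal frequency `η`, the integral along coordinate `i` is the one-dimensional
form with `w = 4π²|η|² - 1 + iκ`. The cutoff gives `‖w‖ ≤ 2`, hence a constant `√‖w‖ / 2 ≤ 1`;
integration in `η` then brings in the slab norms. -/
theorem enorm_integral_slabSym_le {κ : ℝ} (hκ : 0 < κ) (hκ1 : κ ≤ 1) (i : Fin 3)
    (f g : 𝓢(E3, ℂ)) :
    ‖∫ ξ, slabSym i κ ξ * (𝓕 (f : E3 → ℂ) ξ * (starRingEnd ℂ) (𝓕 (g : E3 → ℂ) ξ))‖ₑ ≤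
      slabNorm i f * slabNorm i g := by
  have hint : Integrable (fun ξ => slabSym i κ ξ *
      (𝓕 (f : E3 → ℂ) ξ * (starRingEnd ℂ) (𝓕 (g : E3 → ℂ) ξ))) (volume : Measure E3) :=
    (integrable_fourier_mul_conj f g).bdd_mul (measurable_slabSym i κ).aestronglyMeasurable
      (Eventually.of_forall (norm_slabSym_le hκ hκ1 i))
  have hint' := ((measurePreserving_ins i).integrable_comp hint.1).2 hint
  rw [← (measurePreserving_ins i).integral_comp (ins i).measurableEmbedding]
  rw [show (volume : Measure (ℝ × E2)) = (volume : Measure ℝ).prod volume from rfl] at hint' ⊢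
  have hswap := integral_prod_symm _ hint'
  simp only [Function.comp_apply] at hswap
  rw [hswap]
  refine (enorm_integral_le_lintegral_enorm _).trans
    (le_trans (lintegral_mono fun η => ?_) (lintegral_partialFourier_mul_le i f g))
  have hF := integrable_partialFourier i f η
  have hG := integrable_partialFourier i g η
  rw [← ofReal_integral_norm_eq_lintegral_enorm hF, ← ofReal_integral_norm_eq_lintegral_enorm hG,
    ← ENNReal.ofReal_mul (by positivity), ← ofReal_norm]
  refine ENNReal.ofReal_le_ofReal ?_
  by_cases hη : 4 * Real.pi ^ 2 * ‖η‖ ^ 2 ≤ 2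
  · set w : ℂ := ((4 * Real.pi ^ 2 * ‖η‖ ^ 2 - 1 : ℝ) : ℂ) + Complex.I * κ with hw
    have hwim : w.im ≠ 0 := by simpa [hw, ← Complex.ofReal_pow] using hκ.ne'
    have hwn : ‖w‖ ≤ 2 := by
      have := norm_transv_le (i := i) (ξ := ins i (0, η)) hκ hκ1 (by rw [transv_ins]; exact hη)
      rwa [transv_ins] at this
    have h1 := norm_integral_resolvent_mul_fourier_le hwim hF hG
    have h2 : Real.sqrt ‖w‖ / 2 ≤ 1 := by
      have : Real.sqrt ‖w‖ ≤ 2 := by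
        rw [Real.sqrt_le_left (by norm_num)]; linarith
      linarith
    refine le_trans (le_of_eq ?_) (h1.trans (mul_le_of_le_one_left (by positivity) h2))
    congr 1
    refine integral_congr_ae (Eventually.of_forall fun t => ?_)
    simp only [fourier_partialFourier]
    congr 1
    have hs := sym_eq_transv i (ins i (t, η))
    rw [transv_ins, ins_apply_self] at hs
    rw [slabSym, transv_ins, if_pos hη, hs, ← hw]
    congr 1
    rw [hw]
    push_cast
    ring
  · have : ∀ t, slabSym i κ (ins i (t, η)) = 0 := fun t => by
      rw [slabSym, transv_ins, if_neg hη]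
    simp only [this, zero_mul, integral_zero, norm_zero]
    positivity

theorem sum_transv (ξ : E3) : ∑ i, 4 * Real.pi ^ 2 * ξ i ^ 2 = sym ξ + 1 := by
  rw [sym, EuclideanSpace.real_norm_sq_eq, ← Finset.mul_sum]
  ring

/-- Near the sphere the resolvent is a sum of one-dimensional resolvents, up to a bounded
multiplier. -/
theorem norm_resolv_add_sum_slabSym_le {κ : ℝ} (hκ : 0 < κ) (ξ : E3) :
    ‖resolv κ ξ + ∑ i, slabSym i κ ξ‖ ≤ 4 := by
  set z : ℂ := (sym ξ : ℂ) + Complex.I * κ with hz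
  have hz0 : z ≠ 0 := add_I_mul_ne_zero _ hκ.ne'
  have hzpos : 0 < ‖z‖ := norm_pos_iff.2 hz0
  have hzp : |sym ξ| ≤ ‖z‖ := norm_add_I_mul_ge' _ _
  -- Here `1 = -p + (p + 1)` is divided by `z`, and `p + 1` is split into its three coordinate
  -- contributions.
  have key : resolv κ ξ + ∑ i, slabSym i κ ξ =
      -((sym ξ : ℂ) / z) + ∑ i, (slabSym i κ ξ + ((4 * Real.pi ^ 2 * ξ i ^ 2 : ℝ) : ℂ) / z) := by
    rw [Finset.sum_add_distrib, ← Finset.sum_div, ← Complex.ofReal_sum, sum_transv, resolv, ← hz]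
    push_cast
    field_simp
    ring
  -- Inside the cutoff the two numerators add up to `z`. Outside it `sym ξ` exceeds `4π²ξᵢ²`, so the
  -- remaining quotient is already bounded by one.
  have hterm : ∀ i, ‖slabSym i κ ξ + ((4 * Real.pi ^ 2 * ξ i ^ 2 : ℝ) : ℂ) / z‖ ≤ 1 := by
    intro i
    have hs := sym_eq_transv i ξ
    have hX : 0 ≤ 4 * Real.pi ^ 2 * ξ i ^ 2 := by positivity
    unfold slabSym
    split_ifs with h
    · rw [← hz, ← add_div]
      have : ((transv i ξ - 1 : ℝ) : ℂ) + Complex.I * κ + ((4 * Real.pi ^ 2 * ξ i ^ 2 : ℝ) : ℂ) =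
          z := by
        rw [hz, hs]; push_cast; ring
      rw [this, div_self hz0, norm_one]
    · rw [zero_add, norm_div, Complex.norm_real, Real.norm_of_nonneg hX, div_le_one hzpos]
      have := le_abs_self (sym ξ)
      linarith
  rw [key]
  refine (norm_add_le _ _).trans ?_
  have h1 : ‖-((sym ξ : ℂ) / z)‖ ≤ 1 := by
    rw [norm_neg, norm_div, Complex.norm_real, Real.norm_eq_abs]
    exact div_le_one_of_le₀ hzp hzpos.le
  have h2 := norm_sum_le_of_le Finset.univ fun i (_ : i ∈ Finset.univ) => hterm i
  have h3 : ∑ _i : Fin 3, (1 : ℝ) = 3 := by simp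
  linarith

theorem mulForm_schwartz (m : E3 → ℂ) (f g : 𝓢(E3, ℂ)) :
    mulForm m f g =
      ∫ ξ, m ξ * (𝓕 (f : E3 → ℂ) ξ * (starRingEnd ℂ) (𝓕 (g : E3 → ℂ) ξ)) := by
  refine integral_congr_ae ?_
  filter_upwards [planch_schwartz f, planch_schwartz g] with ξ h1 h2
  rw [h1, h2, SchwartzMap.fourier_coe, SchwartzMap.fourier_coe]

/-- The right side contains only translation invariant norms, so that it can be applied to a
displaced `f`. For `κ > 1` the resolvent itself is bounded and no slicing is needed. -/
theorem norm_mulForm_resolv_schwartz_le {κ : ℝ} (hκ : 0 < κ) (f g : 𝓢(E3, ℂ)) :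
    ‖mulForm (resolv κ) f g‖ ≤
      4 * ((eLpNorm f 2 volume).toReal * (eLpNorm g 2 volume).toReal) +
        ∑ i, (slabNorm i f * slabNorm i g).toReal := by
  have hslab_nonneg : 0 ≤ ∑ i, (slabNorm i f * slabNorm i g).toReal :=
    Finset.sum_nonneg fun i _ => ENNReal.toReal_nonneg
  have hf := f.memLp 2 (volume : Measure E3)
  have hg := g.memLp 2 (volume : Measure E3)
  have hfin : ∀ (i : Fin 3) (h : 𝓢(E3, ℂ)), slabNorm i h ≠ ∞ := fun i h =>
    ((slabNorm_le_normB i h.continuous.measurable).trans_lt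
      (ENNReal.mul_lt_top (by norm_num) (memB_schwartz h).2)).ne
  rcases le_or_gt κ 1 with hκ1 | hκ1
  · set m : E3 → ℂ := fun ξ => resolv κ ξ + ∑ i, slabSym i κ ξ with hm
    have hFG := integrable_fourier_mul_conj f g
    have hIs : ∀ i, Integrable (fun ξ => slabSym i κ ξ *
        (𝓕 (f : E3 → ℂ) ξ * (starRingEnd ℂ) (𝓕 (g : E3 → ℂ) ξ))) (volume : Measure E3) :=
      fun i => hFG.bdd_mul (measurable_slabSym i κ).aestronglyMeasurable
        (Eventually.of_forall (norm_slabSym_le hκ hκ1 i))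
    have hIr := hFG.bdd_mul (measurable_resolv κ).aestronglyMeasurable
        (Eventually.of_forall (norm_resolv_le hκ))
    have h1 : mulForm (resolv κ) f g = mulForm m f g - ∑ i, ∫ ξ, slabSym i κ ξ *
        (𝓕 (f : E3 → ℂ) ξ * (starRingEnd ℂ) (𝓕 (g : E3 → ℂ) ξ)) := by
      rw [mulForm_schwartz, mulForm_schwartz, ← integral_finsetSum _ fun i _ => hIs i,
        eq_sub_iff_add_eq, ← integral_add hIr (integrable_finsetSum _ fun i _ => hIs i)]
      refine integral_congr_ae (Eventually.of_forall fun ξ => ?_)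
      simp only [hm, add_mul, Finset.sum_mul]
    rw [h1]
    refine (norm_sub_le _ _).trans (add_le_add ?_ (norm_sum_le_of_le _ fun i _ => ?_))
    · exact norm_mulForm_le_eLpNorm (norm_resolv_add_sum_slabSym_le hκ) hf hg
    · have := enorm_integral_slabSym_le hκ hκ1 i f g
      rw [← toReal_enorm]
      exact ENNReal.toReal_mono (ENNReal.mul_ne_top (hfin i f) (hfin i g)) this
  · have h1 : ∀ ξ, ‖resolv κ ξ‖ ≤ 4 := fun ξ => (norm_resolv_le hκ ξ).trans (by
      rw [div_le_iff₀ hκ]; linarith)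
    have := norm_mulForm_le_eLpNorm h1 hf hg
    linarith

/-! ### Translations -/

/-- The Fourier symbol `exp (-2πi h·ξ)` of the translation by `h`. -/
def phase (h ξ : E3) : ℂ := Complex.exp (((-2 * Real.pi * inner ℝ h ξ : ℝ) : ℂ) * Complex.I)

theorem norm_phase (h ξ : E3) : ‖phase h ξ‖ = 1 := Complex.norm_exp_ofReal_mul_I _

theorem continuous_phase (h : E3) : Continuous (phase h) := by unfold phase; fun_prop

@[simp] theorem phase_zero (ξ : E3) : phase 0 ξ = 1 := by simp [phase]

theorem fourier_comp_sub_const (f : E3 → ℂ) (h ξ : E3) :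
    𝓕 (fun x => f (x - h)) ξ = phase h ξ * 𝓕 f ξ := by
  rw [Real.fourier_eq', Real.fourier_eq', ← integral_add_right_eq_self _ h, ← integral_const_mul]
  refine integral_congr_ae (Eventually.of_forall fun x => ?_)
  simp only [add_sub_cancel_right, smul_eq_mul, phase]
  rw [← mul_assoc, ← Complex.exp_add, inner_add_left]
  congr 2
  push_cast
  ring

theorem eLpNorm_comp_sub (f : E3 → ℂ) (h : E3) :
    eLpNorm (fun x => f (x - h)) 2 volume = eLpNorm f 2 (volume : Measure E3) := by
  rw [eLpNorm_two_eq, eLpNorm_two_eq, lintegral_sub_right_eq_self (fun x => ‖f x‖ₑ ^ 2) h]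

theorem memLp_comp_sub {f : E3 → ℂ} (hf : MemLp f 2 (volume : Measure E3)) (h : E3) :
    MemLp (fun x => f (x - h)) 2 (volume : Measure E3) :=
  hf.comp_measurePreserving (measurePreserving_sub_right volume h)

/-- The identity is explicit on Schwartz functions, and both sides preserve the `L²` norm of `f`;
density does the rest. -/
theorem planch_comp_sub {f : E3 → ℂ} (hf : MemB f) (h : E3) :
    planch (fun x => f (x - h)) =ᵐ[volume] fun ξ => phase h ξ * planch f ξ := by
  set τ : (E3 → ℂ) → E3 → ℂ := fun f x => f (x - h) with hτ
  have hmeas : AEStronglyMeasurable (planch (τ f) - fun ξ => phase h ξ * planch f ξ) volume :=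
    (aestronglyMeasurable_planch _).sub
      ((continuous_phase h).aestronglyMeasurable.mul (aestronglyMeasurable_planch f))
  have hzero : eLpNorm (planch (τ f) - fun ξ => phase h ξ * planch f ξ) 2 volume = 0 := by
    refine le_antisymm (ENNReal.le_of_forall_pos_le_add fun ε hε _ => ?_) zero_le
    obtain ⟨g, hg⟩ := exists_schwartz_nB_sub_lt hf (ε := ε / 2) (by positivity)
    have hgB := memB_schwartz g
    have hd := hf.sub hgB
    have hnorm : eLpNorm (f - ⇑g) 2 volume ≤ ENNReal.ofReal (ε / 2) :=
      (eLpNorm_le_normB _).trans ((ENNReal.le_ofReal_iff_toReal_le hd.2.ne (by positivity)).2 hg.le)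
    have e1 : planch (τ f) =ᵐ[volume] planch (τ (f - ⇑g)) + planch (τ g) := by
      have h1 := planch_add (memLp_comp_sub hd.memLp h) (memLp_comp_sub hgB.memLp h)
      have h2 : τ f = τ (f - ⇑g) + τ g := by ext x; simp [hτ]
      rw [h2]
      exact h1
    have e2 : planch f =ᵐ[volume] planch (f - ⇑g) + planch g := by
      have := planch_add hd.memLp hgB.memLp
      rwa [sub_add_cancel] at this
    have e3 : planch (τ g) =ᵐ[volume] fun ξ => phase h ξ * planch g ξ := by
      have h1 := planch_schwartz (SchwartzMap.compSubConstCLM ℂ h g)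
      have h2 : (SchwartzMap.compSubConstCLM ℂ h g : E3 → ℂ) = τ g := by
        ext x; simp [hτ]
      rw [h2] at h1
      filter_upwards [h1, planch_schwartz g] with ξ h3 h4
      rw [h3, h4, SchwartzMap.fourier_coe, SchwartzMap.fourier_coe, h2]
      exact fourier_comp_sub_const g h ξ
    have e4 : (planch (τ f) - fun ξ => phase h ξ * planch f ξ) =ᵐ[volume]
        planch (τ (f - ⇑g)) - fun ξ => phase h ξ * planch (f - ⇑g) ξ := by
      filter_upwards [e1, e2, e3] with ξ h1 h2 h3
      simp only [Pi.sub_apply, Pi.add_apply] at *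
      rw [h1, h2, h3]
      ring
    rw [eLpNorm_congr_ae e4, zero_add]
    refine (eLpNorm_sub_le (aestronglyMeasurable_planch _)
      ((continuous_phase h).aestronglyMeasurable.mul (aestronglyMeasurable_planch _))
      (by norm_num)).trans ?_
    have h5 : eLpNorm (phase h * planch (f - ⇑g)) 2 volume =
        eLpNorm (planch (f - ⇑g)) 2 volume :=
      eLpNorm_congr_norm_ae (Eventually.of_forall fun ξ => by
        rw [Pi.mul_apply, norm_mul, norm_phase, one_mul])
    rw [h5, eLpNorm_planch (memLp_comp_sub hd.memLp h), eLpNorm_planch hd.memLp]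
    have h6 : eLpNorm (τ (f - ⇑g)) 2 volume = eLpNorm (f - ⇑g) 2 volume := eLpNorm_comp_sub _ h
    rw [h6]
    refine (add_le_add hnorm hnorm).trans (le_of_eq ?_)
    rw [← ENNReal.ofReal_add (by positivity) (by positivity), add_halves, ENNReal.ofReal_coe_nnreal]
  rw [eLpNorm_eq_zero_iff hmeas (by norm_num)] at hzero
  filter_upwards [hzero] with ξ h1
  exact sub_eq_zero.1 h1

theorem mulForm_comp_sub (m : E3 → ℂ) {f : E3 → ℂ} (hf : MemB f) (v : E3 → ℂ) (h : E3) :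
    mulForm m (fun x => f (x - h)) v = mulForm (fun ξ => phase h ξ * m ξ) f v := by
  refine integral_congr_ae ?_
  filter_upwards [planch_comp_sub hf h] with ξ h1
  rw [h1]
  ring

theorem norm_phase_mul_resolv_le {κ : ℝ} (hκ : 0 < κ) (h ξ : E3) :
    ‖phase h ξ * resolv κ ξ‖ ≤ 1 / κ := by
  rw [norm_mul, norm_phase, one_mul]; exact norm_resolv_le hκ ξ

theorem aestronglyMeasurable_phase_mul_resolv (κ : ℝ) (h : E3) :
    AEStronglyMeasurable (fun ξ => phase h ξ * resolv κ ξ) volume :=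
  (continuous_phase h).aestronglyMeasurable.mul (measurable_resolv κ).aestronglyMeasurable

/-- The resolvent estimate `B → B*`, uniform in the absorption and in translations. -/
theorem formBound_phase_mul_resolv {κ : ℝ} (hκ : 0 < κ) (h : E3) :
    FormBound (fun ξ => phase h ξ * resolv κ ξ) 16 := by
  refine FormBound.of_schwartz (aestronglyMeasurable_phase_mul_resolv κ h)
    (norm_phase_mul_resolv_le hκ h) (by norm_num) fun f g => ?_
  have hf := memB_schwartz f
  have hg := memB_schwartz g
  have h2 : (SchwartzMap.compSubConstCLM ℂ h f : E3 → ℂ) = fun x => f (x - h) := by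
    ext x; simp
  rw [← mulForm_comp_sub (resolv κ) hf g h, ← h2]
  refine (norm_mulForm_resolv_schwartz_le hκ _ g).trans ?_
  rw [h2, eLpNorm_comp_sub]
  simp_rw [slabNorm_comp_sub]
  -- The constant is `16 = 4 + 3 * 4`: the bounded remainder, and three directions with a factor `2`
  -- for each slab norm.
  have h3 : ∀ i, (slabNorm i f * slabNorm i g).toReal ≤ 4 * (nB f * nB g) := by
    intro i
    have h4 : slabNorm i f * slabNorm i g ≤ (2 * normB f) * (2 * normB g) :=
      mul_le_mul' (slabNorm_le_normB i f.continuous.measurable)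
        (slabNorm_le_normB i g.continuous.measurable)
    refine (ENNReal.toReal_mono (ENNReal.mul_ne_top (ENNReal.mul_ne_top (by norm_num) hf.2.ne)
      (ENNReal.mul_ne_top (by norm_num) hg.2.ne)) h4).trans (le_of_eq ?_)
    simp only [ENNReal.toReal_mul, nB, ENNReal.toReal_ofNat]
    ring
  have h5 : ∑ i, (slabNorm i f * slabNorm i g).toReal ≤ ∑ _i : Fin 3, 4 * (nB f * nB g) :=
    Finset.sum_le_sum fun i _ => h3 i
  have h6 : (eLpNorm f 2 volume).toReal * (eLpNorm g 2 volume).toReal ≤ nB f * nB g := by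
    gcongr
    · exact nB_nonneg f
    · exact hf.toReal_eLpNorm_le
    · exact hg.toReal_eLpNorm_le
  have h7 : ∑ _i : Fin 3, 4 * (nB f * nB g) = 12 * (nB f * nB g) := by simp; ring
  linarith

theorem formBound_resolv {κ : ℝ} (hκ : 0 < κ) : FormBound (resolv κ) 16 := by
  simpa using formBound_phase_mul_resolv hκ 0

/-! ### Limits of the resolvent on Schwartz functions, by the Schrödinger group -/

/-- The Schwartz function `G = 𝓕 f · conj (𝓕 v)`. -/
theorem exists_schwartz_fourier_mul_conj (f v : 𝓢(E3, ℂ)) :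
    ∃ G : 𝓢(E3, ℂ), ∀ ξ, G ξ = 𝓕 (f : E3 → ℂ) ξ * (starRingEnd ℂ) (𝓕 (v : E3 → ℂ) ξ) := by
  refine ⟨SchwartzMap.smulLeftCLM ℂ (𝓕 f : 𝓢(E3, ℂ))
    (SchwartzMap.postcompCLM (Complex.conjCLE : ℂ →L[ℝ] ℂ) (𝓕 v)), fun ξ => ?_⟩
  rw [SchwartzMap.smulLeftCLM_apply_apply (SchwartzMap.hasTemperateGrowth _),
    SchwartzMap.postcompCLM_apply, SchwartzMap.fourier_coe, SchwartzMap.fourier_coe]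
  rfl

/-- The matrix element `⟨exp (-is(Δ + 1)) f(· - h), v⟩` in Fourier variables. -/
def schrod (G : E3 → ℂ) (s : ℝ) (h : E3) : ℂ :=
  ∫ ξ, Complex.exp (((s * sym ξ : ℝ) : ℂ) * Complex.I) * (phase h ξ * G ξ)

theorem norm_exp_mul_phase (s : ℝ) (h ξ : E3) (z : ℂ) :
    ‖Complex.exp ((s : ℂ) * Complex.I) * (phase h ξ * z)‖ = ‖z‖ := by
  rw [norm_mul, norm_mul, norm_phase, Complex.norm_exp_ofReal_mul_I, one_mul, one_mul]

theorem norm_schrod_le (G : E3 → ℂ) (s : ℝ) (h : E3) : ‖schrod G s h‖ ≤ ∫ ξ, ‖G ξ‖ := by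
  refine (norm_integral_le_integral_norm _).trans (le_of_eq ?_)
  simp_rw [norm_exp_mul_phase]

/-- The transform is moved from `g` onto the modulated Gaussian, where it is explicit. A complex `b`
close to the imaginary axis regularises the Schrödinger exponential. -/
theorem integral_fourier_mul_gaussian {g : E3 → ℂ} (hg : Integrable g) {b : ℂ} (hb : 0 < b.re)
    (h : E3) : ∫ ξ, 𝓕 g ξ * (phase h ξ * Complex.exp (-b * ‖ξ‖ ^ 2)) =
      ∫ x, g x * ((Real.pi / b) ^ (3 / 2 : ℂ) *
        Complex.exp (-(Real.pi : ℂ) ^ 2 * ‖-h - x‖ ^ 2 / b)) := by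
  set k : E3 → ℂ := fun ξ => Complex.exp (-b * ‖ξ‖ ^ 2 +
    2 * Real.pi * Complex.I * ((inner ℝ (-h) ξ : ℝ) : ℂ)) with hk
  have hk' : ∀ ξ, phase h ξ * Complex.exp (-b * ‖ξ‖ ^ 2) = k ξ := by
    intro ξ
    simp only [hk, phase]
    rw [← Complex.exp_add, inner_neg_left]
    congr 1
    push_cast
    ring
  have hki : Integrable k := by
    have := GaussianFourier.integrable_cexp_neg_mul_sq_norm_add hb (2 * Real.pi * Complex.I) (-h)
    simpa [hk] using this
  have hself := VectorFourier.integral_fourierIntegral_smul_eq_flip (L := innerₗ E3)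
    (e := Real.fourierChar) (μ := volume) (ν := volume) Real.continuous_fourierChar continuous_inner
    hg hki
  simp_rw [hk']
  have hflip : ∀ x, 𝓕 k x = (Real.pi / b) ^ (3 / 2 : ℂ) *
      Complex.exp (-(Real.pi : ℂ) ^ 2 * ‖-h - x‖ ^ 2 / b) := by
    intro x
    rw [hk, fourier_gaussian_innerProductSpace' hb]
    simp
  simp_rw [← hflip]
  simpa using! hself

/-- The prefactor is governed by `‖b‖`, which stays of order `s` when `b.re → 0`, and the
exponential has modulus at most one because `b⁻¹` has positive real part. -/
theorem norm_gaussian_kernel_le {b : ℂ} (hb : 0 < b.re) {s : ℝ} (hs : 0 < s)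
    (hbs : 4 * Real.pi ^ 2 * s ≤ ‖b‖) (x : E3) :
    ‖(Real.pi / b) ^ (3 / 2 : ℂ) * Complex.exp (-(Real.pi : ℂ) ^ 2 * ‖x‖ ^ 2 / b)‖ ≤
      s ^ (-(3 / 2) : ℝ) := by
  rw [norm_mul]
  have h1 : ‖(Real.pi / b) ^ (3 / 2 : ℂ)‖ ≤ s ^ (-(3 / 2) : ℝ) := by
    have h2 : (3 / 2 : ℂ) = ((3 / 2 : ℝ) : ℂ) := by push_cast; rfl
    rw [h2, Complex.norm_cpow_real, Real.rpow_neg hs.le, ← Real.inv_rpow hs.le]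
    refine Real.rpow_le_rpow (norm_nonneg _) ?_ (by norm_num)
    rw [norm_div, Complex.norm_real, Real.norm_of_nonneg Real.pi_pos.le, inv_eq_one_div,
      div_le_div_iff₀ (by nlinarith [Real.pi_pos, sq_nonneg Real.pi, mul_pos (pow_pos Real.pi_pos 2) hs]) hs]
    have h3 : Real.pi * s ≤ 4 * Real.pi ^ 2 * s := by
      have := Real.pi_gt_three
      have h4 : Real.pi ≤ 4 * Real.pi ^ 2 := by nlinarith
      gcongr
    linarith
  have h2 : ‖Complex.exp (-(Real.pi : ℂ) ^ 2 * ‖x‖ ^ 2 / b)‖ ≤ 1 := by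
    rw [Complex.norm_exp, Real.exp_le_one_iff]
    have h3 : -(Real.pi : ℂ) ^ 2 * ‖x‖ ^ 2 / b =
        ((-(Real.pi ^ 2 * ‖x‖ ^ 2) : ℝ) : ℂ) * b⁻¹ := by push_cast; ring
    rw [h3, Complex.re_ofReal_mul, Complex.inv_re]
    have : 0 ≤ b.re / Complex.normSq b := div_nonneg hb.le (Complex.normSq_nonneg _)
    have h4 : 0 ≤ Real.pi ^ 2 * ‖x‖ ^ 2 := by positivity
    nlinarith
  calc _ ≤ s ^ (-(3 / 2) : ℝ) * 1 := mul_le_mul h1 h2 (norm_nonneg _) (by positivity)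
    _ = _ := mul_one _

/-- The dispersive estimate. -/
theorem norm_schrod_le_rpow {g : E3 → ℂ} (hg : Integrable g) (hG : Integrable (𝓕 g)) {s : ℝ}
    (hs : 0 < s) (h : E3) :
    ‖schrod (𝓕 g) s h‖ ≤ s ^ (-(3 / 2) : ℝ) * ∫ x, ‖g x‖ := by
  -- The damping `δ > 0` makes the Gaussian integrable; the bound does not depend on `δ`, which is
  -- then sent to zero.
  set b : ℝ → ℂ := fun δ => (δ : ℂ) - ((4 * Real.pi ^ 2 * s : ℝ) : ℂ) * Complex.I with hb
  have hbre : ∀ δ, (b δ).re = δ := fun δ => by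
    simp only [hb, Complex.sub_re, Complex.ofReal_re, Complex.re_ofReal_mul, Complex.I_re]
    ring
  have hbim : ∀ δ, (b δ).im = -(4 * Real.pi ^ 2 * s) := fun δ => by
    simp only [hb, Complex.sub_im, Complex.ofReal_im, Complex.im_ofReal_mul, Complex.I_im]
    ring
  set A : ℝ → ℂ := fun δ => ∫ ξ, 𝓕 g ξ * (phase h ξ * Complex.exp (-b δ * ‖ξ‖ ^ 2)) with hA
  have hbound : ∀ δ : ℝ, 0 < δ → ‖A δ‖ ≤ s ^ (-(3 / 2) : ℝ) * ∫ x, ‖g x‖ := by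
    intro δ hδ
    have hbr : 0 < (b δ).re := by rw [hbre]; exact hδ
    simp only [hA]
    rw [integral_fourier_mul_gaussian hg hbr, ← integral_const_mul]
    refine norm_integral_le_of_norm_le (hg.norm.const_mul _) (Eventually.of_forall fun x => ?_)
    rw [norm_mul, mul_comm]
    gcongr
    refine norm_gaussian_kernel_le hbr hs ?_ _
    have := Complex.abs_im_le_norm (b δ)
    rwa [hbim, abs_neg, abs_of_pos (by positivity)] at this
  have hexp : ∀ (δ : ℝ) (ξ : E3), Complex.exp (-b δ * ‖ξ‖ ^ 2) =
      Complex.exp (((-δ * ‖ξ‖ ^ 2 : ℝ) : ℂ)) *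
        Complex.exp (((4 * Real.pi ^ 2 * s * ‖ξ‖ ^ 2 : ℝ) : ℂ) * Complex.I) := by
    intro δ ξ
    rw [← Complex.exp_add]
    congr 1
    simp only [hb]
    push_cast
    ring
  have hlim : Tendsto A (𝓝[>] 0) (𝓝 (A 0)) := by
    refine tendsto_integral_filter_of_dominated_convergence (fun ξ => ‖𝓕 g ξ‖) ?_ ?_ hG.norm ?_
    · filter_upwards with δ
      refine hG.1.mul (Continuous.aestronglyMeasurable ?_)
      have := continuous_phase h
      fun_prop
    · filter_upwards [self_mem_nhdsWithin] with δ hδ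
      have hδ' : 0 < δ := hδ
      filter_upwards with ξ
      rw [norm_mul, norm_mul, norm_phase, one_mul, hexp, norm_mul, Complex.norm_exp_ofReal_mul_I,
        mul_one, ← Complex.ofReal_exp, Complex.norm_real, Real.norm_of_nonneg (Real.exp_pos _).le]
      refine mul_le_of_le_one_right (norm_nonneg _) (Real.exp_le_one_iff.2 ?_)
      have : 0 ≤ δ * ‖ξ‖ ^ 2 := by positivity
      linarith
    · filter_upwards with ξ
      have : Continuous fun δ : ℝ => 𝓕 g ξ * (phase h ξ * Complex.exp (-b δ * ‖ξ‖ ^ 2)) := by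
        simp only [hb]
        fun_prop
      exact (this.tendsto 0).mono_left nhdsWithin_le_nhds
  have hA0 : ‖schrod (𝓕 g) s h‖ = ‖A 0‖ := by
    have : schrod (𝓕 g) s h = Complex.exp (((-s : ℝ) : ℂ) * Complex.I) * A 0 := by
      simp only [hA, schrod]
      rw [← integral_const_mul]
      refine integral_congr_ae (Eventually.of_forall fun ξ => ?_)
      simp only [hexp, sym]
      have : Complex.exp (((s * (4 * Real.pi ^ 2 * ‖ξ‖ ^ 2 - 1) : ℝ) : ℂ) * Complex.I) =
          Complex.exp (((-s : ℝ) : ℂ) * Complex.I) *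
          Complex.exp (((4 * Real.pi ^ 2 * s * ‖ξ‖ ^ 2 : ℝ) : ℂ) * Complex.I) := by
        rw [← Complex.exp_add]
        congr 1
        push_cast
        ring
      rw [this]
      simp
      ring
    rw [this, norm_mul, Complex.norm_exp_ofReal_mul_I, one_mul]
  rw [hA0]
  refine le_of_tendsto hlim.norm ?_
  filter_upwards [self_mem_nhdsWithin] with δ hδ
  exact hbound δ hδ

theorem aestronglyMeasurable_schrod {G : E3 → ℂ} (hG : Continuous G) (h : E3) :
    StronglyMeasurable fun s => schrod G s h := by
  refine StronglyMeasurable.integral_prod_right (f := fun (s : ℝ) (ξ : E3) =>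
    Complex.exp (((s * sym ξ : ℝ) : ℂ) * Complex.I) * (phase h ξ * G ξ))
    (Continuous.stronglyMeasurable ?_)
  have h1 := continuous_phase h
  have h2 := continuous_sym
  simp only [Function.uncurry_def]
  fun_prop

/-- The trivial bound serves for `s ≤ 1` and the dispersive one for `s > 1`. Integrability at
infinity uses that half the dimension, `3 / 2`, exceeds one. The same `D` serves for all
displacements `h`. -/
theorem exists_integrableOn_bound_schrod (G : 𝓢(E3, ℂ)) :
    ∃ D : ℝ → ℝ, IntegrableOn D (Set.Ioi 0) ∧ ∀ s ∈ Set.Ioi (0 : ℝ), ∀ h, ‖schrod G s h‖ ≤ D s := by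
  set g : 𝓢(E3, ℂ) := 𝓕⁻ G with hg
  have hGg : (G : E3 → ℂ) = 𝓕 (g : E3 → ℂ) := by
    rw [← SchwartzMap.fourier_coe, hg, FourierTransform.fourier_fourierInv_eq]
  refine ⟨fun s => if s ≤ 1 then ∫ ξ, ‖G ξ‖ else s ^ (-(3 / 2) : ℝ) * ∫ x, ‖g x‖, ?_, ?_⟩
  · rw [← Set.Ioc_union_Ioi_eq_Ioi (zero_le_one' ℝ)]
    refine IntegrableOn.union ?_ ?_
    · refine (integrableOn_const (by simp) (by simp) : IntegrableOn (fun _ => ∫ ξ, ‖G ξ‖)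
        (Set.Ioc (0 : ℝ) 1)).congr_fun (fun s hs => ?_) measurableSet_Ioc
      simp [hs.2]
    · have h1 : IntegrableOn (fun s : ℝ => s ^ (-(3 / 2) : ℝ) * ∫ x, ‖g x‖) (Set.Ioi 1) :=
        (integrableOn_Ioi_rpow_of_lt (a := -(3 / 2)) (by norm_num)
        (zero_lt_one' ℝ)).mul_const (∫ x, ‖g x‖)
      refine h1.congr_fun (fun s hs => ?_) measurableSet_Ioi
      exact (if_neg (not_le.2 hs)).symm
  · intro s hs h
    dsimp only
    split_ifs
    · exact norm_schrod_le _ _ _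
    · rw [hGg]
      exact norm_schrod_le_rpow g.integrable (hGg ▸ G.integrable) hs h

/-- The sign of the absorption selects forward times: `exp (-κs + is sym ξ)` is integrable on `s >
0`. -/
theorem resolv_eq_integral {κ : ℝ} (hκ : 0 < κ) (ξ : E3) :
    resolv κ ξ = -Complex.I * ∫ s in Set.Ioi (0 : ℝ),
      (Real.exp (-κ * s) : ℂ) * Complex.exp (((s * sym ξ : ℝ) : ℂ) * Complex.I) := by
  set a : ℂ := -(κ : ℂ) + sym ξ * Complex.I with ha
  have hare : a.re < 0 := by simpa [ha] using hκ
  have h1 : ∀ s : ℝ, (Real.exp (-κ * s) : ℂ) * Complex.exp (((s * sym ξ : ℝ) : ℂ) * Complex.I) =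
      Complex.exp (a * s) := by
    intro s
    rw [Complex.ofReal_exp, ← Complex.exp_add]
    congr 1
    rw [ha]
    push_cast
    ring
  simp_rw [h1]
  rw [integral_exp_mul_complex_Ioi hare, resolv]
  have h2 : (sym ξ : ℂ) + Complex.I * κ = -Complex.I * a := by
    rw [ha]
    linear_combination (sym ξ : ℂ) * Complex.I_sq
  have h3 : a ≠ 0 := fun h => by rw [h] at hare; simp at hare
  rw [h2]
  have hI := Complex.I_ne_zero
  simp only [Complex.ofReal_zero, mul_zero, Complex.exp_zero]
  field_simp
  rw [Complex.I_sq]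

theorem integral_phase_resolv_eq {κ : ℝ} (hκ : 0 < κ) (G : 𝓢(E3, ℂ)) (h : E3) :
    ∫ ξ, phase h ξ * resolv κ ξ * G ξ =
      -Complex.I * ∫ s in Set.Ioi (0 : ℝ), (Real.exp (-κ * s) : ℂ) * schrod G s h := by
  have hexp : IntegrableOn (fun s : ℝ => (Real.exp (-κ * s) : ℂ)) (Set.Ioi 0) :=
    (integrableOn_exp_mul_Ioi (by linarith) 0).ofReal
  have hint : Integrable (Function.uncurry fun (ξ : E3) (s : ℝ) =>
      (Real.exp (-κ * s) : ℂ) * (Complex.exp (((s * sym ξ : ℝ) : ℂ) * Complex.I) *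
        (phase h ξ * G ξ))) ((volume : Measure E3).prod (volume.restrict (Set.Ioi (0 : ℝ)))) := by
    have h1 : Integrable (fun p : E3 × ℝ => G p.1 * (Real.exp (-κ * p.2) : ℂ))
        ((volume : Measure E3).prod (volume.restrict (Set.Ioi (0 : ℝ)))) :=
      Integrable.mul_prod (f := fun ξ => G ξ) (G.integrable (μ := volume)) hexp
    refine (h1.bdd_mul (c := 1) (f := fun p : E3 × ℝ =>
      Complex.exp (((p.2 * sym p.1 : ℝ) : ℂ) * Complex.I) * phase h p.1)
      (Continuous.aestronglyMeasurable ?_) (Eventually.of_forall fun p => ?_)).congr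
      (Eventually.of_forall fun p => ?_)
    · have h1 := continuous_phase h
      have h2 := continuous_sym
      fun_prop
    · rw [norm_mul, norm_phase, Complex.norm_exp_ofReal_mul_I, one_mul]
    · simp only [Function.uncurry]
      ring
  calc ∫ ξ, phase h ξ * resolv κ ξ * G ξ
      = -Complex.I * ∫ ξ, ∫ s in Set.Ioi (0 : ℝ), (Real.exp (-κ * s) : ℂ) *
          (Complex.exp (((s * sym ξ : ℝ) : ℂ) * Complex.I) * (phase h ξ * G ξ)) := by
        rw [← integral_const_mul]
        refine integral_congr_ae (Eventually.of_forall fun ξ => ?_)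
        simp only
        simp_rw [← mul_assoc, integral_mul_const]
        rw [resolv_eq_integral hκ]
        ring
    _ = _ := by
        rw [integral_integral_swap hint]
        congr 1
        refine integral_congr_ae (Eventually.of_forall fun s => ?_)
        simp only
        rw [integral_const_mul]
        rfl

theorem norm_exp_mul_schrod_le {κ s : ℝ} (hκ : 0 < κ) (hs : s ∈ Set.Ioi (0 : ℝ)) {z : ℂ} {D : ℝ}
    (hz : ‖z‖ ≤ D) : ‖(Real.exp (-κ * s) : ℂ) * z‖ ≤ D := by
  have hs' : 0 < s := hs
  rw [norm_mul, Complex.norm_real, Real.norm_of_nonneg (Real.exp_pos _).le]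
  have : Real.exp (-κ * s) ≤ 1 := Real.exp_le_one_iff.2 (by nlinarith)
  exact (mul_le_of_le_one_left (norm_nonneg _) this).trans hz

/-- In the time representation the limit in `κ` only removes the factor `exp (-κs)`; the dominating
function comes from the dispersive estimate. -/
theorem tendsto_integral_resolv (G : 𝓢(E3, ℂ)) :
    Tendsto (fun κ : ℝ => ∫ ξ, resolv κ ξ * G ξ) (𝓝[>] 0)
      (𝓝 (-Complex.I * ∫ s in Set.Ioi (0 : ℝ), schrod G s 0)) := by
  obtain ⟨D, hD, hbound⟩ := exists_integrableOn_bound_schrod G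
  have h1 : Tendsto (fun κ : ℝ => -Complex.I *
      ∫ s in Set.Ioi (0 : ℝ), (Real.exp (-κ * s) : ℂ) * schrod G s 0) (𝓝[>] 0)
      (𝓝 (-Complex.I * ∫ s in Set.Ioi (0 : ℝ), schrod G s 0)) := by
    refine Tendsto.const_mul _ ?_
    refine tendsto_integral_filter_of_dominated_convergence D ?_ ?_ hD ?_
    · filter_upwards with κ
      exact (Continuous.aestronglyMeasurable (by fun_prop)).mul
        (aestronglyMeasurable_schrod G.continuous 0).aestronglyMeasurable
    · filter_upwards [self_mem_nhdsWithin] with κ hκ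
      filter_upwards [ae_restrict_mem measurableSet_Ioi] with s hs
      exact norm_exp_mul_schrod_le hκ hs (hbound s hs 0)
    · filter_upwards with s
      have : Continuous fun κ : ℝ => (Real.exp (-κ * s) : ℂ) * schrod G s 0 := by fun_prop
      have h2 := (this.tendsto 0).mono_left (nhdsWithin_le_nhds (s := Set.Ioi 0))
      simpa using h2
  refine h1.congr' ?_
  filter_upwards [self_mem_nhdsWithin] with κ hκ
  rw [← integral_phase_resolv_eq hκ]
  simp

/-- This is the Riemann–Lebesgue lemma, `h` being the dual variable of `ξ`. -/
theorem tendsto_schrod_cocompact {G : E3 → ℂ} (s : ℝ) :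
    Tendsto (fun h => schrod G s h) (cocompact E3) (𝓝 0) := by
  have h1 := tendsto_integral_exp_inner_smul_cocompact
    (fun ξ : E3 => Complex.exp (((s * sym ξ : ℝ) : ℂ) * Complex.I) * G ξ)
  refine h1.congr fun h => integral_congr_ae (Eventually.of_forall fun ξ => ?_)
  simp only [Circle.smul_def, Real.fourierChar_apply, smul_eq_mul, phase]
  rw [real_inner_comm]
  have : (2 * Real.pi * -(inner ℝ h ξ) : ℝ) = -2 * Real.pi * inner ℝ h ξ := by ring
  rw [this]
  ring

/-- Far translations decouple, uniformly in the absorption. -/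
theorem tendsto_integral_phase_resolv {ι : Type*} {l : Filter ι} [l.IsCountablyGenerated]
    {κ : ι → ℝ} {h : ι → E3}
    (hκ : ∀ᶠ i in l, 0 < κ i) (hh : Tendsto h l (cocompact E3)) (G : 𝓢(E3, ℂ)) :
    Tendsto (fun i => ∫ ξ, phase (h i) ξ * resolv (κ i) ξ * G ξ) l (𝓝 0) := by
  obtain ⟨D, hD, hbound⟩ := exists_integrableOn_bound_schrod G
  have h1 : Tendsto (fun i => -Complex.I *
      ∫ s in Set.Ioi (0 : ℝ), (Real.exp (-κ i * s) : ℂ) * schrod G s (h i)) l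
      (𝓝 (-Complex.I * ∫ _s in Set.Ioi (0 : ℝ), 0)) := by
    refine Tendsto.const_mul _ ?_
    refine tendsto_integral_filter_of_dominated_convergence D ?_ ?_ hD ?_
    · filter_upwards with i
      exact (Continuous.aestronglyMeasurable (by fun_prop)).mul
        (aestronglyMeasurable_schrod G.continuous _).aestronglyMeasurable
    · filter_upwards [hκ] with i hi
      filter_upwards [ae_restrict_mem measurableSet_Ioi] with s hs
      exact norm_exp_mul_schrod_le hi hs (hbound s hs _)
    · filter_upwards [ae_restrict_mem measurableSet_Ioi] with s hs
      have h2 : Tendsto (fun i => ‖schrod G s (h i)‖) l (𝓝 0) := by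
        simpa using ((tendsto_schrod_cocompact s).comp hh).norm
      refine squeeze_zero_norm' ?_ h2
      filter_upwards [hκ] with i hi
      exact norm_exp_mul_schrod_le hi hs le_rfl
  simp only [integral_zero, mul_zero] at h1
  refine h1.congr' ?_
  filter_upwards [hκ] with i hi
  rw [← integral_phase_resolv_eq hi]

/-! ### Approximate identities in the symbol -/

/-- Integration in polar coordinates. -/
theorem integral_eq_integral_sphere {F : E3 → ℂ} (hF : Integrable F) :
    ∫ ξ, F ξ = ∫ r in Set.Ioi (0 : ℝ), ((r ^ 2 : ℝ) : ℂ) *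
      ∫ ω : Metric.sphere (0 : E3) 1, F (r • (ω : E3)) ∂(volume : Measure E3).toSphere := by
  have hdim : Module.finrank ℝ E3 - 1 = 2 := by simp
  set σ := (volume : Measure E3).toSphere with hσ
  set g : Metric.sphere (0 : E3) 1 × Set.Ioi (0 : ℝ) → ℂ := fun p => F ((p.2 : ℝ) • (p.1 : E3))
    with hg
  have hgh : ∀ x : ({0}ᶜ : Set E3), g (homeomorphUnitSphereProd E3 x) = F x := by
    intro x
    have := congrArg Subtype.val ((homeomorphUnitSphereProd E3).symm_apply_apply x)
    rw [homeomorphUnitSphereProd_symm_apply_coe] at this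
    simp only [hg]
    rw [this]
  have hmp := (volume : Measure E3).measurePreserving_homeomorphUnitSphereProd
  rw [hdim] at hmp
  have hemb : MeasurableEmbedding (homeomorphUnitSphereProd E3) :=
    Homeomorph.measurableEmbedding _
  have hint : Integrable g (σ.prod (Measure.volumeIoiPow 2)) := by
    rw [← hmp.integrable_comp_emb hemb]
    have : g ∘ homeomorphUnitSphereProd E3 = F ∘ Subtype.val := funext hgh
    rw [this, ← integrableOn_iff_comap_subtypeVal (measurableSet_singleton _).compl]
    exact hF.integrableOn
  calc ∫ ξ, F ξ = ∫ x : ({(0)}ᶜ : Set E3), F x ∂((volume : Measure E3).comap (↑)) := by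
        rw [integral_subtype_comap (measurableSet_singleton _).compl F, restrict_compl_singleton]
    _ = ∫ p, g p ∂σ.prod (Measure.volumeIoiPow 2) := by
        rw [← hmp.integral_comp hemb]
        simp_rw [hgh]
    _ = ∫ r : Set.Ioi (0 : ℝ), ∫ ω, F ((r : ℝ) • (ω : E3)) ∂σ ∂(Measure.volumeIoiPow 2) :=
        integral_prod_symm _ hint
    _ = _ := by
        simp only [Measure.volumeIoiPow, ENNReal.ofReal]
        rw [integral_withDensity_eq_integral_smul,
          integral_subtype_comap measurableSet_Ioi fun a : ℝ =>
            Real.toNNReal (a ^ 2) • ∫ ω, F (a • (ω : E3)) ∂σ]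
        · refine setIntegral_congr_fun measurableSet_Ioi fun x hx => ?_
          simp only [NNReal.smul_def, Real.coe_toNNReal _ (sq_nonneg x), Complex.real_smul]
        · exact (measurable_subtype_coe.pow_const _).real_toNNReal

/-- The density of the image of `G dξ` under `sym`. -/
def symDensity (G : E3 → ℂ) (t : ℝ) : ℂ :=
  -- With `t = 4π²r² - 1` one has `r² dr = r / (8π²) dt`. For `t ≤ -1` the square root is zero, so
  -- the density extends continuously by zero.
  ((Real.sqrt (1 + t) / (2 * Real.pi) / (8 * Real.pi ^ 2) : ℝ) : ℂ) *
    ∫ ω : Metric.sphere (0 : E3) 1,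
      G ((Real.sqrt (1 + t) / (2 * Real.pi)) • (ω : E3)) ∂(volume : Measure E3).toSphere

theorem continuous_integral_sphere (G : 𝓢(E3, ℂ)) :
    Continuous fun r : ℝ => ∫ ω : Metric.sphere (0 : E3) 1, G (r • (ω : E3))
      ∂(volume : Measure E3).toSphere := by
  refine continuous_of_dominated (bound := fun _ => SchwartzMap.seminorm ℝ 0 0 G) ?_ ?_ ?_ ?_
  · intro r
    have := G.continuous
    exact Continuous.aestronglyMeasurable (by fun_prop)
  · intro r
    exact Eventually.of_forall fun ω => SchwartzMap.norm_le_seminorm ℝ G _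
  · exact integrable_const _
  · refine Eventually.of_forall fun ω => ?_
    have := G.continuous
    fun_prop

theorem continuous_symDensity (G : 𝓢(E3, ℂ)) : Continuous (symDensity G) := by
  have h1 : Continuous fun t : ℝ => Real.sqrt (1 + t) / (2 * Real.pi) := by fun_prop
  refine Continuous.mul ?_ ((continuous_integral_sphere G).comp h1)
  fun_prop

theorem exists_bound_symDensity (G : 𝓢(E3, ℂ)) : ∃ C, ∀ t, ‖symDensity G t‖ ≤ C := by
  set S := SchwartzMap.seminorm ℝ 1 0 G
  refine ⟨1 / (8 * Real.pi ^ 2) * (S * (volume : Measure E3).toSphere.real Set.univ), fun t => ?_⟩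
  set r := Real.sqrt (1 + t) / (2 * Real.pi) with hr
  have hr0 : 0 ≤ r := by positivity
  have h1 : ‖(r : ℂ) * ∫ ω : Metric.sphere (0 : E3) 1, G (r • (ω : E3))
      ∂(volume : Measure E3).toSphere‖ ≤ S * (volume : Measure E3).toSphere.real Set.univ := by
    rw [← integral_const_mul]
    refine norm_integral_le_of_norm_le_const (Eventually.of_forall fun ω => ?_)
    have h2 := SchwartzMap.norm_pow_mul_le_seminorm ℝ G 1 (r • (ω : E3))
    have h3 : ‖(ω : E3)‖ = 1 := by simp
    rw [norm_smul, h3, mul_one, pow_one, Real.norm_eq_abs] at h2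
    rwa [norm_mul, Complex.norm_real, Real.norm_eq_abs]
  have h2 : symDensity G t = ((1 / (8 * Real.pi ^ 2) : ℝ) : ℂ) *
      ((r : ℂ) * ∫ ω : Metric.sphere (0 : E3) 1, G (r • (ω : E3))
        ∂(volume : Measure E3).toSphere) := by
    rw [symDensity, ← hr]
    push_cast
    ring
  rw [h2, norm_mul, Complex.norm_real, Real.norm_of_nonneg (by positivity)]
  gcongr

/-- Polar coordinates, followed by the substitution `s = (4π²r² - 1) / η`, which maps `r > 0`
bijectively onto `s > -1 / η`. -/
theorem integral_comp_sym_div {G : 𝓢(E3, ℂ)} {φ : ℝ → ℂ} (hφ : Measurable φ) {c : ℝ}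
    (hc : ∀ t, ‖φ t‖ ≤ c) {η : ℝ} (hη : 0 < η) :
    (η : ℂ)⁻¹ * ∫ ξ, G ξ * φ (sym ξ / η) =
      ∫ s in Set.Ioi (-1 / η), symDensity G (η * s) * φ s := by
  have hint : Integrable (fun ξ => G ξ * φ (sym ξ / η)) (volume : Measure E3) := by
    refine (G.integrable (μ := volume)).mul_bdd (c := c) ?_ (Eventually.of_forall fun ξ => hc _)
    exact (hφ.comp (continuous_sym.measurable.div_const η)).aestronglyMeasurable
  set f : ℝ → ℝ := fun r => (4 * Real.pi ^ 2 * r ^ 2 - 1) / η with hf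
  have hpi := Real.pi_pos
  have himage : f '' Set.Ioi 0 = Set.Ioi (-1 / η) := by
    ext s
    simp only [Set.mem_image, Set.mem_Ioi, hf]
    constructor
    · rintro ⟨r, hr, rfl⟩
      have : 0 < 4 * Real.pi ^ 2 * r ^ 2 := by positivity
      gcongr
      linarith
    · intro hs
      rw [div_lt_iff₀ hη] at hs
      refine ⟨Real.sqrt (1 + s * η) / (2 * Real.pi), ?_, ?_⟩
      · have : 0 < Real.sqrt (1 + s * η) := Real.sqrt_pos.2 (by linarith)
        positivity
      · rw [div_pow, Real.sq_sqrt (by linarith)]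
        field_simp
        ring
  have hinj : Set.InjOn f (Set.Ioi 0) := by
    intro a ha b hb hab
    simp only [Set.mem_Ioi] at ha hb
    have h1 : 4 * Real.pi ^ 2 * a ^ 2 - 1 = 4 * Real.pi ^ 2 * b ^ 2 - 1 := by
      have := congrArg (· * η) hab
      simpa [hf, hη.ne'] using this
    have h2 : a ^ 2 = b ^ 2 := by
      have h3 : (0 : ℝ) < 4 * Real.pi ^ 2 := by positivity
      nlinarith
    exact (pow_left_inj₀ ha.le hb.le two_ne_zero).1 h2
  have hderiv : ∀ r ∈ Set.Ioi (0 : ℝ), HasDerivWithinAt f (8 * Real.pi ^ 2 * r / η) (Set.Ioi 0) r := by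
    intro r _
    have h1 : HasDerivAt f ((4 * Real.pi ^ 2 * (2 * r)) / η) r := by
      have := (((hasDerivAt_pow 2 r).const_mul (4 * Real.pi ^ 2)).sub_const 1).div_const η
      simpa using this
    refine (h1.congr_deriv ?_).hasDerivWithinAt
    ring
  rw [← himage, integral_image_eq_integral_abs_deriv_smul measurableSet_Ioi hderiv hinj,
    integral_eq_integral_sphere hint, ← integral_const_mul]
  refine setIntegral_congr_fun measurableSet_Ioi fun r hr => ?_
  have hr' : 0 < r := hr
  have hηf : η * f r = 4 * Real.pi ^ 2 * r ^ 2 - 1 := by simp only [hf]; field_simp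
  have hsq : Real.sqrt (1 + (4 * Real.pi ^ 2 * r ^ 2 - 1)) / (2 * Real.pi) = r := by
    have : 1 + (4 * Real.pi ^ 2 * r ^ 2 - 1) = (2 * Real.pi * r) ^ 2 := by ring
    rw [this, Real.sqrt_sq (by positivity)]
    field_simp
  have hsym : ∀ ω : Metric.sphere (0 : E3) 1, sym (r • (ω : E3)) / η = f r := by
    intro ω
    have h3 : ‖(ω : E3)‖ = 1 := by simp
    simp only [sym, hf, norm_smul, h3, mul_one, Real.norm_eq_abs, sq_abs]
  simp only [hsym, symDensity, hηf, hsq]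
  rw [integral_mul_const, abs_of_pos (by positivity), Complex.real_smul]
  push_cast
  have h1 : (η : ℂ) ≠ 0 := Complex.ofReal_ne_zero.2 hη.ne'
  have h2 : (Real.pi : ℂ) ≠ 0 := Complex.ofReal_ne_zero.2 hpi.ne'
  field_simp

/-- Dilations of a kernel in the symbol converge to a multiple of the density at the sphere. -/
theorem tendsto_integral_comp_sym_div (G : 𝓢(E3, ℂ)) {φ : ℝ → ℂ} (hφ : Measurable φ) {c : ℝ}
    (hc : ∀ t, ‖φ t‖ ≤ c * (1 + t ^ 2)⁻¹) :
    Tendsto (fun η : ℝ => (η : ℂ)⁻¹ * ∫ ξ, G ξ * φ (sym ξ / η)) (𝓝[>] 0)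
      (𝓝 (symDensity G 0 * ∫ s, φ s)) := by
  have hc0 : 0 ≤ c := by simpa using (norm_nonneg _).trans (hc 0)
  obtain ⟨C, hC⟩ := exists_bound_symDensity G
  have hC0 : 0 ≤ C := (norm_nonneg _).trans (hC 0)
  have hcb : ∀ t, ‖φ t‖ ≤ c := fun t => (hc t).trans
    (mul_le_of_le_one_right hc0 (inv_le_one_of_one_le₀ (by nlinarith [sq_nonneg t])))
  have h1 : Tendsto (fun η : ℝ => ∫ s, (Set.Ioi (-1 / η)).indicator
      (fun s => symDensity G (η * s) * φ s) s) (𝓝[>] 0) (𝓝 (∫ s, symDensity G 0 * φ s)) := by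
    refine tendsto_integral_filter_of_dominated_convergence
      (fun s => C * (c * (1 + s ^ 2)⁻¹)) ?_ ?_ ?_ ?_
    · filter_upwards with η
      refine AEStronglyMeasurable.indicator ?_ measurableSet_Ioi
      have := continuous_symDensity G
      exact (Continuous.aestronglyMeasurable (by fun_prop)).mul hφ.aestronglyMeasurable
    · filter_upwards with η
      filter_upwards with s
      refine (norm_indicator_le_norm_self _ _).trans ?_
      rw [norm_mul]
      exact mul_le_mul (hC _) (hc s) (norm_nonneg _) hC0
    · exact (integrable_inv_one_add_sq.const_mul c).const_mul C
    · filter_upwards with s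
      have h2 : Tendsto (fun η : ℝ => symDensity G (η * s) * φ s) (𝓝[>] 0)
          (𝓝 (symDensity G 0 * φ s)) := by
        have := continuous_symDensity G
        have h3 : Continuous fun η : ℝ => symDensity G (η * s) * φ s := by fun_prop
        simpa using (h3.tendsto 0).mono_left (nhdsWithin_le_nhds (s := Set.Ioi 0))
      refine h2.congr' ?_
      have h4 : ∀ᶠ η : ℝ in 𝓝[>] 0, -1 < η * s := by
        have h3 : Continuous fun η : ℝ => η * s := by fun_prop
        exact nhdsWithin_le_nhds (h3.tendsto 0 (Ioi_mem_nhds (by simp)))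
      filter_upwards [h4, self_mem_nhdsWithin] with η h5 h6
      have h7 : 0 < η := h6
      rw [Set.indicator_of_mem]
      rw [Set.mem_Ioi, div_lt_iff₀ h7]
      linarith
  rw [integral_const_mul] at h1
  refine h1.congr' ?_
  filter_upwards [self_mem_nhdsWithin] with η hη
  rw [integral_comp_sym_div hφ hcb hη, integral_indicator measurableSet_Ioi]

/-! ### Limiting absorption, principal value and surface measure on `B` -/

theorem mulForm_schwartz_eq (m : E3 → ℂ) {f v G : 𝓢(E3, ℂ)}
    (hG : ∀ ξ, G ξ = 𝓕 (f : E3 → ℂ) ξ * (starRingEnd ℂ) (𝓕 (v : E3 → ℂ) ξ)) :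
    mulForm m f v = ∫ ξ, m ξ * G ξ := by
  rw [mulForm_schwartz]
  simp_rw [hG]

/-! ### Multipliers dominated by the Poisson kernel. -/

/-- The Poisson kernel in the symbol. -/
def poisson (κ : ℝ) (ξ : E3) : ℝ := κ / (sym ξ ^ 2 + κ ^ 2)

theorem poisson_nonneg {κ : ℝ} (hκ : 0 < κ) (ξ : E3) : 0 ≤ poisson κ ξ := by
  unfold poisson; positivity

theorem resolv_im {κ : ℝ} (ξ : E3) : (resolv κ ξ).im = -poisson κ ξ := by
  rw [resolv, one_div, Complex.inv_im, poisson, Complex.normSq_apply]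
  simp
  ring

theorem poisson_le {κ : ℝ} (hκ : 0 < κ) (ξ : E3) : poisson κ ξ ≤ 1 / κ := by
  have h := (Complex.abs_im_le_norm _).trans (norm_resolv_le hκ ξ)
  rw [resolv_im, abs_neg] at h
  exact (le_abs_self _).trans h

theorem continuous_poisson {κ : ℝ} (hκ : 0 < κ) : Continuous (poisson κ) := by
  have := continuous_sym
  unfold poisson
  exact continuous_const.div (by fun_prop) fun ξ => by positivity

theorem integrable_poisson_mul {κ : ℝ} (hκ : 0 < κ) (f v : E3 → ℂ) :
    Integrable (fun ξ => poisson κ ξ * (‖planch f ξ‖ * ‖planch v ξ‖)) (volume : Measure E3) := by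
  have h : Integrable (fun ξ => ‖planch f ξ‖ * ‖planch v ξ‖) (volume : Measure E3) := by
    simpa using (integrable_mul_conj (memLp_planch f) (memLp_planch v)).norm
  refine h.bdd_mul (c := 1 / κ) (continuous_poisson hκ).aestronglyMeasurable
    (Eventually.of_forall fun ξ => ?_)
  rw [Real.norm_of_nonneg (poisson_nonneg hκ ξ)]
  exact poisson_le hκ ξ

/-- The Poisson kernel is minus the imaginary part of the resolvent. On the diagonal `v = f` the
form has a density of constant sign in its imaginary part, so the resolvent bound controls an
absolutely convergent integral uniformly in `κ`. -/
theorem integral_poisson_mul_sq_le {κ : ℝ} (hκ : 0 < κ) {f : E3 → ℂ} (hf : MemB f) :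
    ∫ ξ, poisson κ ξ * (‖planch f ξ‖ * ‖planch f ξ‖) ≤ 16 * nB f ^ 2 := by
  have h1 := formBound_resolv hκ f f hf hf
  have h2 : (mulForm (resolv κ) f f).im = -∫ ξ, poisson κ ξ * (‖planch f ξ‖ * ‖planch f ξ‖) := by
    have hint := integrable_mulForm (f := f) (v := f) (measurable_resolv κ).aestronglyMeasurable
      (norm_resolv_le hκ)
    have h3 := integral_im hint
    simp only [RCLike.im_to_complex] at h3
    rw [mulForm, ← h3, ← integral_neg]
    refine integral_congr_ae (Eventually.of_forall fun ξ => ?_)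
    simp only
    rw [Complex.mul_conj, Complex.im_mul_ofReal, resolv_im, Complex.normSq_eq_norm_sq]
    ring
  have h3 := (Complex.abs_im_le_norm _).trans h1
  rw [h2, abs_neg] at h3
  exact (le_abs_self _).trans (h3.trans (le_of_eq (by ring)))

/-- Cauchy–Schwarz for the measure with density `poisson κ` reduces to the diagonal case. -/
theorem integral_poisson_mul_le {κ : ℝ} (hκ : 0 < κ) {f v : E3 → ℂ} (hf : MemB f) (hv : MemB v) :
    ∫ ξ, poisson κ ξ * (‖planch f ξ‖ * ‖planch v ξ‖) ≤ 16 * (nB f * nB v) := by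
  set s : E3 → ℝ := fun ξ => Real.sqrt (poisson κ ξ) with hs
  have hsm : Continuous s := (continuous_poisson hκ).sqrt
  have hss : ∀ ξ, s ξ * s ξ = poisson κ ξ := fun ξ => Real.mul_self_sqrt (poisson_nonneg hκ ξ)
  have hmem : ∀ g : E3 → ℂ, MemLp (fun ξ => s ξ * ‖planch g ξ‖) (ENNReal.ofReal 2) volume := by
    intro g
    rw [ENNReal.ofReal_ofNat]
    refine (memLp_two_iff_integrable_sq_norm ?_).2 ?_
    · exact hsm.aestronglyMeasurable.mul (aestronglyMeasurable_planch g).norm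
    · refine (integrable_poisson_mul hκ g g).congr (Eventually.of_forall fun ξ => ?_)
      simp only [norm_mul, mul_pow, Real.norm_eq_abs, sq_abs]
      rw [← hss]
      ring
  have h1 := integral_mul_le_Lp_mul_Lq_of_nonneg (μ := (volume : Measure E3))
    Real.HolderConjugate.two_two (f := fun ξ => s ξ * ‖planch f ξ‖)
    (g := fun ξ => s ξ * ‖planch v ξ‖) (Eventually.of_forall fun ξ => by positivity)
    (Eventually.of_forall fun ξ => by positivity) (hmem f) (hmem v)
  have h2 : ∀ {g : E3 → ℂ}, MemB g →
      (∫ ξ, (s ξ * ‖planch g ξ‖) ^ (2 : ℝ)) ^ (1 / 2 : ℝ) ≤ 4 * nB g := by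
    intro g hg
    have h3 : ∫ ξ, (s ξ * ‖planch g ξ‖) ^ (2 : ℝ) ≤ (4 * nB g) ^ 2 := by
      refine le_trans (le_of_eq ?_) ((integral_poisson_mul_sq_le hκ hg).trans (le_of_eq (by ring)))
      refine integral_congr_ae (Eventually.of_forall fun ξ => ?_)
      simp only [Real.rpow_two]
      rw [← hss]
      ring
    rw [← Real.sqrt_eq_rpow]
    exact Real.sqrt_le_iff.2 ⟨mul_nonneg (by norm_num) (nB_nonneg g), h3⟩
  calc _ = ∫ ξ, s ξ * ‖planch f ξ‖ * (s ξ * ‖planch v ξ‖) := by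
        refine integral_congr_ae (Eventually.of_forall fun ξ => ?_)
        simp only
        rw [← hss]
        ring
    _ ≤ _ := h1
    _ ≤ (4 * nB f) * (4 * nB v) :=
        mul_le_mul (h2 hf) (h2 hv) (by positivity) (mul_nonneg (by norm_num) (nB_nonneg f))
    _ = _ := by ring

/-- No regularity of `m` enters: the sharp cutoffs in the principal value and in the delta term are
therefore admissible. -/
theorem formBound_of_le_poisson {m : E3 → ℂ} {κ c : ℝ} (hκ : 0 < κ) (hc : 0 ≤ c)
    (hm : ∀ ξ, ‖m ξ‖ ≤ c * poisson κ ξ) : FormBound m (16 * c) := by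
  intro f v hf hv
  calc ‖mulForm m f v‖ ≤ ∫ ξ, c * (poisson κ ξ * (‖planch f ξ‖ * ‖planch v ξ‖)) := by
        refine norm_integral_le_of_norm_le ((integrable_poisson_mul hκ f v).const_mul c)
          (Eventually.of_forall fun ξ => ?_)
        rw [norm_mul, norm_mul, RCLike.norm_conj, ← mul_assoc c]
        gcongr
        exact hm ξ
    _ ≤ c * (16 * (nB f * nB v)) := by
        rw [integral_const_mul]
        gcongr
        exact integral_poisson_mul_le hκ hf hv
    _ = 16 * c * nB f * nB v := by ring

/-- The dilated kernel `η⁻¹ φ(· / η)` in the symbol. -/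
def dilation (φ : ℝ → ℂ) (η : ℝ) (ξ : E3) : ℂ := (η : ℂ)⁻¹ * φ (sym ξ / η)

/-- The dilation of `(1 + t²)⁻¹` by `η` is exactly the Poisson kernel at absorption `η`. -/
theorem norm_dilation_le {φ : ℝ → ℂ} {c : ℝ} (hc : ∀ t, ‖φ t‖ ≤ c * (1 + t ^ 2)⁻¹) {η : ℝ}
    (hη : 0 < η) (ξ : E3) : ‖dilation φ η ξ‖ ≤ c * poisson η ξ := by
  rw [dilation, norm_mul, norm_inv, Complex.norm_real, Real.norm_of_nonneg hη.le]
  calc η⁻¹ * ‖φ (sym ξ / η)‖ ≤ η⁻¹ * (c * (1 + (sym ξ / η) ^ 2)⁻¹) := by gcongr; exact hc _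
    _ = c * poisson η ξ := by
        unfold poisson
        field_simp
        ring

theorem measurable_dilation {φ : ℝ → ℂ} (hφ : Measurable φ) (η : ℝ) : Measurable (dilation φ η) := by
  have := continuous_sym.measurable
  exact (hφ.comp (this.div_const η)).const_mul _

theorem dilation_admissible {φ : ℝ → ℂ} (hφ : Measurable φ) {c : ℝ}
    (hc : ∀ t, ‖φ t‖ ≤ c * (1 + t ^ 2)⁻¹) {η : ℝ} (hη : 0 < η) :
    AEStronglyMeasurable (dilation φ η) volume ∧ (∃ M : ℝ, ∀ ξ, ‖dilation φ η ξ‖ ≤ M) ∧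
      FormBound (dilation φ η) (16 * c) := by
  have hc0 : 0 ≤ c := by simpa using (norm_nonneg _).trans (hc 0)
  refine ⟨(measurable_dilation hφ η).aestronglyMeasurable, ⟨c * (1 / η), fun ξ => ?_⟩,
    formBound_of_le_poisson hη hc0 (norm_dilation_le hc hη)⟩
  refine (norm_dilation_le hc hη ξ).trans ?_
  gcongr
  exact poisson_le hη ξ

theorem tendsto_mulForm_dilation_schwartz {φ : ℝ → ℂ} (hφ : Measurable φ) {c : ℝ}
    (hc : ∀ t, ‖φ t‖ ≤ c * (1 + t ^ 2)⁻¹) {f v G : 𝓢(E3, ℂ)}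
    (hG : ∀ ξ, G ξ = 𝓕 (f : E3 → ℂ) ξ * (starRingEnd ℂ) (𝓕 (v : E3 → ℂ) ξ)) :
    Tendsto (fun η : ℝ => mulForm (dilation φ η) f v) (𝓝[>] 0)
      (𝓝 (symDensity G 0 * ∫ s, φ s)) := by
  refine (tendsto_integral_comp_sym_div G hφ hc).congr fun η => ?_
  rw [mulForm_schwartz_eq _ hG, ← integral_const_mul]
  refine integral_congr_ae (Eventually.of_forall fun ξ => ?_)
  simp only [dilation]
  ring

theorem exists_tendsto_mulForm_dilation {φ : ℝ → ℂ} (hφ : Measurable φ) {c : ℝ}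
    (hc : ∀ t, ‖φ t‖ ≤ c * (1 + t ^ 2)⁻¹) {f v : E3 → ℂ} (hf : MemB f) (hv : MemB v) :
    ∃ L, Tendsto (fun η : ℝ => mulForm (dilation φ η) f v) (𝓝[>] 0) (𝓝 L) := by
  have hc0 : 0 ≤ c := by simpa using (norm_nonneg _).trans (hc 0)
  refine exists_tendsto_mulForm (C := 16 * c) ?_ (by positivity) (fun f v => ?_) hf hv
  · filter_upwards [self_mem_nhdsWithin] with η hη
    exact dilation_admissible hφ hc hη
  · obtain ⟨G, hG⟩ := exists_schwartz_fourier_mul_conj f v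
    exact ⟨_, tendsto_mulForm_dilation_schwartz hφ hc hG⟩

/-- On Schwartz pairs the limit is proportional to `∫ φ`. For general data no density on the sphere
is at hand, and this vanishing is what relates the limits for different profiles. -/
theorem tendsto_mulForm_dilation_zero {φ : ℝ → ℂ} (hφ : Measurable φ) {c : ℝ}
    (hc : ∀ t, ‖φ t‖ ≤ c * (1 + t ^ 2)⁻¹) (h0 : ∫ s, φ s = 0) {f v : E3 → ℂ} (hf : MemB f)
    (hv : MemB v) : Tendsto (fun η : ℝ => mulForm (dilation φ η) f v) (𝓝[>] 0) (𝓝 0) := by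
  have hc0 : 0 ≤ c := by simpa using (norm_nonneg _).trans (hc 0)
  refine tendsto_mulForm_zero (C := 16 * c) ?_ (by positivity) (fun f v => ?_) hf hv
  · filter_upwards [self_mem_nhdsWithin] with η hη
    exact dilation_admissible hφ hc hη
  · obtain ⟨G, hG⟩ := exists_schwartz_fourier_mul_conj f v
    have := tendsto_mulForm_dilation_schwartz hφ hc hG
    rwa [h0, mul_zero] at this

theorem resolv_admissible {κ : ℝ} (hκ : 0 < κ) (h : E3) :
    AEStronglyMeasurable (fun ξ => phase h ξ * resolv κ ξ) volume ∧
      (∃ M : ℝ, ∀ ξ, ‖phase h ξ * resolv κ ξ‖ ≤ M) ∧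
      FormBound (fun ξ => phase h ξ * resolv κ ξ) 16 :=
  ⟨aestronglyMeasurable_phase_mul_resolv κ h, ⟨_, norm_phase_mul_resolv_le hκ h⟩,
    formBound_phase_mul_resolv hκ h⟩

/-- The limiting absorption principle, in weak form. -/
theorem exists_tendsto_mulForm_resolv {f v : E3 → ℂ} (hf : MemB f) (hv : MemB v) :
    ∃ L, Tendsto (fun κ : ℝ => mulForm (resolv κ) f v) (𝓝[>] 0) (𝓝 L) := by
  refine exists_tendsto_mulForm (C := 16) ?_ (by positivity) (fun f v => ?_) hf hv
  · filter_upwards [self_mem_nhdsWithin] with κ hκ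
    simpa using resolv_admissible hκ 0
  · obtain ⟨G, hG⟩ := exists_schwartz_fourier_mul_conj f v
    refine ⟨_, (tendsto_integral_resolv G).congr fun κ => ?_⟩
    rw [mulForm_schwartz_eq _ hG]

theorem tendsto_mulForm_phase_mul_resolv {ι : Type*} {l : Filter ι} [l.IsCountablyGenerated]
    {κ : ι → ℝ} {h : ι → E3} (hκ : ∀ᶠ i in l, 0 < κ i) (hh : Tendsto h l (cocompact E3))
    {f v : E3 → ℂ} (hf : MemB f) (hv : MemB v) :
    Tendsto (fun i => mulForm (fun ξ => phase (h i) ξ * resolv (κ i) ξ) f v) l (𝓝 0) := by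
  refine tendsto_mulForm_zero (C := 16) ?_ (by positivity) (fun f v => ?_) hf hv
  · filter_upwards [hκ] with i hi
    exact resolv_admissible hi _
  · obtain ⟨G, hG⟩ := exists_schwartz_fourier_mul_conj f v
    refine (tendsto_integral_phase_resolv hκ hh G).congr fun i => ?_
    rw [mulForm_schwartz_eq _ hG]

/-! ### The Sokhotski–Plemelj formula. -/

/-- The truncation of `1 / p` to `η < |p|`. -/
def pvSym (η : ℝ) (ξ : E3) : ℂ := if η < |sym ξ| then 1 / (sym ξ : ℂ) else 0

/-- The normalised indicator function of `|p| < η`. -/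
def deltaSym (η : ℝ) (ξ : E3) : ℂ := if |sym ξ| < η then ((2 * η : ℝ) : ℂ)⁻¹ else 0

/-- The profile of the difference of the truncated `1 / p` and `1 / (p + iη)`. -/
def pvProfile (t : ℝ) : ℂ := (if 1 < |t| then 1 / (t : ℂ) else 0) - 1 / ((t : ℂ) + Complex.I)

def boxProfile (t : ℝ) : ℂ := if |t| < 1 then 2⁻¹ else 0

theorem measurable_pvProfile : Measurable pvProfile := by
  refine Measurable.sub (Measurable.ite (measurableSet_lt measurable_const (by fun_prop)) ?_
    measurable_const) ?_ <;> fun_prop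

theorem measurable_boxProfile : Measurable boxProfile :=
  Measurable.ite (measurableSet_lt (by fun_prop) measurable_const) measurable_const measurable_const

theorem add_I_ne_zero (t : ℝ) : (t : ℂ) + Complex.I ≠ 0 := fun h => by
  have := congrArg Complex.im h
  simp at this

theorem norm_add_I_sq (t : ℝ) : ‖(t : ℂ) + Complex.I‖ ^ 2 = 1 + t ^ 2 := by
  rw [← Complex.normSq_eq_norm_sq, Complex.normSq_apply]
  simp
  ring

/-- Each term decays only like `1 / t`, but for `|t| > 1` the difference is `i / (t (t + i))`. -/
theorem norm_pvProfile_le (t : ℝ) : ‖pvProfile t‖ ≤ 2 * (1 + t ^ 2)⁻¹ := by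
  have h0 := add_I_ne_zero t
  have h1 : 0 < ‖(t : ℂ) + Complex.I‖ := norm_pos_iff.2 h0
  rw [← norm_add_I_sq, ← div_eq_mul_inv, le_div_iff₀ (by positivity)]
  unfold pvProfile
  split_ifs with h
  · have ht : t ≠ 0 := fun h' => by rw [h'] at h; norm_num at h
    have ht' : (t : ℂ) ≠ 0 := Complex.ofReal_ne_zero.2 ht
    have h2 : 1 / (t : ℂ) - 1 / ((t : ℂ) + Complex.I) = Complex.I / (t * (t + Complex.I)) := by
      field_simp
      ring
    rw [h2, norm_div, norm_mul, Complex.norm_I, Complex.norm_real, Real.norm_eq_abs, sq]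
    have h3 : ‖(t : ℂ) + Complex.I‖ ≤ 2 * |t| := by
      refine (norm_add_le _ _).trans ?_
      rw [Complex.norm_I, Complex.norm_real, Real.norm_eq_abs]
      linarith
    have h4 : 0 < |t| := by linarith
    calc 1 / (|t| * ‖(t : ℂ) + Complex.I‖) * (‖(t : ℂ) + Complex.I‖ * ‖(t : ℂ) + Complex.I‖)
        = ‖(t : ℂ) + Complex.I‖ / |t| := by field_simp
      _ ≤ 2 := by rw [div_le_iff₀ h4]; exact h3
  · rw [zero_sub, norm_neg, norm_div, norm_one]
    have h3 : ‖(t : ℂ) + Complex.I‖ ≤ 2 := by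
      refine (norm_add_le _ _).trans ?_
      rw [Complex.norm_I, Complex.norm_real, Real.norm_eq_abs]
      linarith
    calc 1 / ‖(t : ℂ) + Complex.I‖ * ‖(t : ℂ) + Complex.I‖ ^ 2 = ‖(t : ℂ) + Complex.I‖ := by
          field_simp
      _ ≤ 2 := h3

theorem norm_boxProfile_le (t : ℝ) : ‖boxProfile t‖ ≤ 1 * (1 + t ^ 2)⁻¹ := by
  rw [one_mul]
  unfold boxProfile
  split_ifs with h
  · rw [norm_inv, RCLike.norm_ofNat]
    gcongr
    have : t ^ 2 < 1 := (sq_lt_one_iff_abs_lt_one t).2 h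
    linarith
  · rw [norm_zero]; positivity

/-- Tying the absorption to the truncation width makes the difference a pure dilation, to which the
Poisson bound applies. -/
theorem pvSym_eq {η : ℝ} (hη : 0 < η) (ξ : E3) :
    pvSym η ξ = resolv η ξ + dilation pvProfile η ξ := by
  have hη' : (η : ℂ) ≠ 0 := Complex.ofReal_ne_zero.2 hη.ne'
  have hiff : (1 < |sym ξ / η|) ↔ η < |sym ξ| := by
    rw [abs_div, abs_of_pos hη, lt_div_iff₀ hη, one_mul]
  have h1 : (η : ℂ)⁻¹ * (1 / (((sym ξ / η : ℝ) : ℂ) + Complex.I)) = resolv η ξ := by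
    rw [resolv, one_div, one_div, ← mul_inv]
    congr 1
    push_cast
    field_simp
  rw [dilation, pvProfile, mul_sub, h1, pvSym]
  simp only [hiff]
  split_ifs with h
  · have hs : (sym ξ : ℂ) ≠ 0 := Complex.ofReal_ne_zero.2 fun h' => by
      rw [h', abs_zero] at h; linarith
    push_cast
    field_simp
    ring
  · ring

theorem deltaSym_eq {η : ℝ} (hη : 0 < η) (ξ : E3) : deltaSym η ξ = dilation boxProfile η ξ := by
  have hiff : (|sym ξ / η| < 1) ↔ |sym ξ| < η := by
    rw [abs_div, abs_of_pos hη, div_lt_iff₀ hη, one_mul]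
  rw [dilation, boxProfile, deltaSym]
  simp only [hiff]
  split_ifs with h
  · push_cast
    rw [mul_inv, mul_comm]
  · ring

theorem integrable_of_le_inv_one_add_sq {φ : ℝ → ℂ} (hφ : Measurable φ) {c : ℝ}
    (hc : ∀ t, ‖φ t‖ ≤ c * (1 + t ^ 2)⁻¹) : Integrable φ :=
  (integrable_inv_one_add_sq.const_mul c).mono' hφ.aestronglyMeasurable (Eventually.of_forall hc)

theorem integral_boxProfile : ∫ t, boxProfile t = 1 := by
  have h : boxProfile = (Set.Ioo (-1 : ℝ) 1).indicator fun _ => (2⁻¹ : ℂ) := by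
    ext t
    simp only [boxProfile, Set.indicator, Set.mem_Ioo, abs_lt]
  rw [h, integral_indicator measurableSet_Ioo, setIntegral_const]
  simp [Measure.real, Real.volume_Ioo]
  norm_num

/-- Symmetrisation under `t ↦ -t` removes the odd part `1 / t` and leaves `2i / (1 + t²)`. -/
theorem integral_pvProfile : ∫ t, pvProfile t = Complex.I * Real.pi := by
  have hint := integrable_of_le_inv_one_add_sq measurable_pvProfile norm_pvProfile_le
  have h1 : ∫ t, pvProfile t = ∫ t, pvProfile (-t) := (integral_neg_eq_self pvProfile volume).symm
  have h2 : ∀ t : ℝ, pvProfile t + pvProfile (-t) = 2 * Complex.I * (((1 + t ^ 2)⁻¹ : ℝ) : ℂ) := by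
    intro t
    have e1 := add_I_ne_zero t
    have e2 := add_I_ne_zero (-t)
    have e3 : (1 + t ^ 2 : ℂ) = -((t + Complex.I) * (((-t : ℝ) : ℂ) + Complex.I)) := by
      push_cast
      linear_combination Complex.I_sq
    have e4 : 1 / ((t : ℂ) + Complex.I) + 1 / (((-t : ℝ) : ℂ) + Complex.I) =
        -(2 * Complex.I * (((1 + t ^ 2)⁻¹ : ℝ) : ℂ)) := by
      rw [Complex.ofReal_inv]
      push_cast at e2 e3 ⊢
      rw [e3]
      field_simp
      ring
    unfold pvProfile
    rw [abs_neg]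
    split_ifs
    · have : 1 / (((-t : ℝ)) : ℂ) = -(1 / (t : ℂ)) := by push_cast; rw [div_neg]
      rw [this]
      linear_combination -e4
    · linear_combination -e4
  have h3 : 2 * ∫ t, pvProfile t = 2 * (Complex.I * Real.pi) := by
    calc 2 * ∫ t, pvProfile t = (∫ t, pvProfile t) + ∫ t, pvProfile (-t) := by rw [← h1]; ring
      _ = ∫ t : ℝ, 2 * Complex.I * (((1 + t ^ 2)⁻¹ : ℝ) : ℂ) := by
          rw [← integral_add hint hint.comp_neg]
          exact integral_congr_ae (Eventually.of_forall h2)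
      _ = _ := by
          rw [integral_const_mul, integral_complex_ofReal, integral_univ_inv_one_add_sq]
          ring
  exact mul_left_cancel₀ two_ne_zero h3

/-- The Sokhotski–Plemelj formula on `B`, with the existence of all limits. -/
theorem exists_tendsto_resolv_pv_delta {f v : E3 → ℂ} (hf : MemB f) (hv : MemB v) :
    ∃ L P D : ℂ, Tendsto (fun κ : ℝ => mulForm (resolv κ) f v) (𝓝[>] 0) (𝓝 L) ∧
      Tendsto (fun η : ℝ => mulForm (pvSym η) f v) (𝓝[>] 0) (𝓝 P) ∧
      Tendsto (fun η : ℝ => mulForm (deltaSym η) f v) (𝓝[>] 0) (𝓝 D) ∧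
      L = P - Complex.I * Real.pi * D := by
  obtain ⟨L, hL⟩ := exists_tendsto_mulForm_resolv hf hv
  obtain ⟨Q, hQ⟩ := exists_tendsto_mulForm_dilation measurable_pvProfile norm_pvProfile_le hf hv
  obtain ⟨D, hD⟩ := exists_tendsto_mulForm_dilation measurable_boxProfile norm_boxProfile_le hf hv
  -- This combination has integral zero, so its dilations vanish in the limit on all of `B × B`,
  -- which forces `Q = iπD`.
  set ψ : ℝ → ℂ := fun t => pvProfile t - Complex.I * Real.pi * boxProfile t with hψ
  have hψm : Measurable ψ := measurable_pvProfile.sub (measurable_boxProfile.const_mul _)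
  have hψb : ∀ t, ‖ψ t‖ ≤ (2 + Real.pi) * (1 + t ^ 2)⁻¹ := by
    intro t
    refine (norm_sub_le _ _).trans ?_
    rw [norm_mul, norm_mul, Complex.norm_I, Complex.norm_real,
      Real.norm_of_nonneg Real.pi_pos.le, one_mul, add_mul]
    have h1 := norm_pvProfile_le t
    have h2 := norm_boxProfile_le t
    rw [one_mul] at h2
    gcongr
  have hψ0 : ∫ t, ψ t = 0 := by
    simp only [hψ]
    rw [integral_sub (integrable_of_le_inv_one_add_sq measurable_pvProfile norm_pvProfile_le)
      ((integrable_of_le_inv_one_add_sq measurable_boxProfile norm_boxProfile_le).const_mul _),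
      integral_const_mul, integral_pvProfile, integral_boxProfile]
    ring
  have hZ := tendsto_mulForm_dilation_zero hψm hψb hψ0 hf hv
  have hadm : ∀ {φ : ℝ → ℂ}, Measurable φ → ∀ {c : ℝ}, (∀ t, ‖φ t‖ ≤ c * (1 + t ^ 2)⁻¹) →
      ∀ {η : ℝ}, 0 < η → Integrable (fun ξ => dilation φ η ξ *
        (planch f ξ * (starRingEnd ℂ) (planch v ξ))) (volume : Measure E3) := by
    intro φ hφ c hc η hη
    obtain ⟨h1, ⟨M, h2⟩, -⟩ := dilation_admissible hφ hc hη
    exact integrable_mulForm h1 h2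
  have hQD : Q - Complex.I * Real.pi * D = 0 := by
    refine tendsto_nhds_unique (hQ.sub (hD.const_mul _)) (hZ.congr' ?_)
    filter_upwards [self_mem_nhdsWithin] with η hη
    have hη' : 0 < η := hη
    unfold mulForm
    rw [← integral_const_mul, ← integral_sub
      (hadm measurable_pvProfile norm_pvProfile_le hη')
      ((hadm measurable_boxProfile norm_boxProfile_le hη').const_mul _)]
    refine integral_congr_ae (Eventually.of_forall fun ξ => ?_)
    simp only [dilation, hψ]
    ring
  refine ⟨L, L + Q, D, hL, (hL.add hQ).congr' ?_, hD.congr' ?_, by linear_combination -hQD⟩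
  · filter_upwards [self_mem_nhdsWithin] with η hη
    have hη' : 0 < η := hη
    unfold mulForm
    rw [← integral_add (integrable_mulForm (measurable_resolv η).aestronglyMeasurable
      (norm_resolv_le hη')) (hadm measurable_pvProfile norm_pvProfile_le hη')]
    refine integral_congr_ae (Eventually.of_forall fun ξ => ?_)
    simp only [pvSym_eq hη']
    ring
  · filter_upwards [self_mem_nhdsWithin] with η hη
    unfold mulForm
    simp only [deltaSym_eq hη]

/-! ### The duality between `B` and `B*` -/

theorem zpow_one_sub_eq (k : ℕ) : (2 : ℝ≥0∞) ^ (1 - (k : ℤ)) = 2 * (2 ^ k)⁻¹ := by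
  rw [sub_eq_add_neg, ENNReal.zpow_add (by norm_num) (by norm_num), zpow_one, ENNReal.zpow_neg,
    zpow_natCast]

theorem normBstar_eq (u : E3 → ℂ) :
    normBstar u = ⨆ k : ℕ, (2 * (2 ^ k)⁻¹ : ℝ≥0∞) ^ (1 / 2 : ℝ) *
      eLpNorm u 2 (volume.restrict (annulus k)) := by
  unfold normBstar
  refine iSup_congr fun k => ?_
  rw [eLpNorm_two_eq, ENNReal.mul_rpow_of_nonneg _ _ (by norm_num), zpow_one_sub_eq]

/-- On ring `k` the squared weights are `2 ^ k` in `B` and `2 ^ (1 - k)` in `B*`, with product `2`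
and not `1`. Hence the factors `√2`, absorbed by `1 ≤ √2` or `√2 ≤ 2` in the duality estimates. -/
theorem pow_rpow_mul_rpow (k : ℕ) :
    ((2 : ℝ≥0∞) ^ k) ^ (1 / 2 : ℝ) * (2 * (2 ^ k)⁻¹ : ℝ≥0∞) ^ (1 / 2 : ℝ) = 2 ^ (1 / 2 : ℝ) := by
  rw [← ENNReal.mul_rpow_of_nonneg _ _ (by norm_num), mul_comm, mul_assoc,
    ENNReal.inv_mul_cancel (by positivity) (by finiteness), mul_one]

theorem eLpNorm_annulus_le_normBstar (u : E3 → ℂ) (k : ℕ) :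
    eLpNorm u 2 (volume.restrict (annulus k)) ≤ (2 ^ k : ℝ≥0∞) ^ (1 / 2 : ℝ) * normBstar u := by
  have h1 : (1 : ℝ≥0∞) ≤ 2 ^ (1 / 2 : ℝ) := ENNReal.one_le_rpow (by norm_num) (by norm_num)
  rw [normBstar_eq]
  calc eLpNorm u 2 (volume.restrict (annulus k))
      ≤ 2 ^ (1 / 2 : ℝ) * eLpNorm u 2 (volume.restrict (annulus k)) := le_mul_of_one_le_left' h1
    _ = (2 ^ k : ℝ≥0∞) ^ (1 / 2 : ℝ) * ((2 * (2 ^ k)⁻¹ : ℝ≥0∞) ^ (1 / 2 : ℝ) *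
          eLpNorm u 2 (volume.restrict (annulus k))) := by rw [← mul_assoc, pow_rpow_mul_rpow]
    _ ≤ _ := by
        gcongr
        exact le_iSup (fun k : ℕ => (2 * (2 ^ k)⁻¹ : ℝ≥0∞) ^ (1 / 2 : ℝ) *
          eLpNorm u 2 (volume.restrict (annulus k))) k

theorem normBstar_le_of_forall {u : E3 → ℂ} {C : ℝ≥0∞}
    (h : ∀ k, eLpNorm u 2 (volume.restrict (annulus k)) ≤ (2 ^ k : ℝ≥0∞) ^ (1 / 2 : ℝ) * C) :
    normBstar u ≤ 2 * C := by
  rw [normBstar_eq]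
  refine iSup_le fun k => ?_
  have h1 : (2 : ℝ≥0∞) ^ (1 / 2 : ℝ) ≤ 2 := by
    simpa using ENNReal.rpow_le_rpow_of_exponent_le (x := 2) (by norm_num)
      (show (1 / 2 : ℝ) ≤ 1 by norm_num)
  calc (2 * (2 ^ k)⁻¹ : ℝ≥0∞) ^ (1 / 2 : ℝ) * eLpNorm u 2 (volume.restrict (annulus k))
      ≤ (2 * (2 ^ k)⁻¹ : ℝ≥0∞) ^ (1 / 2 : ℝ) * ((2 ^ k : ℝ≥0∞) ^ (1 / 2 : ℝ) * C) := by
        gcongr; exact h k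
    _ = 2 ^ (1 / 2 : ℝ) * C := by
        rw [← mul_assoc, mul_comm (_ ^ _) (_ ^ _), pow_rpow_mul_rpow]
    _ ≤ 2 * C := by gcongr

theorem memBstar_of_memLp {u : E3 → ℂ} (hu : MemLp u 2 (volume : Measure E3)) : MemBstar u := by
  refine ⟨hu.1, (normBstar_le_of_forall (C := eLpNorm u 2 volume) fun k => ?_).trans_lt
    (ENNReal.mul_lt_top (by norm_num) hu.2)⟩
  refine (eLpNorm_mono_measure u Measure.restrict_le_self).trans (le_mul_of_one_le_left' ?_)
  exact ENNReal.one_le_rpow (one_le_pow₀ (by norm_num)) (by norm_num)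

theorem lintegral_enorm_mul_le {a v : E3 → ℂ} (ha : AEStronglyMeasurable a volume)
    (hv : AEStronglyMeasurable v volume) :
    ∫⁻ x, ‖a x‖ₑ * ‖v x‖ₑ ≤ normBstar a * normB v := by
  rw [lintegral_eq_tsum_annulus, normB_eq, ← ENNReal.tsum_mul_left]
  refine ENNReal.tsum_le_tsum fun k => ?_
  calc ∫⁻ x in annulus k, ‖a x‖ₑ * ‖v x‖ₑ
      ≤ eLpNorm a 2 (volume.restrict (annulus k)) * eLpNorm v 2 (volume.restrict (annulus k)) := by
        rw [eLpNorm_two_eq, eLpNorm_two_eq]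
        simpa using ENNReal.lintegral_mul_le_Lp_mul_Lq (volume.restrict (annulus k))
          Real.HolderConjugate.two_two (ha.enorm.restrict (s := annulus k))
          (hv.enorm.restrict (s := annulus k))
    _ ≤ ((2 ^ k : ℝ≥0∞) ^ (1 / 2 : ℝ) * normBstar a) *
          eLpNorm v 2 (volume.restrict (annulus k)) := by
        gcongr; exact eLpNorm_annulus_le_normBstar a k
    _ = _ := by ring

theorem MemBstar.integrable_mul_conj {a v : E3 → ℂ} (ha : MemBstar a) (hv : MemB v) :
    Integrable (fun x => a x * (starRingEnd ℂ) (v x)) (volume : Measure E3) := by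
  refine ⟨ha.1.mul (Complex.continuous_conj.comp_aestronglyMeasurable hv.1), ?_⟩
  refine lt_of_le_of_lt ?_ (ENNReal.mul_lt_top ha.2 hv.2)
  refine le_trans (le_of_eq ?_) (lintegral_enorm_mul_le ha.1 hv.1)
  simp [enorm_mul]

theorem MemBstar.norm_integral_le {a v : E3 → ℂ} (ha : MemBstar a) (hv : MemB v) :
    ‖∫ x, a x * (starRingEnd ℂ) (v x)‖ ≤ (normBstar a).toReal * nB v := by
  rw [nB, ← ENNReal.toReal_mul]
  refine (norm_integral_le_lintegral_norm _).trans
    (ENNReal.toReal_mono (ENNReal.mul_lt_top ha.2 hv.2).ne ?_)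
  refine le_trans (le_of_eq ?_) (lintegral_enorm_mul_le ha.1 hv.1)
  simp [← ofReal_norm, ENNReal.ofReal_mul]

theorem memB_indicator_annulus {u : E3 → ℂ} (hu : AEStronglyMeasurable u volume) {k : ℕ}
    (h : eLpNorm u 2 (volume.restrict (annulus k)) < ∞) : MemB ((annulus k).indicator u) := by
  refine ⟨hu.indicator (measurableSet_annulus k), ?_⟩
  rw [normB_indicator_annulus]
  exact ENNReal.mul_lt_top (by finiteness) h

/-- The norm of `B*` is controlled by the pairing with `B`. -/
theorem normBstar_le_of_pairing {a : E3 → ℂ} {M : ℝ≥0} (ham : AEStronglyMeasurable a volume)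
    (ha : ∀ k, eLpNorm a 2 (volume.restrict (annulus k)) < ∞)
    (hM : ∀ k, ‖∫ x, a x * (starRingEnd ℂ) ((annulus k).indicator a x)‖
      ≤ M * nB ((annulus k).indicator a)) :
    normBstar a ≤ 2 * M := by
  refine normBstar_le_of_forall fun k => ?_
  set N := eLpNorm a 2 (volume.restrict (annulus k)) with hN
  -- Tested on its own restriction to a ring, `a` gives `N² ≤ M 2^(k/2) N`, from which one factor
  -- `N` is cancelled.
  have hsq : ∫ x, a x * (starRingEnd ℂ) ((annulus k).indicator a x) = ((N.toReal ^ 2 : ℝ) : ℂ) := by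
    have h1 : ∀ x, a x * (starRingEnd ℂ) ((annulus k).indicator a x)
        = (annulus k).indicator (fun x => ((‖a x‖ ^ 2 : ℝ) : ℂ)) x := by
      intro x
      by_cases hx : x ∈ annulus k
      · simp [hx, Complex.mul_conj']
      · simp [hx]
    simp_rw [h1]
    rw [integral_indicator (measurableSet_annulus k), integral_complex_ofReal]
    congr 1
    have hmem : MemLp a 2 (volume.restrict (annulus k)) := ⟨ham.restrict, ha k⟩
    rw [hN, hmem.eLpNorm_eq_integral_rpow_norm (by norm_num) (by norm_num),
      ENNReal.toReal_ofReal (by positivity)]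
    norm_num
    rw [← Real.sqrt_eq_rpow, Real.sq_sqrt (by positivity)]
  have h2 := hM k
  rw [hsq, Complex.norm_real, Real.norm_of_nonneg (by positivity), nB,
    normB_indicator_annulus, ENNReal.toReal_mul] at h2
  have hNfin : N ≠ ∞ := (ha k).ne
  have hfin : (2 ^ k : ℝ≥0∞) ^ (1 / 2 : ℝ) * (M : ℝ≥0∞) ≠ ∞ := by finiteness
  rw [← ENNReal.toReal_le_toReal hNfin hfin, ENNReal.toReal_mul, ENNReal.coe_toReal]
  rcases (ENNReal.toReal_nonneg (a := N)).eq_or_lt with h0 | h0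
  · rw [← h0]; positivity
  · rw [← hN] at h2
    have : N.toReal * N.toReal ≤ (((2 ^ k : ℝ≥0∞) ^ (1 / 2 : ℝ)).toReal * M) * N.toReal := by
      nlinarith
    exact le_of_mul_le_mul_right this h0

theorem eq_of_forall_integral_mul_conj_eq {a : E3 → ℂ} (ha : MemBstar a) {T : (E3 → ℂ) → ℂ} {C : ℝ}
    (hC : 0 ≤ C) (hT : ∀ f g, MemB f → MemB g → ‖T f - T g‖ ≤ C * nB (f - g))
    (h : ∀ v : 𝓢(E3, ℂ), ∫ x, a x * (starRingEnd ℂ) (v x) = T v) {v : E3 → ℂ} (hv : MemB v) :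
    ∫ x, a x * (starRingEnd ℂ) (v x) = T v := by
  refine eq_of_forall_dist_le fun ε hε => ?_
  set D := (normBstar a).toReal + C + 1 with hD
  have hD0 : 0 < D := by positivity
  obtain ⟨g, hg⟩ := exists_schwartz_nB_sub_lt hv (div_pos hε hD0)
  have hgB := memB_schwartz g
  have h1 := ha.norm_integral_le (hv.sub hgB)
  have h2 : ∫ x, a x * (starRingEnd ℂ) ((v - ⇑g) x)
      = (∫ x, a x * (starRingEnd ℂ) (v x)) - ∫ x, a x * (starRingEnd ℂ) (g x) := by
    rw [← integral_sub (ha.integrable_mul_conj hv) (ha.integrable_mul_conj hgB)]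
    simp [mul_sub]
  rw [h2, h g] at h1
  have h3 := hT v g hv hgB
  have h4 := dist_triangle_right (∫ x, a x * (starRingEnd ℂ) (v x)) (T v) (T g)
  rw [dist_eq_norm _ (T g), dist_eq_norm _ (T g)] at h4
  have h5 : D * nB (v - ⇑g) ≤ ε := by
    rw [lt_div_iff₀ hD0] at hg; linarith
  have := nB_nonneg (v - ⇑g)
  rw [hD] at h5
  linarith

/-! ### The Helmholtz equation in Fourier variables -/

/-- Pointwise conjugation of Schwartz functions. -/
def conjS (p : 𝓢(E3, ℂ)) : 𝓢(E3, ℂ) := SchwartzMap.postcompCLM (Complex.conjCLE : ℂ →L[ℝ] ℂ) p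

theorem conjS_apply (p : 𝓢(E3, ℂ)) (x : E3) : conjS p x = (starRingEnd ℂ) (p x) := rfl

theorem conjS_conjS (p : 𝓢(E3, ℂ)) : conjS (conjS p) = p := by ext; simp [conjS_apply]

theorem laplacian_conjS (p : 𝓢(E3, ℂ)) (x : E3) :
    Laplacian.laplacian (conjS p : E3 → ℂ) x =
      (starRingEnd ℂ) (Laplacian.laplacian (p : E3 → ℂ) x) :=
  congrFun (InnerProductSpace.laplacian_CLE_comp_left (f := (p : E3 → ℂ)) (l := Complex.conjCLE)) x

/-- The adjoint Helmholtz operator `Δ + 1 + iκ` on Schwartz functions. -/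
def helmAdj (κ : ℝ) (p : 𝓢(E3, ℂ)) : 𝓢(E3, ℂ) :=
  Laplacian.laplacian p + p + (Complex.I * κ) • p

theorem helmAdj_apply (κ : ℝ) (p : 𝓢(E3, ℂ)) (x : E3) :
    helmAdj κ p x = Laplacian.laplacian (p : E3 → ℂ) x + p x + Complex.I * κ * p x := by
  simp [helmAdj, SchwartzMap.laplacian_apply]

theorem conj_helmAdj (κ : ℝ) (p : 𝓢(E3, ℂ)) (x : E3) :
    (starRingEnd ℂ) (helmAdj κ p x) = -Complex.I * (κ : ℂ) * conjS p x +
      Laplacian.laplacian (conjS p : E3 → ℂ) x + ((1 : ℝ) : ℂ) * conjS p x := by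
  rw [helmAdj_apply, laplacian_conjS, conjS_apply]
  simp
  ring

/-- Conjugating the test functions turns the bilinear distributional pairing into the sesquilinear
one of the duality between `B` and `B*`; the sign of the absorption flips in the adjoint. -/
theorem isHelmholtzSolution_iff {κ : ℝ} {u f : E3 → ℂ} :
    IsHelmholtzSolution κ 1 u f ↔ ∀ p : 𝓢(E3, ℂ),
      ∫ x, u x * (starRingEnd ℂ) (helmAdj κ p x) = ∫ x, f x * (starRingEnd ℂ) (p x) := by
  constructor
  · intro h p
    have := h (conjS p)
    simp only [conj_helmAdj]
    exact this
  · intro h φ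
    have := h (conjS φ)
    simp only [conj_helmAdj, conjS_conjS] at this
    rw [this]
    simp [conjS_apply]

theorem fourier_laplacian (p : 𝓢(E3, ℂ)) (ξ : E3) :
    (𝓕 (Laplacian.laplacian p) : 𝓢(E3, ℂ)) ξ
      = -(4 * Real.pi ^ 2 * ‖ξ‖ ^ 2 : ℝ) * (𝓕 p : 𝓢(E3, ℂ)) ξ := by
  have hg : (fun ξ : E3 => ‖ξ‖ ^ 2).HasTemperateGrowth := by fun_prop
  rw [SchwartzMap.laplacian_eq_fourierMultiplierCLM, FourierTransform.fourier_smul,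
    SchwartzMap.fourierMultiplierCLM_apply, FourierTransform.fourier_fourierInv_eq,
    smul_apply, SchwartzMap.smulLeftCLM_apply_apply hg, Complex.real_smul,
    Complex.real_smul, ← mul_assoc]
  push_cast
  ring

theorem fourier_helmAdj (κ : ℝ) (p : 𝓢(E3, ℂ)) (ξ : E3) :
    (𝓕 (helmAdj κ p) : 𝓢(E3, ℂ)) ξ = (-(sym ξ : ℂ) + Complex.I * κ) * (𝓕 p : 𝓢(E3, ℂ)) ξ := by
  rw [helmAdj, FourierTransform.fourier_add, FourierTransform.fourier_add,
    FourierTransform.fourier_smul, add_apply, add_apply,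
    fourier_laplacian, smul_apply, sym, smul_eq_mul]
  push_cast
  ring

theorem hasTemperateGrowth_sym : sym.HasTemperateGrowth := by
  unfold sym; fun_prop

/-- The inverse is written through a power of `1 + ‖·‖²`, a function of temperate growth, times a
factor affine in `s`. -/
theorem inv_eq_smul_rpow (s : ℝ) {κ : ℝ} (hκ : 0 < κ) :
    (-(s : ℂ) + Complex.I * κ)⁻¹ =
      (((1 + ‖s / κ‖ ^ 2) ^ (-1 : ℝ) : ℝ) : ℂ) * ((((κ ^ 2)⁻¹ : ℝ) : ℂ) *
        (-(s : ℂ) - Complex.I * κ)) := by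
  have h1 : (0 : ℝ) < κ ^ 2 + s ^ 2 := by positivity
  have h2 : (-(s : ℂ) + Complex.I * κ) * (-(s : ℂ) - Complex.I * κ) = ((κ ^ 2 + s ^ 2 : ℝ) : ℂ) := by
    push_cast
    ring_nf
    rw [Complex.I_sq]
    ring
  have h3 : (1 + ‖s / κ‖ ^ 2) ^ (-1 : ℝ) * (κ ^ 2)⁻¹ = (κ ^ 2 + s ^ 2)⁻¹ := by
    rw [Real.rpow_neg_one, ← mul_inv, Real.norm_eq_abs, sq_abs]
    congr 1
    field_simp
  rw [← mul_assoc, ← Complex.ofReal_mul, h3]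
  refine inv_eq_of_mul_eq_one_right ?_
  rw [mul_left_comm, h2, ← Complex.ofReal_mul, inv_mul_cancel₀ h1.ne', Complex.ofReal_one]

theorem hasTemperateGrowth_inv_sym {κ : ℝ} (hκ : 0 < κ) :
    (fun ξ => (-(sym ξ : ℂ) + Complex.I * κ)⁻¹).HasTemperateGrowth := by
  have h1 : (fun ξ => sym ξ / κ).HasTemperateGrowth := by
    have := hasTemperateGrowth_sym
    simp only [div_eq_mul_inv]
    fun_prop
  have h2 : (fun ξ => (1 + ‖sym ξ / κ‖ ^ 2) ^ (-1 : ℝ)).HasTemperateGrowth :=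
    (Function.hasTemperateGrowth_one_add_norm_sq_rpow ℝ (-1)).comp h1
  have h3 := hasTemperateGrowth_sym
  have h4 : (fun ξ => (sym ξ : ℂ)).HasTemperateGrowth := Function.Complex.hasTemperateGrowth_ofReal.comp h3
  have h5 : (fun ξ => (((1 + ‖sym ξ / κ‖ ^ 2) ^ (-1 : ℝ) : ℝ) : ℂ)).HasTemperateGrowth :=
    Function.Complex.hasTemperateGrowth_ofReal.comp h2
  simp_rw [inv_eq_smul_rpow _ hκ]
  fun_prop

/-- For `κ > 0` the symbol never vanishes and its inverse has temperate growth, so division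
preserves Schwartz functions. Surjectivity of the adjoint gives uniqueness of solutions with
absorption. -/
theorem exists_helmAdj_eq {κ : ℝ} (hκ : 0 < κ) (v : 𝓢(E3, ℂ)) : ∃ p, helmAdj κ p = v := by
  set p : 𝓢(E3, ℂ) :=
    𝓕⁻ (SchwartzMap.smulLeftCLM ℂ (fun ξ => (-(sym ξ : ℂ) + Complex.I * κ)⁻¹) (𝓕 v)) with hp
  refine ⟨p, ?_⟩
  have h : (𝓕 (helmAdj κ p) : 𝓢(E3, ℂ)) = 𝓕 v := by
    ext ξ
    rw [fourier_helmAdj, hp, FourierTransform.fourier_fourierInv_eq,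
      SchwartzMap.smulLeftCLM_apply_apply (hasTemperateGrowth_inv_sym hκ), smul_eq_mul,
      mul_inv_cancel_left₀]
    have := add_I_mul_ne_zero (-sym ξ) hκ.ne'
    simpa using this
  have := congrArg (fun g => (𝓕⁻ g : 𝓢(E3, ℂ))) h
  simpa using this

/-- The conjugate of the symbol `-p + iκ` is `-(p + iκ)`, which cancels the resolvent up to sign;
Plancherel finishes. -/
theorem mulForm_resolv_helmAdj {κ : ℝ} (hκ : 0 < κ) {f : E3 → ℂ}
    (hf : MemLp f 2 (volume : Measure E3)) (p : 𝓢(E3, ℂ)) :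
    mulForm (resolv κ) f (helmAdj κ p) = -∫ x, f x * (starRingEnd ℂ) (p x) := by
  rw [← integral_planch_mul_conj hf (p.memLp 2), ← integral_neg]
  refine integral_congr_ae ?_
  filter_upwards [planch_schwartz p, planch_schwartz (helmAdj κ p)] with ξ h1 h2
  have h0 := add_I_mul_ne_zero (sym ξ) hκ.ne'
  rw [h1, h2, fourier_helmAdj, resolv]
  simp only [map_mul, map_add, map_neg, Complex.conj_ofReal, Complex.conj_I]
  field_simp
  ring

/-- Solutions of the Helmholtz equation with absorption are given by the resolvent. -/
theorem IsHelmholtzSolution.integral_mul_conj {κ : ℝ} (hκ : 0 < κ) {a f : E3 → ℂ}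
    (ha : MemBstar a) (hf : MemLp f 2 (volume : Measure E3)) (h : IsHelmholtzSolution κ 1 a f)
    {v : E3 → ℂ} (hv : MemB v) :
    ∫ x, a x * (starRingEnd ℂ) (v x) = -mulForm (resolv κ) f v := by
  have hm := (measurable_resolv κ).aestronglyMeasurable (μ := (volume : Measure E3))
  -- The constant degenerates as `κ → 0`, but it only provides continuity in `v` at fixed `κ`. The
  -- `L²` bound is used so that `f` need not lie in `B`.
  refine eq_of_forall_integral_mul_conj_eq ha (T := fun v => -mulForm (resolv κ) f v)
    (C := 1 / κ * (eLpNorm f 2 volume).toReal) (by positivity) (fun g w hg hw => ?_)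
    (fun v => ?_) hv
  · have h1 := mulForm_add_right (f := f) hm (norm_resolv_le hκ) (hg.sub hw).memLp hw.memLp
    rw [sub_add_cancel] at h1
    have h2 : -mulForm (resolv κ) f g - -mulForm (resolv κ) f w
        = -mulForm (resolv κ) f (g - w) := by rw [h1]; ring
    rw [h2, norm_neg, mul_assoc]
    refine (norm_mulForm_le_eLpNorm (norm_resolv_le hκ) hf (hg.sub hw).memLp).trans ?_
    gcongr
    exact (hg.sub hw).toReal_eLpNorm_le
  · obtain ⟨p, rfl⟩ := exists_helmAdj_eq hκ v
    rw [isHelmholtzSolution_iff.1 h p, mulForm_resolv_helmAdj hκ hf p, neg_neg]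

/-! ### Rescaling -/

theorem integral_comp_add_smul (g : E3 → ℂ) (q : E3) {ε : ℝ} (hε : 0 < ε) :
    ∫ y, g y = (ε : ℂ) ^ 3 * ∫ x, g (q + ε • x) := by
  have h := Measure.integral_comp_smul (volume : Measure E3) (fun y => g (q + y)) ε
  rw [h, integral_add_left_eq_self, finrank_euclideanSpace_fin, abs_of_pos (by positivity),
    Complex.real_smul]
  push_cast
  rw [mul_inv_cancel_left₀]
  exact pow_ne_zero 3 (Complex.ofReal_ne_zero.2 hε.ne')

theorem laplacian_comp_smul_sub {φ : E3 → ℂ} (hφ : ContDiff ℝ 2 φ) (c : ℝ) (q x : E3) :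
    Laplacian.laplacian (fun y => φ (c • (y - q))) x =
      (c : ℂ) ^ 2 * Laplacian.laplacian φ (c • (x - q)) := by
  have h1 : (fun y => φ (c • (y - q))) =
      fun y => (φ ∘ (c • ContinuousLinearMap.id ℝ E3 : E3 →L[ℝ] E3)) (y - q) := by
    ext y; simp
  rw [h1]
  simp only [InnerProductSpace.laplacian_eq_iteratedFDeriv_stdOrthonormalBasis,
    iteratedFDeriv_comp_sub]
  rw [ContinuousLinearMap.iteratedFDeriv_comp_right _ hφ _ (by norm_num)]
  simp only [Finset.mul_sum,
    ContinuousMultilinearMap.compContinuousLinearMap_apply]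
  refine Finset.sum_congr rfl fun i _ => ?_
  have := (iteratedFDeriv ℝ 2 φ (c • (x - q))).map_smul_univ (fun _ => c)
    ![stdOrthonormalBasis ℝ E3 i, stdOrthonormalBasis ℝ E3 i]
  simp only [Fin.prod_univ_two, ← sq] at this
  rw [← Complex.ofReal_pow, ← Complex.real_smul, ← this]
  rfl

/-- The Schwartz function `y ↦ φ(ε⁻¹ (y - q))`. -/
theorem exists_schwartz_comp_smul_sub (φ : 𝓢(E3, ℂ)) (q : E3) {c : ℝ} (hc : c ≠ 0) :
    ∃ ψ : 𝓢(E3, ℂ), ∀ y, ψ y = φ (c • (y - q)) :=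
  ⟨SchwartzMap.compSubConstCLM ℂ q (SchwartzMap.compCLMOfContinuousLinearEquiv ℂ
    (ContinuousLinearEquiv.smulLeft (Units.mk0 c hc) : E3 ≃L[ℝ] E3) φ), fun _ => rfl⟩

/-- The equation is tested on `φ(ε⁻¹(y - q))`. Of the Jacobian `ε³`, two powers cancel the `ε⁻²` of
the Laplacian and the third is the amplitude in `rescale`; the absorption `α / ε` becomes `α * ε`.
-/
theorem IsHelmholtzSolution.rescale {α ε : ℝ} (hε : 0 < ε) {u f : E3 → ℂ} (q : E3)
    (h : IsHelmholtzSolution (α / ε) (1 / ε ^ 2) u f) :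
    IsHelmholtzSolution (α * ε) 1 (rescale q ε u) (fun x => (ε : ℂ) ^ 3 * f (q + ε • x)) := by
  intro φ
  have hε' : (ε : ℂ) ≠ 0 := Complex.ofReal_ne_zero.2 hε.ne'
  obtain ⟨ψ, hψ⟩ := exists_schwartz_comp_smul_sub φ q (inv_ne_zero hε.ne')
  have h1 := h ψ
  have h2 : ∀ x, ε⁻¹ • (q + ε • x - q) = x := fun x => by
    rw [add_sub_cancel_left, inv_smul_smul₀ hε.ne']
  have h3 : (ψ : E3 → ℂ) = fun y => φ (ε⁻¹ • (y - q)) := funext hψ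
  rw [integral_comp_add_smul _ q hε, integral_comp_add_smul (fun x => f x * ψ x) q hε] at h1
  simp only [h3, laplacian_comp_smul_sub (φ.smooth 2), h2] at h1
  rw [← integral_const_mul, ← integral_const_mul] at h1
  simp only [TwoSources.rescale]
  refine Eq.trans (integral_congr_ae (Eventually.of_forall fun x => ?_)) (h1.trans
    (integral_congr_ae (Eventually.of_forall fun x => ?_)))
  · simp only
    push_cast
    field_simp
  · simp only
    ring

theorem memLp_rescale {u : E3 → ℂ} (hu : MemLp u 2 (volume : Measure E3)) (q : E3) {ε : ℝ}
    (hε : 0 < ε) : MemLp (rescale q ε u) 2 (volume : Measure E3) := by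
  have h1 : MemLp (fun x => u (q + x)) 2 (volume : Measure E3) :=
    hu.comp_measurePreserving (measurePreserving_add_left volume q)
  refine MemLp.const_mul ?_ _
  have h2 : MemLp (fun x => u (q + x)) 2 (Measure.map (ε • ·) (volume : Measure E3)) := by
    rw [Measure.map_addHaar_smul _ hε.ne']
    exact h1.smul_measure ENNReal.ofReal_ne_top
  exact h2.comp_of_map (by fun_prop)

theorem source_rescale_zero (S₀ S₁ : E3 → ℂ) (q₁ : E3) {ε : ℝ} (hε : 0 < ε) :
    (fun x => (ε : ℂ) ^ 3 * source S₀ S₁ q₁ ε (0 + ε • x)) =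
      S₀ + fun x => S₁ (x - ε⁻¹ • q₁) := by
  ext x
  have hε' : (ε : ℂ) ^ 3 ≠ 0 := pow_ne_zero 3 (Complex.ofReal_ne_zero.2 hε.ne')
  rw [source, zero_add, smul_sub, inv_smul_smul₀ hε.ne', mul_add, mul_inv_cancel_left₀ hε',
    mul_inv_cancel_left₀ hε']
  rfl

theorem source_rescale_shift (S₀ S₁ : E3 → ℂ) (q₁ : E3) {ε : ℝ} (hε : 0 < ε) :
    (fun x => (ε : ℂ) ^ 3 * source S₀ S₁ q₁ ε (q₁ + ε • x)) =
      S₁ + fun x => S₀ (x - -(ε⁻¹ • q₁)) := by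
  ext x
  have hε' : (ε : ℂ) ^ 3 ≠ 0 := pow_ne_zero 3 (Complex.ofReal_ne_zero.2 hε.ne')
  rw [source, add_sub_cancel_left, smul_add, inv_smul_smul₀ hε.ne', mul_add,
    mul_inv_cancel_left₀ hε', mul_inv_cancel_left₀ hε', Pi.add_apply, sub_neg_eq_add, add_comm,
    add_comm x]

/-- The pairing of a rescaled solution with a test function. -/
theorem integral_rescale_mul_conj {α ε : ℝ} (hε : 0 < ε) (hα : 0 < α) {u f F G : E3 → ℂ} {q h : E3}
    (hu : MemLp u 2 (volume : Measure E3)) (hF : MemB F) (hG : MemB G)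
    (hf : (fun x => (ε : ℂ) ^ 3 * f (q + ε • x)) = F + fun x => G (x - h))
    (hsol : IsHelmholtzSolution (α / ε) (1 / ε ^ 2) u f) {v : E3 → ℂ} (hv : MemB v) :
    ∫ x, rescale q ε u x * (starRingEnd ℂ) (v x) = -(mulForm (resolv (α * ε)) F v +
      mulForm (fun ξ => phase h ξ * resolv (α * ε) ξ) G v) := by
  have hκ : 0 < α * ε := by positivity
  have h1 := hsol.rescale hε q
  rw [hf] at h1
  have h2 : MemLp (fun x => G (x - h)) 2 (volume : Measure E3) := memLp_comp_sub hG.memLp h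
  rw [h1.integral_mul_conj hκ (memBstar_of_memLp (memLp_rescale hu q hε)) (hF.memLp.add h2) hv,
    mulForm_add_left (measurable_resolv _).aestronglyMeasurable (norm_resolv_le hκ) hF.memLp h2,
    mulForm_comp_sub _ hG]

/-- By duality it suffices to pair the rescaled solution with its own restrictions to rings, which
lie in `B`; the two form bounds then do not see `α`, `ε` or `h`. -/
theorem normBstar_rescale_le {α ε : ℝ} (hε : 0 < ε) (hα : 0 < α) {u f F G : E3 → ℂ} {q h : E3}
    (hu : MemLp u 2 (volume : Measure E3)) (hF : MemB F) (hG : MemB G)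
    (hf : (fun x => (ε : ℂ) ^ 3 * f (q + ε • x)) = F + fun x => G (x - h))
    (hsol : IsHelmholtzSolution (α / ε) (1 / ε ^ 2) u f) :
    normBstar (rescale q ε u) ≤ 2 * (16 * (nB F + nB G)).toNNReal := by
  have hκ : 0 < α * ε := by positivity
  have hmem := memLp_rescale hu q hε
  have hfin : ∀ k, eLpNorm (rescale q ε u) 2 (volume.restrict (annulus k)) < ∞ := fun k =>
    (hmem.restrict _).2
  refine normBstar_le_of_pairing hmem.1 hfin fun k => ?_
  have hv := memB_indicator_annulus hmem.1 (hfin k)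
  set v := (annulus k).indicator (rescale q ε u)
  have h0 := nB_nonneg F
  have h0' := nB_nonneg G
  rw [integral_rescale_mul_conj hε hα hu hF hG hf hsol hv, norm_neg,
    Real.coe_toNNReal _ (by positivity)]
  refine (norm_add_le _ _).trans ?_
  have h1 := formBound_resolv hκ F v hF hv
  have h2 := formBound_phase_mul_resolv hκ h G v hG hv
  linarith

/-! ### `B*` is the dual of `B` -/

/-- Bounded antilinear functionals on `B`. -/
structure IsBoundedAntilinear (T : (E3 → ℂ) → ℂ) (C : ℝ≥0) : Prop where
  add : ∀ f g, MemB f → MemB g → T (f + g) = T f + T g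
  smul : ∀ (c : ℂ) (f), MemB f → T (c • f) = (starRingEnd ℂ) c * T f
  bound : ∀ f, MemB f → ‖T f‖ ≤ C * nB f

theorem IsBoundedAntilinear.sub {T : (E3 → ℂ) → ℂ} {C : ℝ≥0} (hT : IsBoundedAntilinear T C)
    {f g : E3 → ℂ} (hf : MemB f) (hg : MemB g) : T (f - g) = T f - T g := by
  have h := hT.add _ _ (hf.sub hg) hg
  rw [sub_add_cancel] at h
  rw [h, add_sub_cancel_right]

theorem IsBoundedAntilinear.congr {T : (E3 → ℂ) → ℂ} {C : ℝ≥0} (hT : IsBoundedAntilinear T C)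
    {f g : E3 → ℂ} (hf : MemB f) (hg : MemB g) (h : f =ᵐ[volume] g) : T f = T g := by
  have h1 := hT.bound _ (hf.sub hg)
  have h2 : normB (f - g) = 0 := by
    rw [normB_congr (g := (0 : ℂ) • f)]
    · rw [normB_const_smul]; simp
    · filter_upwards [h] with x hx
      simp [hx]
  rw [nB, h2, ENNReal.toReal_zero, mul_zero, hT.sub hf hg] at h1
  exact sub_eq_zero.1 (norm_le_zero_iff.1 h1)

theorem IsBoundedAntilinear.of_memBstar {w : E3 → ℂ} (hw : MemBstar w) :
    IsBoundedAntilinear (fun v => ∫ x, w x * (starRingEnd ℂ) (v x)) (normBstar w).toNNReal where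
  add f g hf hg := by
    rw [← integral_add (hw.integrable_mul_conj hf) (hw.integrable_mul_conj hg)]
    simp [mul_add]
  smul c f _ := by
    rw [← integral_const_mul]
    congr 1
    ext x
    simp
    ring
  bound f hf := hw.norm_integral_le hf

theorem memB_indicator_of_memLp {f : E3 → ℂ} (hf : MemLp f 2 (volume : Measure E3)) (k : ℕ) :
    MemB ((annulus k).indicator f) :=
  memB_indicator_annulus hf.1 (hf.restrict _).2

theorem nB_indicator_le {f : E3 → ℂ} (hf : MemLp f 2 (volume : Measure E3)) (k : ℕ) :
    nB ((annulus k).indicator f) ≤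
      ((2 ^ k : ℝ≥0∞) ^ (1 / 2 : ℝ)).toReal * (eLpNorm f 2 volume).toReal := by
  rw [nB, normB_indicator_annulus, ENNReal.toReal_mul]
  gcongr
  · exact hf.2.ne
  · exact Measure.restrict_le_self

/-- The representation of a functional on one ring. -/
theorem IsBoundedAntilinear.exists_annulus {T : (E3 → ℂ) → ℂ} {C : ℝ≥0}
    (hT : IsBoundedAntilinear T C) (k : ℕ) :
    ∃ w : E3 → ℂ, MemLp w 2 (volume : Measure E3) ∧
      ∀ g : E3 → ℂ, MemLp g 2 (volume : Measure E3) →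
        ∫ x, w x * (starRingEnd ℂ) (g x) = T ((annulus k).indicator g) := by
  have hmem : ∀ g : Lp ℂ 2 (volume : Measure E3), MemB ((annulus k).indicator g) := fun g =>
    memB_indicator_of_memLp (Lp.memLp g) k
  let L₀ : Lp ℂ 2 (volume : Measure E3) →ₗ[ℂ] ℂ :=
    -- The conjugate makes the antilinear `T` linear, as the Riesz representation in `L²` requires.
    { toFun := fun g => (starRingEnd ℂ) (T ((annulus k).indicator g))
      map_add' := fun f g => by
        rw [← map_add, ← hT.add _ _ (hmem f) (hmem g)]
        refine congrArg _ (hT.congr (hmem _) ((hmem f).add (hmem g)) ?_)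
        filter_upwards [Lp.coeFn_add f g] with x hx
        by_cases h : x ∈ annulus k
        · simpa [h] using hx
        · simp [h]
      map_smul' := fun c f => by
        have h1 : T ((annulus k).indicator ⇑(c • f)) = T (c • (annulus k).indicator f) := by
          refine hT.congr (hmem _) ((hmem f).const_smul c) ?_
          filter_upwards [Lp.coeFn_smul c f] with x hx
          by_cases h : x ∈ annulus k <;> simp [h, hx]
        rw [h1, hT.smul c _ (hmem f), map_mul, Complex.conj_conj]
        rfl }
  let L : Lp ℂ 2 (volume : Measure E3) →L[ℂ] ℂ :=
    L₀.mkContinuous (C * ((2 ^ k : ℝ≥0∞) ^ (1 / 2 : ℝ)).toReal) fun g => by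
      refine (le_of_eq (RCLike.norm_conj _)).trans ((hT.bound _ (hmem g)).trans ?_)
      rw [mul_assoc, Lp.norm_def]
      gcongr
      exact nB_indicator_le (Lp.memLp g) k
  refine ⟨(InnerProductSpace.toDual ℂ (Lp ℂ 2 (volume : Measure E3))).symm L, Lp.memLp _,
    fun g hg => ?_⟩
  have h1 := InnerProductSpace.toDual_symm_apply (𝕜 := ℂ) (x := hg.toLp g) (y := L)
  have h2 : L (hg.toLp g) = (starRingEnd ℂ) (T ((annulus k).indicator g)) := by
    refine congrArg (starRingEnd ℂ) (hT.congr (hmem _) (memB_indicator_of_memLp hg k) ?_)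
    filter_upwards [hg.coeFn_toLp] with x hx
    by_cases h : x ∈ annulus k <;> simp [h, hx]
  rw [h2, L2.inner_def] at h1
  have h3 := congrArg (starRingEnd ℂ) h1
  rw [Complex.conj_conj, ← integral_conj] at h3
  rw [← h3]
  refine integral_congr_ae ?_
  filter_upwards [hg.coeFn_toLp] with x hx
  rw [RCLike.inner_apply, map_mul, Complex.conj_conj, hx, mul_comm]

theorem indicator_ball_eq_sum (v : E3 → ℂ) (K : ℕ) :
    (Metric.ball (0 : E3) (2 ^ K)).indicator v =
      ∑ k ∈ Finset.range (K + 1), (annulus k).indicator v := by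
  ext x
  obtain ⟨j, hj⟩ := Set.mem_iUnion.1 (iUnion_annulus.symm ▸ Set.mem_univ x : x ∈ ⋃ k, annulus k)
  rw [Finset.sum_apply]
  have h0 : ∀ k, k ≠ j → (annulus k).indicator v x = 0 := fun k hk =>
    Set.indicator_of_notMem (fun h => Set.disjoint_left.1 (pairwise_disjoint_annulus hk) h hj) _
  by_cases hjK : j ≤ K
  · rw [Finset.sum_eq_single j (fun k _ hk => h0 k hk)
      (fun h => absurd (by simpa using hjK) (by simpa using h)), Set.indicator_of_mem hj,
      Set.indicator_of_mem]
    rw [mem_ball_zero_iff]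
    exact (norm_lt_of_mem_annulus hj).trans_le (pow_le_pow_right₀ one_le_two hjK)
  · have hlt : K < j := not_le.1 hjK
    rw [Finset.sum_eq_zero, Set.indicator_of_notMem]
    · rw [mem_ball_zero_iff, not_lt]
      exact le_norm_of_mem_annulus hlt hj
    · intro k hk
      refine h0 k ?_
      have : k < K + 1 := by simpa using hk
      omega

theorem IsBoundedAntilinear.sum {T : (E3 → ℂ) → ℂ} {C : ℝ≥0} (hT : IsBoundedAntilinear T C)
    {v : E3 → ℂ} (hv : MemB v) (n : ℕ) :
    MemB (∑ k ∈ Finset.range n, (annulus k).indicator v) ∧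
    T (∑ k ∈ Finset.range n, (annulus k).indicator v) =
      ∑ k ∈ Finset.range n, T ((annulus k).indicator v) := by
  induction n with
  | zero =>
    have h := hT.smul 0 v hv
    have h' := hv.const_smul 0
    rw [zero_smul] at h h'
    rw [map_zero, zero_mul] at h
    simpa using ⟨h', h⟩
  | succ n ih =>
    have h := hv.indicator (measurableSet_annulus n)
    rw [Finset.sum_range_succ, Finset.sum_range_succ, hT.add _ _ ih.1 h, ih.2]
    exact ⟨ih.1.add h, rfl⟩

/-- Two functionals which agree on functions supported in a ring are equal. -/
theorem IsBoundedAntilinear.eq_of_annulus {T U : (E3 → ℂ) → ℂ} {C D : ℝ≥0}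
    (hT : IsBoundedAntilinear T C) (hU : IsBoundedAntilinear U D) {v : E3 → ℂ} (hv : MemB v)
    (h : ∀ k, T ((annulus k).indicator v) = U ((annulus k).indicator v)) : T v = U v := by
  have hlim : Tendsto
      (fun K : ℕ => ((C + D : ℝ≥0) : ℝ) * nB (v - (Metric.ball (0 : E3) (2 ^ K)).indicator v)) atTop
      (𝓝 (((C + D : ℝ≥0) : ℝ) * 0)) :=
    ((ENNReal.tendsto_toReal ENNReal.zero_ne_top).comp (tendsto_normB_sub_truncation hv)).const_mul _
  rw [mul_zero] at hlim
  refine sub_eq_zero.1 (norm_le_zero_iff.1 (ge_of_tendsto' hlim fun K => ?_))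
  rw [indicator_ball_eq_sum]
  obtain ⟨h1, h2⟩ := hT.sum hv (K + 1)
  obtain ⟨-, h3⟩ := hU.sum hv (K + 1)
  set t := ∑ k ∈ Finset.range (K + 1), (annulus k).indicator v
  have h4 : T t = U t := by rw [h2, h3]; exact Finset.sum_congr rfl fun k _ => h k
  have h5 : T v - U v = T (v - t) - U (v - t) := by
    rw [hT.sub hv h1, hU.sub hv h1, h4]; ring
  rw [h5]
  refine (norm_sub_le _ _).trans ?_
  have := hT.bound _ (hv.sub h1)
  have := hU.bound _ (hv.sub h1)
  push_cast
  linarith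

/-- The Riesz representatives on the disjoint rings are glued together. Testing `T` on the
restrictions of the result to rings bounds its `B*` norm, and truncation extends the representation
from single rings to `B`. -/
theorem IsBoundedAntilinear.exists_memBstar {T : (E3 → ℂ) → ℂ} {C : ℝ≥0}
    (hT : IsBoundedAntilinear T C) :
    ∃ w : E3 → ℂ, MemBstar w ∧
      ∀ v : E3 → ℂ, MemB v → ∫ x, w x * (starRingEnd ℂ) (v x) = T v := by
  choose W hW hWT using fun k => hT.exists_annulus k
  set w : E3 → ℂ := fun x => ∑' k, (annulus k).indicator (W k) x with hw
  have hwk : ∀ k, ∀ x ∈ annulus k, w x = W k x := fun k x hx => by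
    simp only [hw]
    rw [tsum_eq_single k, Set.indicator_of_mem hx]
    intro j hj
    exact Set.indicator_of_notMem
      (fun h => Set.disjoint_left.1 (pairwise_disjoint_annulus hj) h hx) _
  have hae : ∀ k, w =ᵐ[volume.restrict (annulus k)] W k := fun k => by
    filter_upwards [ae_restrict_mem (measurableSet_annulus k)] with x hx using hwk k x hx
  have hmeas : AEStronglyMeasurable w volume := by
    rw [← Measure.restrict_univ (μ := (volume : Measure E3)), ← iUnion_annulus,
      aestronglyMeasurable_iUnion_iff]
    exact fun k => (hW k).1.restrict.congr (hae k).symm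
  have hfin : ∀ k, eLpNorm w 2 (volume.restrict (annulus k)) < ∞ := fun k => by
    rw [eLpNorm_congr_ae (hae k)]; exact ((hW k).restrict _).2
  have hpair : ∀ k (v : E3 → ℂ), MemLp ((annulus k).indicator v) 2 (volume : Measure E3) →
      ∫ x, w x * (starRingEnd ℂ) ((annulus k).indicator v x) = T ((annulus k).indicator v) := by
    intro k v hv
    have h1 := hWT k _ hv
    rw [Set.indicator_indicator, Set.inter_self] at h1
    rw [← h1]
    congr 1
    ext x
    by_cases hx : x ∈ annulus k
    · rw [hwk k x hx]
    · simp [hx]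
  have hle : normBstar w ≤ 2 * C := by
    refine normBstar_le_of_pairing hmeas hfin fun k => ?_
    have hk := memB_indicator_annulus hmeas (hfin k)
    rw [hpair k w hk.memLp]
    exact hT.bound _ hk
  have hwB : MemBstar w := ⟨hmeas, hle.trans_lt (by finiteness)⟩
  refine ⟨w, hwB, fun v hv => ?_⟩
  exact (IsBoundedAntilinear.of_memBstar hwB).eq_of_annulus hT hv fun k =>
    hpair k v (hv.indicator (measurableSet_annulus k)).memLp

/-! ### The outgoing solution -/

/-- The limit of the forms inherits antilinearity and the bound `16 * nB S`, so duality represents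
it by a function in `B*`. -/
theorem exists_limit_resolv {S : E3 → ℂ} (hS : MemB S) :
    ∃ w : E3 → ℂ, MemBstar w ∧ ∀ v : E3 → ℂ, MemB v →
      Tendsto (fun κ : ℝ => -mulForm (resolv κ) S v) (𝓝[>] 0)
        (𝓝 (∫ x, w x * (starRingEnd ℂ) (v x))) := by
  classical
  choose! L hL using fun v (hv : MemB v) => exists_tendsto_mulForm_resolv hS hv
  have hT : IsBoundedAntilinear (fun v => -L v) (16 * nB S).toNNReal := by
    have hev : ∀ᶠ κ : ℝ in 𝓝[>] 0, 0 < κ := self_mem_nhdsWithin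
    refine ⟨fun f g hf hg => ?_, fun c f hf => ?_, fun f hf => ?_⟩
    · rw [← neg_add, neg_inj]
      refine tendsto_nhds_unique (hL _ (hf.add hg)) (((hL f hf).add (hL g hg)).congr' ?_)
      filter_upwards [hev] with κ hκ
      exact (mulForm_add_right (measurable_resolv κ).aestronglyMeasurable (norm_resolv_le hκ)
        hf.memLp hg.memLp).symm
    · rw [mul_neg, neg_inj]
      refine tendsto_nhds_unique (hL _ (hf.const_smul c)) (((hL f hf).const_mul _).congr ?_)
      exact fun κ => (mulForm_smul_right _ _ c hf.memLp).symm
    · rw [norm_neg, Real.coe_toNNReal _ (mul_nonneg (by norm_num) (nB_nonneg S))]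
      refine le_of_tendsto (hL f hf).norm ?_
      filter_upwards [hev] with κ hκ using formBound_resolv hκ S f hS hf
  obtain ⟨w, hw, h⟩ := hT.exists_memBstar
  refine ⟨w, hw, fun v hv => ?_⟩
  rw [h v hv]
  exact (hL v hv).neg

/-- The adjoint operators at absorption `κ` and `0` differ by `iκ`. At absorption `κ` the equation
is exact, and the difference vanishes because the forms tested on `p` converge, hence stay bounded.
-/
theorem isHelmholtzSolution_of_limit {S w : E3 → ℂ} (hS : MemB S)
    (hw : ∀ v : E3 → ℂ, MemB v → Tendsto (fun κ : ℝ => -mulForm (resolv κ) S v) (𝓝[>] 0)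
        (𝓝 (∫ x, w x * (starRingEnd ℂ) (v x)))) :
    IsHelmholtzSolution 0 1 w S := by
  rw [isHelmholtzSolution_iff]
  intro p
  refine tendsto_nhds_unique (hw _ (memB_schwartz (helmAdj 0 p))) ?_
  have hκ : Tendsto (fun κ : ℝ => Complex.I * (κ : ℂ)) (𝓝[>] 0) (𝓝 0) := by
    have : Tendsto (fun κ : ℝ => Complex.I * (κ : ℂ)) (𝓝 0) (𝓝 (Complex.I * ((0 : ℝ) : ℂ))) :=
      Continuous.tendsto (by fun_prop) 0
    simpa using this.mono_left nhdsWithin_le_nhds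
  have h1 := (hκ.mul (hw _ (memB_schwartz p))).const_add (∫ x, S x * (starRingEnd ℂ) (p x))
  rw [zero_mul, add_zero] at h1
  refine h1.congr' ?_
  filter_upwards [self_mem_nhdsWithin] with κ hκ0
  have hκ0 : 0 < κ := hκ0
  have h2 : (helmAdj κ p : E3 → ℂ) = ⇑(helmAdj 0 p) + (Complex.I * κ) • ⇑p := by
    ext x
    simp [helmAdj_apply]
  have h3 := mulForm_resolv_helmAdj hκ0 hS.memLp p
  rw [h2, mulForm_add_right (measurable_resolv κ).aestronglyMeasurable (norm_resolv_le hκ0)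
    ((helmAdj 0 p).memLp 2) ((p.memLp 2).const_smul _), mulForm_smul_right _ _ _ (p.memLp 2)] at h3
  simp only [map_mul, Complex.conj_I, Complex.conj_ofReal] at h3
  linear_combination h3

/-! ### The Fourier transform of the outgoing solution -/

theorem two_pi_pos : 0 < 2 * Real.pi := by positivity

theorem integral_comp_two_pi_smul (g : E3 → ℂ) :
    ((2 * Real.pi : ℂ) ^ 3)⁻¹ * ∫ ξ, g ξ = ∫ ζ, g ((2 * Real.pi) • ζ) := by
  have h := integral_comp_add_smul g 0 two_pi_pos
  simp only [zero_add] at h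
  rw [h]
  push_cast
  rw [inv_mul_cancel_left₀]
  exact pow_ne_zero 3 (by simp)

theorem fourierInt_eq (φ : E3 → ℂ) (x : E3) :
    fourierInt φ x = 𝓕 (fun ζ => φ ((2 * Real.pi) • ζ)) x := by
  rw [fourierInt, integral_comp_two_pi_smul, Real.fourier_eq']
  congr 1
  ext ζ
  rw [smul_eq_mul, real_inner_smul_left]
  congr 2
  push_cast
  ring

/-- The test function whose Plancherel transform is `conj φ(2π·)`. -/
theorem exists_schwartz_conj_eq_fourierInt (φ : 𝓢(E3, ℂ)) :
    ∃ v : 𝓢(E3, ℂ), (∀ x, (starRingEnd ℂ) (v x) = fourierInt φ x) ∧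
      ∀ ζ, (starRingEnd ℂ) ((𝓕 v : 𝓢(E3, ℂ)) ζ) = φ ((2 * Real.pi) • ζ) := by
  obtain ⟨ψ, hψ⟩ := exists_schwartz_comp_smul_sub φ 0 two_pi_pos.ne'
  simp only [sub_zero] at hψ
  refine ⟨𝓕⁻ (conjS ψ), fun x => ?_, fun ζ => ?_⟩
  · rw [fourierInt_eq, SchwartzMap.fourierInv_coe, Real.fourierInv_eq', Real.fourier_eq',
      ← integral_conj]
    congr 1
    ext ζ
    rw [smul_eq_mul, smul_eq_mul, map_mul, conjS_apply, Complex.conj_conj, hψ, ← Complex.exp_conj]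
    simp [Complex.conj_ofNat]
  · rw [FourierTransform.fourier_fourierInv_eq, conjS_apply, Complex.conj_conj, hψ]

/-- The change of variables `ξ = 2πζ` links the two Fourier normalisations; its Jacobian cancels the
factor `(2π)⁻³`, and `|ξ|² - 1` becomes `sym ζ`. -/
theorem integral_fourierL2_mul (m : E3 → ℂ) {S : E3 → ℂ} (hS : MemLp S 2 (volume : Measure E3))
    {φ v : 𝓢(E3, ℂ)}
    (hv : ∀ ζ, (starRingEnd ℂ) ((𝓕 v : 𝓢(E3, ℂ)) ζ) = φ ((2 * Real.pi) • ζ)) :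
    ∫ ξ, m ξ * (fourierL2 S ξ * φ ξ) = mulForm (fun ζ => m ((2 * Real.pi) • ζ)) S v := by
  have h1 : ∀ ξ, m ξ * (fourierL2 S ξ * φ ξ) = ((2 * Real.pi : ℂ) ^ 3)⁻¹ *
      (m ξ * (planch S ((2 * Real.pi)⁻¹ • ξ) * φ ξ)) := fun ξ => by
    rw [fourierL2_eq hS]; ring
  simp_rw [h1]
  rw [integral_const_mul, integral_comp_two_pi_smul]
  refine integral_congr_ae ?_
  filter_upwards [planch_schwartz v] with ζ h
  rw [h, hv, inv_smul_smul₀ two_pi_pos.ne']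

theorem norm_sq_two_pi_smul (ζ : E3) : ‖(2 * Real.pi) • ζ‖ ^ 2 - 1 = sym ζ := by
  rw [norm_smul, Real.norm_of_nonneg two_pi_pos.le, sym]
  ring

theorem norm_sq_two_pi_smul' (ζ : E3) : ((‖(2 * Real.pi) • ζ‖ : ℝ) : ℂ) ^ 2 - 1 = (sym ζ : ℂ) := by
  rw [← norm_sq_two_pi_smul]
  push_cast
  rfl

theorem integral_div_add_I_mul {S : E3 → ℂ} (hS : MemLp S 2 (volume : Measure E3))
    {φ v : 𝓢(E3, ℂ)}
    (hv : ∀ ζ, (starRingEnd ℂ) ((𝓕 v : 𝓢(E3, ℂ)) ζ) = φ ((2 * Real.pi) • ζ)) (δ : ℝ) :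
    ∫ ξ : E3, -(fourierL2 S ξ) / ((‖ξ‖ : ℂ) ^ 2 - 1 + Complex.I * (δ : ℂ)) * φ ξ =
      -mulForm (resolv δ) S v := by
  have h := integral_fourierL2_mul
    (fun ξ => 1 / ((‖ξ‖ : ℂ) ^ 2 - 1 + Complex.I * (δ : ℂ))) hS hv
  simp only [norm_sq_two_pi_smul'] at h
  unfold resolv
  rw [← h, ← integral_neg]
  congr 1
  ext ξ
  ring

theorem measurable_norm_sq_sub_one : Measurable fun ξ : E3 => |‖ξ‖ ^ 2 - 1| := by fun_prop

theorem setIntegral_div {S : E3 → ℂ} (hS : MemLp S 2 (volume : Measure E3)) {φ v : 𝓢(E3, ℂ)}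
    (hv : ∀ ζ, (starRingEnd ℂ) ((𝓕 v : 𝓢(E3, ℂ)) ζ) = φ ((2 * Real.pi) • ζ)) (η : ℝ) :
    ∫ ξ in {ξ : E3 | η < |‖ξ‖ ^ 2 - 1|}, fourierL2 S ξ / ((‖ξ‖ : ℂ) ^ 2 - 1) * φ ξ =
      mulForm (pvSym η) S v := by
  have h := integral_fourierL2_mul
    (fun ξ => if η < |‖ξ‖ ^ 2 - 1| then 1 / ((‖ξ‖ : ℂ) ^ 2 - 1) else 0) hS hv
  simp only [norm_sq_two_pi_smul', norm_sq_two_pi_smul] at h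
  rw [← integral_indicator (measurableSet_lt measurable_const measurable_norm_sq_sub_one)]
  unfold pvSym
  rw [← h]
  congr 1
  ext ξ
  simp only [Set.indicator, Set.mem_ofPred_eq]
  split_ifs <;> ring

theorem inv_mul_setIntegral {S : E3 → ℂ} (hS : MemLp S 2 (volume : Measure E3)) {φ v : 𝓢(E3, ℂ)}
    (hv : ∀ ζ, (starRingEnd ℂ) ((𝓕 v : 𝓢(E3, ℂ)) ζ) = φ ((2 * Real.pi) • ζ)) (η : ℝ) :
    ((2 * η : ℝ) : ℂ)⁻¹ * ∫ ξ in {ξ : E3 | |‖ξ‖ ^ 2 - 1| < η}, fourierL2 S ξ * φ ξ =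
      mulForm (deltaSym η) S v := by
  have h := integral_fourierL2_mul
    (fun ξ => if |‖ξ‖ ^ 2 - 1| < η then ((2 * η : ℝ) : ℂ)⁻¹ else 0) hS hv
  simp only [norm_sq_two_pi_smul] at h
  rw [← integral_indicator (measurableSet_lt measurable_norm_sq_sub_one measurable_const),
    ← integral_const_mul]
  unfold deltaSym
  rw [← h]
  congr 1
  ext ξ
  simp only [Set.indicator, Set.mem_ofPred_eq]
  split_ifs <;> ring

/-- The limiting absorption principle: the outgoing solution exists, and it is the weak-* limit of
the solutions with absorption. -/
theorem exists_isOutgoingSolution {S : E3 → ℂ} (hS : MemB S) :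
    ∃ w : E3 → ℂ, IsOutgoingSolution w S ∧ ∀ v : E3 → ℂ, MemB v →
      Tendsto (fun κ : ℝ => -mulForm (resolv κ) S v) (𝓝[>] 0)
        (𝓝 (∫ x, w x * (starRingEnd ℂ) (v x))) := by
  obtain ⟨w, hwB, hw⟩ := exists_limit_resolv hS
  refine ⟨w, ⟨hwB, isHelmholtzSolution_of_limit hS hw, fun φ => ?_, fun φ => ?_⟩, hw⟩
  · obtain ⟨v, hv1, hv2⟩ := exists_schwartz_conj_eq_fourierInt φ
    simp only [integral_div_add_I_mul hS.memLp hv2, fourierPairing, ← hv1]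
    exact hw v (memB_schwartz v)
  · obtain ⟨v, hv1, hv2⟩ := exists_schwartz_conj_eq_fourierInt φ
    obtain ⟨L, P, D, hL, hP, hD, h⟩ := exists_tendsto_resolv_pv_delta hS (memB_schwartz v)
    refine ⟨P, D, ?_, ?_, ?_⟩
    · simpa only [IsPrincipalValue, setIntegral_div hS.memLp hv2] using hP
    · simpa only [IsSphereDelta, inv_mul_setIntegral hS.memLp hv2] using hD
    · simp only [fourierPairing, ← hv1]
      rw [← h]
      exact tendsto_nhds_unique (hw v (memB_schwartz v)) hL.neg

/-! ### Convergence -/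

theorem tendsto_inv_smul_cocompact {q : E3} (hq : q ≠ 0) :
    Tendsto (fun ε : ℝ => ε⁻¹ • q) (𝓝[>] 0) (cocompact E3) := by
  rw [← Metric.cobounded_eq_cocompact, ← tendsto_norm_atTop_iff_cobounded]
  have h := tendsto_inv_nhdsGT_zero (𝕜 := ℝ)
  refine (h.atTop_mul_const (norm_pos_iff.2 hq)).congr' ?_
  filter_upwards [self_mem_nhdsWithin] with ε hε
  have hε : 0 < ε := hε
  rw [norm_smul, Real.norm_of_nonneg (by positivity)]

theorem tendsto_mul_self {α : ℝ → ℝ} (hα_pos : ∀ ε : ℝ, 0 < ε → 0 < α ε)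
    (hα_lim : Tendsto α (𝓝[>] 0) (𝓝 0)) :
    Tendsto (fun ε => α ε * ε) (𝓝[>] 0) (𝓝[>] 0) := by
  refine tendsto_nhdsWithin_iff.2 ⟨?_, ?_⟩
  · have h : Tendsto id (𝓝[>] (0 : ℝ)) (𝓝 0) := tendsto_nhdsWithin_of_tendsto_nhds tendsto_id
    simpa using hα_lim.mul h
  · filter_upwards [self_mem_nhdsWithin] with ε hε
    exact mul_pos (hα_pos ε hε) hε

/-- Stated for a fixed source `F` and an escaping one `G`, so that it serves at both points with the
roles of `S₀` and `S₁` exchanged. Only the absorption changes in the `F` term, while the `G` term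
vanishes. -/
theorem tendstoWeakStar_rescale {α : ℝ → ℝ} (hα_pos : ∀ ε : ℝ, 0 < ε → 0 < α ε)
    (hα_lim : Tendsto α (𝓝[>] 0) (𝓝 0)) {u f : ℝ → E3 → ℂ} {F G w : E3 → ℂ} {q : E3} {h : ℝ → E3}
    (hu : ∀ ε, 0 < ε → MemLp (u ε) 2 (volume : Measure E3)) (hF : MemB F) (hG : MemB G)
    (hf : ∀ ε : ℝ, 0 < ε → (fun x => (ε : ℂ) ^ 3 * f ε (q + ε • x)) = F + fun x => G (x - h ε))
    (hh : Tendsto h (𝓝[>] 0) (cocompact E3))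
    (hsol : ∀ ε, 0 < ε → IsHelmholtzSolution (α ε / ε) (1 / ε ^ 2) (u ε) (f ε))
    (hw : ∀ v : E3 → ℂ, MemB v → Tendsto (fun κ : ℝ => -mulForm (resolv κ) F v) (𝓝[>] 0)
        (𝓝 (∫ x, w x * (starRingEnd ℂ) (v x)))) :
    TendstoWeakStar (fun ε => rescale q ε (u ε)) (𝓝[>] 0) w := by
  intro v hv
  have hκ := tendsto_mul_self hα_pos hα_lim
  have h1 := (hw v hv).comp hκ
  have h2 := tendsto_mulForm_phase_mul_resolv (κ := fun ε => α ε * ε)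
    ((tendsto_nhdsWithin_iff.1 hκ).2) hh hG hv
  have h3 := h1.sub h2
  rw [sub_zero] at h3
  refine h3.congr' ?_
  filter_upwards [self_mem_nhdsWithin] with ε hε
  rw [integral_rescale_mul_conj hε (hα_pos ε hε) (hu ε hε) hF hG (hf ε hε) (hsol ε hε) hv]
  simp only [Function.comp]
  ring

theorem tendstoWeakStar_shifted {κ : ℝ → ℝ} (hκ : ∀ ε, 0 < ε → 0 < κ ε) {a : ℝ → E3 → ℂ}
    {G : E3 → ℂ} {h : ℝ → E3} (hG : MemB G) (hh : Tendsto h (𝓝[>] 0) (cocompact E3))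
    (ha : ∀ ε : ℝ, 0 < ε → MemBstar (a ε) ∧
      IsHelmholtzSolution (κ ε) 1 (a ε) (fun x => G (x - h ε))) :
    TendstoWeakStar a (𝓝[>] 0) (fun _ => 0) := by
  intro v hv
  have hev : ∀ᶠ ε : ℝ in 𝓝[>] 0, 0 < κ ε := by
    filter_upwards [self_mem_nhdsWithin] with ε hε using hκ ε hε
  have h1 := (tendsto_mulForm_phase_mul_resolv hev hh hG hv).neg
  simp only [zero_mul, integral_zero, neg_zero] at h1 ⊢
  refine h1.congr' ?_
  filter_upwards [self_mem_nhdsWithin] with ε hε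
  obtain ⟨h2, h3⟩ := ha ε hε
  rw [h3.integral_mul_conj (hκ ε hε) h2 (memLp_comp_sub hG.memLp _) hv, mulForm_comp_sub _ hG]

end TwoSources

end

theorem proposition3p2
    (S₀ S₁ : TwoSources.E3 → ℂ) (hS₀ : TwoSources.MemB S₀) (hS₁ : TwoSources.MemB S₁)
    (q₁ : TwoSources.E3) (hq₁ : q₁ ≠ 0)
    (α : ℝ → ℝ) (hα_pos : ∀ ε : ℝ, 0 < ε → 0 < α ε) (hα_lim : Tendsto α (𝓝[>] 0) (𝓝 0))
    (u : ℝ → TwoSources.E3 → ℂ)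
    (hu_L2 : ∀ ε : ℝ, 0 < ε → MemLp (u ε) 2 volume)
    (hu : ∀ ε : ℝ, 0 < ε →
      TwoSources.IsHelmholtzSolution (α ε / ε) (1 / ε ^ 2) (u ε)
        (TwoSources.source S₀ S₁ q₁ ε)) :
    -- uniform bounds on the two rescaled families
    (∃ C : ℝ≥0, ∀ ε : ℝ, 0 < ε →
      TwoSources.MemBstar (TwoSources.rescale 0 ε (u ε)) ∧
      TwoSources.MemBstar (TwoSources.rescale q₁ ε (u ε)) ∧
      TwoSources.normBstar (TwoSources.rescale 0 ε (u ε)) ≤ C ∧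
      TwoSources.normBstar (TwoSources.rescale q₁ ε (u ε)) ≤ C) ∧
    -- weak-* convergence to the outgoing solutions
    (∃ w₀ w₁ : TwoSources.E3 → ℂ,
      TwoSources.IsOutgoingSolution w₀ S₀ ∧ TwoSources.IsOutgoingSolution w₁ S₁ ∧
      TwoSources.TendstoWeakStar (fun ε => TwoSources.rescale 0 ε (u ε)) (𝓝[>] 0) w₀ ∧
      TwoSources.TendstoWeakStar (fun ε => TwoSources.rescale q₁ ε (u ε)) (𝓝[>] 0) w₁) ∧
    -- the contributions of the shifted sources vanish in the limit
    (∀ a : ℝ → TwoSources.E3 → ℂ,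
      (∀ ε : ℝ, 0 < ε → TwoSources.MemBstar (a ε) ∧
        TwoSources.IsHelmholtzSolution (α ε * ε) 1 (a ε) (fun x => S₁ (x - ε⁻¹ • q₁))) →
      TwoSources.TendstoWeakStar a (𝓝[>] 0) (fun _ => 0)) ∧
    (∀ b : ℝ → TwoSources.E3 → ℂ,
      (∀ ε : ℝ, 0 < ε → TwoSources.MemBstar (b ε) ∧
        TwoSources.IsHelmholtzSolution (α ε * ε) 1 (b ε) (fun x => S₀ (x + ε⁻¹ • q₁))) →
      TwoSources.TendstoWeakStar b (𝓝[>] 0) (fun _ => 0)) := by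
  have hh := TwoSources.tendsto_inv_smul_cocompact hq₁
  have hh' : Tendsto (fun ε : ℝ => -(ε⁻¹ • q₁)) (𝓝[>] 0) (cocompact TwoSources.E3) := by
    simpa only [smul_neg] using TwoSources.tendsto_inv_smul_cocompact (neg_ne_zero.2 hq₁)
  have hs₀ := fun (ε : ℝ) (hε : 0 < ε) => TwoSources.source_rescale_zero S₀ S₁ q₁ hε
  have hs₁ := fun (ε : ℝ) (hε : 0 < ε) => TwoSources.source_rescale_shift S₀ S₁ q₁ hε
  have hκ : ∀ ε : ℝ, 0 < ε → 0 < α ε * ε := fun ε hε => mul_pos (hα_pos ε hε) hε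
  refine ⟨⟨2 * (16 * (TwoSources.nB S₀ + TwoSources.nB S₁)).toNNReal, fun ε hε =>
    ⟨TwoSources.memBstar_of_memLp (TwoSources.memLp_rescale (hu_L2 ε hε) _ hε),
      TwoSources.memBstar_of_memLp (TwoSources.memLp_rescale (hu_L2 ε hε) _ hε), ?_, ?_⟩⟩,
    ?_, fun a ha => ?_, fun b hb => ?_⟩
  · exact_mod_cast TwoSources.normBstar_rescale_le hε (hα_pos ε hε) (hu_L2 ε hε) hS₀ hS₁
      (hs₀ ε hε) (hu ε hε)
  -- At `q₁` the sources exchange roles, while the constant was fixed with `S₀` first.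
  · rw [add_comm (TwoSources.nB S₀)]
    exact_mod_cast TwoSources.normBstar_rescale_le hε (hα_pos ε hε) (hu_L2 ε hε) hS₁ hS₀
      (hs₁ ε hε) (hu ε hε)
  · obtain ⟨w₀, h₀, hl₀⟩ := TwoSources.exists_isOutgoingSolution hS₀
    obtain ⟨w₁, h₁, hl₁⟩ := TwoSources.exists_isOutgoingSolution hS₁
    exact ⟨w₀, w₁, h₀, h₁,
      TwoSources.tendstoWeakStar_rescale hα_pos hα_lim hu_L2 hS₀ hS₁ hs₀ hh hu hl₀,
      TwoSources.tendstoWeakStar_rescale hα_pos hα_lim hu_L2 hS₁ hS₀ hs₁ hh' hu hl₁⟩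
  · exact TwoSources.tendstoWeakStar_shifted hκ hS₁ hh ha
  · exact TwoSources.tendstoWeakStar_shifted hκ hS₀ hh' fun ε hε => by
      simpa only [sub_neg_eq_add] using hb ε hε
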